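/- Let $R$ be a commutative ring and $n\in\mathbb N$. A (Goresky--MacPherson) $n$-perversity is a map $\overline p:\{0,\dots,n\}\to\mathbb N$ with $\overline p(i)=0$ for $i\le 2$ and $\overline p(i)\le\overline p(i+1)\le\overline p(i)+1$; let $\mathcal P$ be the poset of $n$-perversities, ordered pointwise. A perverse chain complex is a functor from $\mathcal P$ to the category $Ch(R)$ of $\mathbb Z$-graded chain complexes of $R$-modules, with tensor product $(X\boxtimes Y)_{\overline r}=\operatorname{colim}_{\overline p+\overline q\le\overline r}X_{\overline p}\otimes Y_{\overline q}$ and internal Hom $\operatorname{Hom}(X,Y)_{\overline r}=\lim_{\overline r\le\overline q-\overline p}\operatorname{Hom}(X_{\overline p},Y_{\overline q})$. A pDGA $A_\bullet$ is a monoid for $\boxtimes$: an associative unital product $A_{\overline p}\otimes A_{\overline q}\to A_{\overline r}$ for $\overline p+\overline q\le\overline r$, compatible with the structure maps and satisfying the Leibniz rule. A pDG $A_\bullet$-module is a left module over this monoid. For pDG $A_\bullet$-modules $M_\bullet,Z_\bullet$, $\operatorname{Hom}_A(M,Z)_\bullet$ is the subcomplex of the internal Hom of the homogeneous $f$ with $f(a\cdot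 m)=(-1)^{|f||a|}a\cdot f(m)$. Acyclicity of perverse chain complexes is meant in each perversity. Equip the category of pDG $A_\bullet$-modules with Hovey's model structure: weak equivalences (respectively fibrations) are the morphisms that are quasi-isomorphisms (respectively degreewise surjections) in each perversity, and cofibrations are the morphisms with the left lifting property against all morphisms that are both. For $\overline p\in\mathcal P$ let $F_{\overline p}$ be the left adjoint of evaluation at $\overline p$, so $F_{\overline p}(V)_{\overline q}=V$ if $\overline p\le\overline q$ and $0$ otherwise. A perverse chain complex is free if it is isomorphic to $\bigoplus_{\overline p}F_{\overline p}(V_{\overline p})$ for a family of degreewise free chain complexes $V_{\overline p}$. A pDG $A_\bullet$-module $M_\bullet$ is semi-projective if its underlying perverse graded $A_\bullet$-module (forgetting differentials) is projective and $\operatorname{Hom}_A(M,Z)_\bullet$ is acyclic for every acyclic pDG $A_\bullet$-module $Z_\bullet$. It is semi-free if it is the union of an increasing sequence $0=F_{-1}\subset F_0\subset F_1\subset\cdots$ of pDG $A_\bullet$-submodules such that each $F_k/F_{k-1}$ is isomorphic, as a pDG $A_\bullet$-module, to $A\boxtimes K_k$ for some free perverse chain complex $K_k$ with zero differential. Theorem.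 For every pDGA $A_\bullet$ and every pDG $A_\bullet$-module $M_\bullet$, the following are equivalent: (1) $M_\bullet$ is semi-projective; (2) $M_\bullet$ is cofibrant; (3) $M_\bullet$ is a retract of a semi-free pDG $A_\bullet$-module. -/

import Mathlib

open CategoryTheory CategoryTheory.Limits HomotopicalAlgebra
open scoped TensorProduct DirectSum

universe u

/-- A Goresky–MacPherson `n`-perversity: a map `{0, …, n} → ℕ` vanishing at `0, 1, 2` and whose
successive increments are `0` or `1`. -/
@[ext]
structure GMPerversity (n : ℕ) where
  toFun : Fin (n + 1) → ℕ
  zero_of_le_two : ∀ i : Fin (n + 1), (i : ℕ) ≤ 2 → toFun i = 0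
  le_succ : ∀ i : Fin n, toFun i.castSucc ≤ toFun i.succ
  succ_le : ∀ i : Fin n, toFun i.succ ≤ toFun i.castSucc + 1

namespace GMPerversity

variable {n : ℕ}

/-- Perversities are ordered pointwise. -/
instance : PartialOrder (GMPerversity n) :=
  PartialOrder.lift GMPerversity.toFun (fun _ _ h => GMPerversity.ext h)

/-- The zero perversity. -/
instance : Zero (GMPerversity n) :=
  ⟨{ toFun := fun _ => 0
     zero_of_le_two := fun _ _ => rfl
     le_succ := fun _ => le_rfl
     succ_le := fun _ => Nat.zero_le _ }⟩

/-- `SumLE p q r` says that the pointwise sum `p + q` (which need not be a perversity) is `≤ r`. -/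
def SumLE (p q r : GMPerversity n) : Prop := ∀ i, p.toFun i + q.toFun i ≤ r.toFun i

theorem SumLE.mono {p q r p' q' r' : GMPerversity n} (h : SumLE p q r) (hp : p' ≤ p)
    (hq : q' ≤ q) (hr : r ≤ r') : SumLE p' q' r' :=
  fun i => (add_le_add (hp i) (hq i)).trans ((h i).trans (hr i))

theorem sumLE_zero_left {q r : GMPerversity n} (h : q ≤ r) : SumLE 0 q r :=
  fun i => (Nat.zero_add _).le.trans (h i)

theorem sumLE_zero_right {q r : GMPerversity n} (h : q ≤ r) : SumLE q 0 r :=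
  fun i => (Nat.add_zero _).le.trans (h i)

theorem mono_toFun (p : GMPerversity n) : Monotone p.toFun :=
  Fin.monotone_iff_le_succ.2 p.le_succ

theorem toFun_le_add_sub (p : GMPerversity n) {i j : Fin (n + 1)} (h : i ≤ j) :
    p.toFun j ≤ p.toFun i + ((j : ℕ) - i) := by
  have hm : Monotone (fun i : Fin (n + 1) => ((i : ℕ) : ℤ) - p.toFun i) := by
    refine Fin.monotone_iff_le_succ.2 fun i => ?_
    have := p.succ_le i
    simp only [Fin.val_castSucc, Fin.val_succ]
    omega
  have h1 := hm h
  have h2 : (i : ℕ) ≤ j := h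
  simp only at h1
  omega

/-- `p ⊕ q`: the smallest perversity which is `≥ p + q` (defined as soon as some perversity is). -/
def oplus {p q r : GMPerversity n} (h : SumLE p q r) : GMPerversity n where
  toFun i := (Finset.Ici i).sup fun j => p.toFun j + q.toFun j - ((j : ℕ) - i)
  zero_of_le_two i hi := by
    have hr : r.toFun i = 0 := r.zero_of_le_two i hi
    rw [← Nat.le_zero]
    refine Finset.sup_le fun j hj => ?_
    have h1 := r.toFun_le_add_sub (Finset.mem_Ici.1 hj)
    have h2 := h j
    omega
  le_succ i := by
    refine Finset.sup_le fun j hj => ?_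
    have hj' : i.castSucc ≤ j := Finset.mem_Ici.1 hj
    rcases hj'.eq_or_lt with rfl | hlt
    · refine le_trans ?_ (Finset.le_sup (f := fun j : Fin (n + 1) =>
        p.toFun j + q.toFun j - ((j : ℕ) - i.succ)) (Finset.mem_Ici.2 (le_refl i.succ)))
      have := p.le_succ i
      have := q.le_succ i
      simp only [Fin.val_castSucc, Fin.val_succ]
      omega
    · refine le_trans ?_ (Finset.le_sup (f := fun j : Fin (n + 1) =>
        p.toFun j + q.toFun j - ((j : ℕ) - i.succ))
        (Finset.mem_Ici.2 (Fin.castSucc_lt_iff_succ_le.1 hlt)))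
      simp only [Fin.val_castSucc, Fin.val_succ]
      omega
  succ_le i := by
    refine Finset.sup_le fun j hj => ?_
    have hj' : i.succ ≤ j := Finset.mem_Ici.1 hj
    have hle : i.castSucc ≤ j := i.castSucc_lt_succ.le.trans hj'
    have h1 := Finset.le_sup (f := fun j : Fin (n + 1) =>
      p.toFun j + q.toFun j - ((j : ℕ) - i.castSucc)) (Finset.mem_Ici.2 hle)
    have h2 : (i.succ : ℕ) ≤ j := hj'
    simp only [Fin.val_castSucc, Fin.val_succ] at h1 h2 ⊢
    omega

theorem sumLE_oplus {p q r : GMPerversity n} (h : SumLE p q r) : SumLE p q (oplus h) := fun i => by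
  refine le_trans ?_ (Finset.le_sup (f := fun j : Fin (n + 1) =>
    p.toFun j + q.toFun j - ((j : ℕ) - i)) (Finset.mem_Ici.2 (le_refl i)))
  simp

theorem oplus_le {p q r s : GMPerversity n} (h : SumLE p q r) (h' : SumLE p q s) :
    oplus h ≤ s := fun i => by
  simp only [oplus]
  refine Finset.sup_le fun j hj => ?_
  have h1 := s.toFun_le_add_sub (Finset.mem_Ici.1 hj)
  have h2 := h' j
  omega

theorem SumLE.assoc_left {p q r u v : GMPerversity n} (h : SumLE p v u) (h' : SumLE q r v) :
    SumLE p q u := fun i => by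
  have := h i
  have := h' i
  omega

theorem SumLE.symm {p q r : GMPerversity n} (h : SumLE p q r) : SumLE q p r := fun i =>
  (Nat.add_comm _ _).le.trans (h i)

theorem sumLE_oplus_of {p q r u w : GMPerversity n} (h : SumLE p q w)
    (h' : ∀ i, p.toFun i + q.toFun i + r.toFun i ≤ u.toFun i) : SumLE (oplus h) r u := fun i => by
  have key : (oplus h).toFun i ≤ u.toFun i - r.toFun i := by
    simp only [oplus]
    refine Finset.sup_le fun j hj => ?_
    have hij := Finset.mem_Ici.1 hj
    have h1 := u.toFun_le_add_sub hij
    have h2 := h' j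
    have h4 := r.mono_toFun hij
    omega
  have := h' i
  omega

theorem sumLE_oplus_assoc {p q r u v : GMPerversity n} (h : SumLE p v u) (h' : SumLE q r v) :
    SumLE (oplus (h.assoc_left h')) r u :=
  sumLE_oplus_of _ fun i => by
    have := h i
    have := h' i
    omega

end GMPerversity

/-- Perverse chain complexes of `R`-modules (of rank `n`): functors from the poset of
GM-perversities to `ℤ`-graded chain complexes. -/
abbrev PerverseComplex (R : Type u) [CommRing R] (n : ℕ) :=
  GMPerversity n ⥤ ChainComplex (ModuleCat.{u} R) ℤ

/-- Perverse graded `R`-modules: functors from the poset of GM-perversities to `ℤ`-graded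
modules. -/
abbrev PerverseGraded (R : Type u) [CommRing R] (n : ℕ) :=
  GMPerversity n ⥤ GradedObject ℤ (ModuleCat.{u} R)

section

variable {R : Type u} [CommRing R] {n : ℕ}

/-- The structure morphism `X_p → X_q`, `p ≤ q`, in degree `i`. -/
abbrev PerverseComplex.res (X : PerverseComplex R n) {p q : GMPerversity n} (h : p ≤ q) (i : ℤ) :
    (X.obj p).X i →ₗ[R] (X.obj q).X i :=
  ((X.map (homOfLE h)).f i).hom

/-- The differential `(X_p)_i → (X_p)_j`; it is zero unless `j + 1 = i`. -/
abbrev PerverseComplex.diff (X : PerverseComplex R n) (p : GMPerversity n) (i j : ℤ) :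
    (X.obj p).X i →ₗ[R] (X.obj p).X j :=
  ((X.obj p).d i j).hom

/-- The structure morphism `Y_p → Y_q`, `p ≤ q`, in degree `i`. -/
abbrev PerverseGraded.res (Y : PerverseGraded R n) {p q : GMPerversity n} (h : p ≤ q) (i : ℤ) :
    Y.obj p i →ₗ[R] Y.obj q i :=
  (Y.map (homOfLE h) i).hom

namespace PerverseComplex

variable (X Y : PerverseComplex R n)

theorem res_refl (p : GMPerversity n) (i : ℤ) (x : (X.obj p).X i) : X.res (le_refl p) i x = x := by
  simp [res]

theorem res_res {p q r : GMPerversity n} (h : p ≤ q) (h' : q ≤ r) (i : ℤ) (x : (X.obj p).X i) :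
    X.res h' i (X.res h i x) = X.res (h.trans h') i x := by
  have : X.map (homOfLE (h.trans h')) = X.map (homOfLE h) ≫ X.map (homOfLE h') :=
    X.map_comp (homOfLE h) (homOfLE h')
  simp [res, this]

theorem diff_res {p q : GMPerversity n} (h : p ≤ q) (i j : ℤ) (x : (X.obj p).X i) :
    X.diff q i j (X.res h i x) = X.res h j (X.diff p i j x) := by
  have := (X.map (homOfLE h)).comm i j
  exact congrArg (fun f => f.hom x) this

theorem diff_diff (p : GMPerversity n) (i j k : ℤ) (x : (X.obj p).X i) :
    X.diff p j k (X.diff p i j x) = 0 :=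
  congrArg (fun f => f.hom x) ((X.obj p).d_comp_d i j k)

theorem diff_eq_zero (p : GMPerversity n) (i j : ℤ) (h : j + 1 ≠ i) (x : (X.obj p).X i) :
    X.diff p i j x = 0 :=
  congrArg (fun f => f.hom x) ((X.obj p).shape i j h)

end PerverseComplex

/-! ### The tensor product of perverse chain complexes -/

/-- Index set of the direct sum `⨁_{p + q ≤ r} ⨁_{i + j = k}`. -/
structure BoxIndex {n : ℕ} (r : GMPerversity n) (k : ℤ) where
  p : GMPerversity n
  q : GMPerversity n
  i : ℤ
  j : ℤ
  hpq : GMPerversity.SumLE p q r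
  hij : i + j = k

noncomputable instance {n : ℕ} (r : GMPerversity n) (k : ℤ) : DecidableEq (BoxIndex r k) :=
  Classical.decEq _

namespace PerverseComplex

variable (X Y : PerverseComplex R n)

/-- `⨁_{p + q ≤ r} ⨁_{i + j = k} (X_p)_i ⊗ (Y_q)_j`. -/
abbrev BoxPre (r : GMPerversity n) (k : ℤ) : Type u :=
  ⨁ t : BoxIndex r k, ((X.obj t.p).X t.i ⊗[R] (Y.obj t.q).X t.j)

/-- The relations of the colimit over the poset `{(p, q) | p + q ≤ r}`. -/
def boxRel (r : GMPerversity n) (k : ℤ) : Submodule R (BoxPre X Y r k) :=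
  Submodule.span R {z | ∃ (p q p' q' : GMPerversity n) (i j : ℤ) (hpq : GMPerversity.SumLE p q r)
    (hpq' : GMPerversity.SumLE p' q' r) (hij : i + j = k) (hp : p ≤ p') (hq : q ≤ q')
    (x : (X.obj p).X i) (y : (Y.obj q).X j),
    z = DirectSum.lof R (BoxIndex r k)
          (fun t => ((X.obj t.p).X t.i ⊗[R] (Y.obj t.q).X t.j)) ⟨p, q, i, j, hpq, hij⟩ (x ⊗ₜ y) -
        DirectSum.lof R (BoxIndex r k)
          (fun t => ((X.obj t.p).X t.i ⊗[R] (Y.obj t.q).X t.j)) ⟨p', q', i, j, hpq', hij⟩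
          (X.res hp i x ⊗ₜ Y.res hq j y)}

/-- `(X ⊠ Y)_r` in degree `k`, that is
`colim_{p + q ≤ r} ⨁_{i + j = k} (X_p)_i ⊗ (Y_q)_j`. -/
abbrev BoxObj (r : GMPerversity n) (k : ℤ) : Type u := BoxPre X Y r k ⧸ boxRel X Y r k

/-- The class of `x ⊗ y` in `(X ⊠ Y)_r`, bilinearly in `x` and `y`. -/
noncomputable def boxMk {p q r : GMPerversity n} (hpq : GMPerversity.SumLE p q r) {i j k : ℤ}
    (hij : i + j = k) : (X.obj p).X i →ₗ[R] (Y.obj q).X j →ₗ[R] BoxObj X Y r k :=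
  (TensorProduct.mk R ((X.obj p).X i) ((Y.obj q).X j)).compr₂
    ((boxRel X Y r k).mkQ ∘ₗ DirectSum.lof R (BoxIndex r k)
      (fun t => ((X.obj t.p).X t.i ⊗[R] (Y.obj t.q).X t.j)) ⟨p, q, i, j, hpq, hij⟩)

theorem boxMk_res {p q p' q' r : GMPerversity n} (hpq : GMPerversity.SumLE p q r)
    (hpq' : GMPerversity.SumLE p' q' r) {i j k : ℤ} (hij : i + j = k) (hp : p ≤ p') (hq : q ≤ q')
    (x : (X.obj p).X i) (y : (Y.obj q).X j) :
    boxMk X Y hpq' hij (X.res hp i x) (Y.res hq j y) = boxMk X Y hpq hij x y := by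
  symm
  exact (Submodule.Quotient.eq _).2
    (Submodule.subset_span ⟨p, q, p', q', i, j, hpq, hpq', hij, hp, hq, x, y, rfl⟩)

variable {X Y}

theorem box_hom_ext {r : GMPerversity n} {k : ℤ} {N : Type*} [AddCommGroup N] [Module R N]
    {f g : BoxObj X Y r k →ₗ[R] N}
    (h : ∀ (p q : GMPerversity n) (i j : ℤ) (hpq : GMPerversity.SumLE p q r) (hij : i + j = k)
      (x : (X.obj p).X i) (y : (Y.obj q).X j),
      f (boxMk X Y hpq hij x y) = g (boxMk X Y hpq hij x y)) : f = g := by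
  apply Submodule.linearMap_qext
  apply DirectSum.linearMap_ext
  rintro ⟨p, q, i, j, hpq, hij⟩
  apply TensorProduct.ext'
  exact fun x y => h p q i j hpq hij x y

/-- The universal property of `(X ⊠ Y)_r` in degree `k`. -/
noncomputable def boxDesc {r : GMPerversity n} {k : ℤ} {N : Type*} [AddCommGroup N] [Module R N]
    (φ : ∀ (p q : GMPerversity n) (i j : ℤ), GMPerversity.SumLE p q r → i + j = k →
      ((X.obj p).X i →ₗ[R] (Y.obj q).X j →ₗ[R] N))
    (hφ : ∀ (p q p' q' : GMPerversity n) (i j : ℤ) (hpq : GMPerversity.SumLE p q r)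
      (hpq' : GMPerversity.SumLE p' q' r) (hij : i + j = k) (hp : p ≤ p') (hq : q ≤ q')
      (x : (X.obj p).X i) (y : (Y.obj q).X j),
      φ p' q' i j hpq' hij (X.res hp i x) (Y.res hq j y) = φ p q i j hpq hij x y) :
    BoxObj X Y r k →ₗ[R] N :=
  (boxRel X Y r k).liftQ
    (DirectSum.toModule R (BoxIndex r k) N
      (fun t => TensorProduct.lift (φ t.p t.q t.i t.j t.hpq t.hij)))
    (by
      rw [boxRel, Submodule.span_le]
      rintro _ ⟨p, q, p', q', i, j, hpq, hpq', hij, hp, hq, x, y, rfl⟩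
      simp only [SetLike.mem_coe, LinearMap.mem_ker, map_sub, DirectSum.toModule_lof,
        TensorProduct.lift.tmul, sub_eq_zero]
      exact (hφ p q p' q' i j hpq hpq' hij hp hq x y).symm)

theorem boxDesc_mk {r : GMPerversity n} {k : ℤ} {N : Type*} [AddCommGroup N] [Module R N]
    (φ : ∀ (p q : GMPerversity n) (i j : ℤ), GMPerversity.SumLE p q r → i + j = k →
      ((X.obj p).X i →ₗ[R] (Y.obj q).X j →ₗ[R] N)) (hφ)
    {p q : GMPerversity n} {i j : ℤ} (hpq : GMPerversity.SumLE p q r) (hij : i + j = k)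
    (x : (X.obj p).X i) (y : (Y.obj q).X j) :
    boxDesc φ hφ (boxMk X Y hpq hij x y) = φ p q i j hpq hij x y := by
  simp [boxDesc, boxMk]

variable (X Y)

/-- The structure morphisms of `X ⊠ Y`. -/
noncomputable def boxRes {r r' : GMPerversity n} (h : r ≤ r') (k : ℤ) :
    BoxObj X Y r k →ₗ[R] BoxObj X Y r' k :=
  boxDesc (fun _ _ _ _ hpq hij => boxMk X Y (hpq.mono le_rfl le_rfl h) hij)
    (fun _ _ _ _ _ _ _ _ _ hp hq x y => boxMk_res X Y _ _ _ hp hq x y)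

theorem boxRes_mk {r r' : GMPerversity n} (h : r ≤ r') {p q : GMPerversity n} {i j k : ℤ}
    (hpq : GMPerversity.SumLE p q r) (hij : i + j = k) (x : (X.obj p).X i) (y : (Y.obj q).X j) :
    boxRes X Y h k (boxMk X Y hpq hij x y) = boxMk X Y (hpq.mono le_rfl le_rfl h) hij x y :=
  boxDesc_mk _ _ _ _ _ _

/-- The differential `d (x ⊗ y) = dx ⊗ y + (-1)^|x| x ⊗ dy` from degree `k` to degree `l`
(it vanishes unless `l + 1 = k`). -/
noncomputable def boxDiff (r : GMPerversity n) (k l : ℤ) :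
    BoxObj X Y r k →ₗ[R] BoxObj X Y r l :=
  boxDesc
    (fun p q i j hpq _ =>
      (boxMk X Y hpq (sub_add_cancel l j)) ∘ₗ (X.diff p i (l - j)) +
      i.negOnePow • (boxMk X Y hpq (add_sub_cancel i l)).compl₂ (Y.diff q j (l - i)))
    (fun p q p' q' i j hpq hpq' hij hp hq x y => by
      simp only [LinearMap.add_apply, LinearMap.comp_apply, LinearMap.smul_apply,
        LinearMap.compl₂_apply, X.diff_res hp, Y.diff_res hq]
      rw [boxMk_res X Y hpq hpq', boxMk_res X Y hpq hpq'])

theorem boxDiff_mk {r : GMPerversity n} {p q : GMPerversity n} {i j k : ℤ}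
    (hpq : GMPerversity.SumLE p q r) (hij : i + j = k) {i' j' l : ℤ}
    (hi : i' + j = l) (hj : i + j' = l)
    (x : (X.obj p).X i) (y : (Y.obj q).X j) :
    boxDiff X Y r k l (boxMk X Y hpq hij x y) =
      boxMk X Y hpq hi (X.diff p i i' x) y +
        i.negOnePow • boxMk X Y hpq hj x (Y.diff q j j' y) := by
  obtain rfl : i' = l - j := by omega
  obtain rfl : j' = l - i := by omega
  exact boxDesc_mk _ _ _ _ _ _

theorem boxDiff_eq_zero (r : GMPerversity n) (k l : ℤ) (h : l + 1 ≠ k) :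
    boxDiff X Y r k l = 0 := by
  apply box_hom_ext
  intro p q i j hpq hij x y
  rw [boxDiff_mk X Y hpq hij (sub_add_cancel l j) (add_sub_cancel i l),
    X.diff_eq_zero _ _ _ (by omega), Y.diff_eq_zero _ _ _ (by omega)]
  simp

theorem boxDiff_comp_boxDiff (r : GMPerversity n) (k l m : ℤ) (hl : l + 1 = k) (hm : m + 1 = l) :
    boxDiff X Y r l m ∘ₗ boxDiff X Y r k l = 0 := by
  apply box_hom_ext
  intro p q i j hpq hij x y
  rw [LinearMap.comp_apply,
    boxDiff_mk X Y hpq hij (i' := i - 1) (j' := j - 1) (by omega) (by omega), map_add,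
    boxDiff_mk X Y hpq _ (i' := i - 2) (j' := j - 1) (by omega) (by omega),
    map_zsmul_unit, boxDiff_mk X Y hpq _ (i' := i - 1) (j' := j - 2) (by omega) (by omega),
    X.diff_diff, Y.diff_diff]
  simp [Int.negOnePow_sub]

theorem boxDiff_comp_boxRes {r r' : GMPerversity n} (h : r ≤ r') (k l : ℤ) :
    boxDiff X Y r' k l ∘ₗ boxRes X Y h k = boxRes X Y h l ∘ₗ boxDiff X Y r k l := by
  apply box_hom_ext
  intro p q i j hpq hij x y
  rw [LinearMap.comp_apply, LinearMap.comp_apply, boxRes_mk,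
    boxDiff_mk X Y _ hij (sub_add_cancel l j) (add_sub_cancel i l),
    boxDiff_mk X Y _ hij (sub_add_cancel l j) (add_sub_cancel i l), map_add,
    map_zsmul_unit, boxRes_mk, boxRes_mk]

theorem boxRes_refl (r : GMPerversity n) (k : ℤ) :
    boxRes X Y (le_refl r) k = LinearMap.id :=
  box_hom_ext fun _ _ _ _ _ _ _ _ => boxRes_mk X Y _ _ _ _ _

theorem boxRes_comp_boxRes {r r' r'' : GMPerversity n} (h : r ≤ r') (h' : r' ≤ r'') (k : ℤ) :
    boxRes X Y h' k ∘ₗ boxRes X Y h k = boxRes X Y (h.trans h') k := by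
  apply box_hom_ext
  intro p q i j hpq hij x y
  rw [LinearMap.comp_apply, boxRes_mk, boxRes_mk, boxRes_mk]

/-- The chain complex `(X ⊠ Y)_r`. -/
noncomputable def boxComplex (r : GMPerversity n) : ChainComplex (ModuleCat.{u} R) ℤ where
  X k := ModuleCat.of R (BoxObj X Y r k)
  d k l := ModuleCat.ofHom (boxDiff X Y r k l)
  shape k l h := by rw [boxDiff_eq_zero X Y r k l h]; rfl
  d_comp_d' k l m hl hm := by
    rw [← ModuleCat.ofHom_comp, boxDiff_comp_boxDiff X Y r k l m hl hm]; rfl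

/-- The structure morphisms of `X ⊠ Y` as chain maps. -/
noncomputable def boxMap {r r' : GMPerversity n} (h : r ≤ r') :
    boxComplex X Y r ⟶ boxComplex X Y r' where
  f k := ModuleCat.ofHom (boxRes X Y h k)
  comm' k l _ := ModuleCat.hom_ext (boxDiff_comp_boxRes X Y h k l)

/-- The tensor product `X ⊠ Y` of perverse chain complexes. -/
noncomputable def box : PerverseComplex R n where
  obj r := boxComplex X Y r
  map f := boxMap X Y (leOfHom f)
  map_id r := HomologicalComplex.hom_ext _ _
    fun k => ModuleCat.hom_ext (boxRes_refl X Y r k)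
  map_comp f g := HomologicalComplex.hom_ext _ _
    fun k => ModuleCat.hom_ext (boxRes_comp_boxRes X Y (leOfHom f) (leOfHom g) k).symm

end PerverseComplex

/-! ### Perverse differential graded algebras and their modules -/

variable (R n) in
/-- A perverse differential graded `R`-algebra: a perverse chain complex with a unital associative
product `A_p ⊗ A_q → A_r` for all `p + q ≤ r` (equivalently a map `A ⊠ A → A`, or products
`A_p ⊗ A_q → A_{p ⊕ q}`), compatible with the structure morphisms and for which the differential
is a derivation. -/
structure PDGAlgebra where
  X : PerverseComplex R n
  one : (X.obj 0).X 0
  mul : ∀ {p q r : GMPerversity n} (_ : GMPerversity.SumLE p q r) {i j k : ℤ} (_ : i + j = k),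
    (X.obj p).X i →ₗ[R] (X.obj q).X j →ₗ[R] (X.obj r).X k
  res_mul : ∀ {p q r p' q' r' : GMPerversity n} (h : GMPerversity.SumLE p q r)
    (h' : GMPerversity.SumLE p' q' r') (hp : p ≤ p') (hq : q ≤ q') (hr : r ≤ r')
    {i j k : ℤ} (e : i + j = k) (a : (X.obj p).X i) (b : (X.obj q).X j),
    X.res hr k (mul h e a b) = mul h' e (X.res hp i a) (X.res hq j b)
  one_mul : ∀ {q r : GMPerversity n} (h : q ≤ r) {j : ℤ} (b : (X.obj q).X j),
    mul (GMPerversity.sumLE_zero_left h) (zero_add j) one b = X.res h j b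
  mul_one : ∀ {q r : GMPerversity n} (h : q ≤ r) {j : ℤ} (b : (X.obj q).X j),
    mul (GMPerversity.sumLE_zero_right h) (add_zero j) b one = X.res h j b
  mul_assoc : ∀ {p q r u v s : GMPerversity n} (h₁ : GMPerversity.SumLE p q u)
    (h₂ : GMPerversity.SumLE u r s) (h₃ : GMPerversity.SumLE q r v) (h₄ : GMPerversity.SumLE p v s)
    {i j k l m t : ℤ} (e₁ : i + j = l) (e₂ : l + k = t) (e₃ : j + k = m) (e₄ : i + m = t)
    (a : (X.obj p).X i) (b : (X.obj q).X j) (c : (X.obj r).X k),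
    mul h₂ e₂ (mul h₁ e₁ a b) c = mul h₄ e₄ a (mul h₃ e₃ b c)
  leibniz : ∀ {p q r : GMPerversity n} (h : GMPerversity.SumLE p q r) {i j k i' j' k' : ℤ}
    (e : i + j = k) (e₁ : i' + j = k') (e₂ : i + j' = k') (_ : k' + 1 = k)
    (a : (X.obj p).X i) (b : (X.obj q).X j),
    X.diff r k k' (mul h e a b) =
      mul h e₁ (X.diff p i i' a) b + i.negOnePow • mul h e₂ a (X.diff q j j' b)

/-- A (left) perverse graded `A`-module: the differentials are ignored. -/
structure PGModule (A : PDGAlgebra.{u} R n) where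
  X : PerverseGraded R n
  smul : ∀ {p q r : GMPerversity n} (_ : GMPerversity.SumLE p q r) {i j k : ℤ} (_ : i + j = k),
    (A.X.obj p).X i →ₗ[R] X.obj q j →ₗ[R] X.obj r k
  res_smul : ∀ {p q r p' q' r' : GMPerversity n} (h : GMPerversity.SumLE p q r)
    (h' : GMPerversity.SumLE p' q' r') (hp : p ≤ p') (hq : q ≤ q') (hr : r ≤ r')
    {i j k : ℤ} (e : i + j = k) (a : (A.X.obj p).X i) (x : X.obj q j),
    X.res hr k (smul h e a x) = smul h' e (A.X.res hp i a) (X.res hq j x)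
  one_smul : ∀ {q r : GMPerversity n} (h : q ≤ r) {j : ℤ} (x : X.obj q j),
    smul (GMPerversity.sumLE_zero_left h) (zero_add j) A.one x = X.res h j x
  mul_smul : ∀ {p q r u v s : GMPerversity n} (h₁ : GMPerversity.SumLE p q u)
    (h₂ : GMPerversity.SumLE u r s) (h₃ : GMPerversity.SumLE q r v) (h₄ : GMPerversity.SumLE p v s)
    {i j k l m t : ℤ} (e₁ : i + j = l) (e₂ : l + k = t) (e₃ : j + k = m) (e₄ : i + m = t)
    (a : (A.X.obj p).X i) (b : (A.X.obj q).X j) (x : X.obj r k),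
    smul h₂ e₂ (A.mul h₁ e₁ a b) x = smul h₄ e₄ a (smul h₃ e₃ b x)

/-- A (left) perverse differential graded `A`-module. -/
structure PDGModule (A : PDGAlgebra.{u} R n) where
  X : PerverseComplex R n
  smul : ∀ {p q r : GMPerversity n} (_ : GMPerversity.SumLE p q r) {i j k : ℤ} (_ : i + j = k),
    (A.X.obj p).X i →ₗ[R] (X.obj q).X j →ₗ[R] (X.obj r).X k
  res_smul : ∀ {p q r p' q' r' : GMPerversity n} (h : GMPerversity.SumLE p q r)
    (h' : GMPerversity.SumLE p' q' r') (hp : p ≤ p') (hq : q ≤ q') (hr : r ≤ r')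
    {i j k : ℤ} (e : i + j = k) (a : (A.X.obj p).X i) (x : (X.obj q).X j),
    X.res hr k (smul h e a x) = smul h' e (A.X.res hp i a) (X.res hq j x)
  one_smul : ∀ {q r : GMPerversity n} (h : q ≤ r) {j : ℤ} (x : (X.obj q).X j),
    smul (GMPerversity.sumLE_zero_left h) (zero_add j) A.one x = X.res h j x
  mul_smul : ∀ {p q r u v s : GMPerversity n} (h₁ : GMPerversity.SumLE p q u)
    (h₂ : GMPerversity.SumLE u r s) (h₃ : GMPerversity.SumLE q r v) (h₄ : GMPerversity.SumLE p v s)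
    {i j k l m t : ℤ} (e₁ : i + j = l) (e₂ : l + k = t) (e₃ : j + k = m) (e₄ : i + m = t)
    (a : (A.X.obj p).X i) (b : (A.X.obj q).X j) (x : (X.obj r).X k),
    smul h₂ e₂ (A.mul h₁ e₁ a b) x = smul h₄ e₄ a (smul h₃ e₃ b x)
  leibniz : ∀ {p q r : GMPerversity n} (h : GMPerversity.SumLE p q r) {i j k i' j' k' : ℤ}
    (e : i + j = k) (e₁ : i' + j = k') (e₂ : i + j' = k') (_ : k' + 1 = k)
    (a : (A.X.obj p).X i) (x : (X.obj q).X j),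
    X.diff r k k' (smul h e a x) =
      smul h e₁ (A.X.diff p i i' a) x + i.negOnePow • smul h e₂ a (X.diff q j j' x)

/-- Morphisms of perverse graded `A`-modules. -/
@[ext]
structure PGModule.Hom {A : PDGAlgebra.{u} R n} (M N : PGModule A) where
  hom : M.X ⟶ N.X
  map_smul : ∀ {p q r : GMPerversity n} (h : GMPerversity.SumLE p q r) {i j k : ℤ} (e : i + j = k)
    (a : (A.X.obj p).X i) (x : M.X.obj q j),
    (hom.app r k).hom (M.smul h e a x) = N.smul h e a ((hom.app q j).hom x)

/-- Morphisms of pDG `A`-modules. -/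
@[ext]
structure PDGModule.Hom {A : PDGAlgebra.{u} R n} (M N : PDGModule A) where
  hom : M.X ⟶ N.X
  map_smul : ∀ {p q r : GMPerversity n} (h : GMPerversity.SumLE p q r) {i j k : ℤ} (e : i + j = k)
    (a : (A.X.obj p).X i) (x : (M.X.obj q).X j),
    ((hom.app r).f k).hom (M.smul h e a x) = N.smul h e a (((hom.app q).f j).hom x)

instance (A : PDGAlgebra.{u} R n) : Category (PGModule A) where
  Hom := PGModule.Hom
  id M := ⟨𝟙 M.X, fun _ _ _ _ _ _ _ => rfl⟩
  comp f g := ⟨f.hom ≫ g.hom, fun {_ _ r} h {_ _ k} e a x =>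
    (congrArg (g.hom.app r k).hom (f.map_smul h e a x)).trans (g.map_smul h e a _)⟩
  id_comp f := PGModule.Hom.ext (Category.id_comp f.hom)
  comp_id f := PGModule.Hom.ext (Category.comp_id f.hom)
  assoc f g h := PGModule.Hom.ext (Category.assoc f.hom g.hom h.hom)

instance (A : PDGAlgebra.{u} R n) : Category (PDGModule A) where
  Hom := PDGModule.Hom
  id M := ⟨𝟙 M.X, fun _ _ _ _ _ _ _ => rfl⟩
  comp f g := ⟨f.hom ≫ g.hom, fun {_ _ r} h {_ _ k} e a x =>
    (congrArg ((g.hom.app r).f k).hom (f.map_smul h e a x)).trans (g.map_smul h e a _)⟩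
  id_comp f := PDGModule.Hom.ext (Category.id_comp f.hom)
  comp_id f := PDGModule.Hom.ext (Category.comp_id f.hom)
  assoc f g h := PDGModule.Hom.ext (Category.assoc f.hom g.hom h.hom)

namespace PDGModule

variable {A : PDGAlgebra.{u} R n}

/-- The underlying perverse graded `A`-module. -/
def toGraded (M : PDGModule A) : PGModule A where
  X := M.X ⋙ HomologicalComplex.forget _ _
  smul h _ _ _ e := M.smul h e
  res_smul h h' hp hq hr _ _ _ e a x := M.res_smul h h' hp hq hr e a x
  one_smul h _ x := M.one_smul h x
  mul_smul h₁ h₂ h₃ h₄ _ _ _ _ _ _ e₁ e₂ e₃ e₄ a b x :=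
    M.mul_smul h₁ h₂ h₃ h₄ e₁ e₂ e₃ e₄ a b x

/-! ### The free module `A ⊠ K` -/

section Free

variable (A) (K : PerverseComplex R n)

/-- The map `b ⊗ x ↦ (a b) ⊗ x` on `A ⊠ K`. -/
noncomputable def freeSMulAux {p q r : GMPerversity n} (h : GMPerversity.SumLE p q r) {i j k : ℤ}
    (e : i + j = k) (a : (A.X.obj p).X i) : A.X.BoxObj K q j →ₗ[R] A.X.BoxObj K r k :=
  PerverseComplex.boxDesc (X := A.X) (Y := K)
    (fun _ _ i₁ j₁ h' e' =>
      PerverseComplex.boxMk A.X K (GMPerversity.sumLE_oplus_assoc h h')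
        (show (i + i₁) + j₁ = k by omega) ∘ₗ
          A.mul (GMPerversity.sumLE_oplus (h.assoc_left h')) rfl a)
    (fun p₁ q₁ p₂ q₂ i₁ j₁ h₁ h₂ e' hp hq b x => by
      have hle : GMPerversity.oplus (h.assoc_left h₁) ≤ GMPerversity.oplus (h.assoc_left h₂) :=
        GMPerversity.oplus_le _ ((GMPerversity.sumLE_oplus (h.assoc_left h₂)).mono le_rfl hp le_rfl)
      rw [LinearMap.comp_apply, LinearMap.comp_apply,
        ← PerverseComplex.boxMk_res A.X K _ (GMPerversity.sumLE_oplus_assoc h h₂) _ hle hq,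
        A.res_mul _ (GMPerversity.sumLE_oplus (h.assoc_left h₂)) le_rfl hp, A.X.res_refl])

theorem freeSMulAux_mk {p q r p₁ q₁ w : GMPerversity n} (h : GMPerversity.SumLE p q r)
    {i j k i₁ j₁ l : ℤ} (e : i + j = k) (a : (A.X.obj p).X i)
    (h' : GMPerversity.SumLE p₁ q₁ q) (e' : i₁ + j₁ = j) (hw : GMPerversity.SumLE p p₁ w)
    (hw' : GMPerversity.SumLE w q₁ r) (el : i + i₁ = l) (el' : l + j₁ = k)
    (b : (A.X.obj p₁).X i₁) (x : (K.obj q₁).X j₁) :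
    freeSMulAux A K h e a (PerverseComplex.boxMk A.X K h' e' b x) =
      PerverseComplex.boxMk A.X K hw' el' (A.mul hw el a b) x := by
  subst el
  have hle : GMPerversity.oplus (h.assoc_left h') ≤ w := GMPerversity.oplus_le _ hw
  rw [freeSMulAux, PerverseComplex.boxDesc_mk, LinearMap.comp_apply,
    ← PerverseComplex.boxMk_res A.X K _ hw' _ hle le_rfl, A.res_mul _ hw le_rfl le_rfl,
    A.X.res_refl, A.X.res_refl, K.res_refl]

/-- The action `a · (b ⊗ x) = (a b) ⊗ x` of `A` on `A ⊠ K`. -/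
noncomputable def freeSMul {p q r : GMPerversity n} (h : GMPerversity.SumLE p q r) {i j k : ℤ}
    (e : i + j = k) :
    (A.X.obj p).X i →ₗ[R] A.X.BoxObj K q j →ₗ[R] A.X.BoxObj K r k where
  toFun := freeSMulAux A K h e
  map_add' a a' := PerverseComplex.box_hom_ext fun p₁ q₁ i₁ j₁ h' e' b x => by
    have hw := GMPerversity.sumLE_oplus (h.assoc_left h')
    have hw' := GMPerversity.sumLE_oplus_assoc h h'
    rw [LinearMap.add_apply, freeSMulAux_mk A K h e _ h' e' hw hw' rfl (by omega),
      freeSMulAux_mk A K h e _ h' e' hw hw' rfl (by omega),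
      freeSMulAux_mk A K h e _ h' e' hw hw' rfl (by omega), map_add, LinearMap.add_apply,
      map_add, LinearMap.add_apply]
  map_smul' c a := PerverseComplex.box_hom_ext fun p₁ q₁ i₁ j₁ h' e' b x => by
    have hw := GMPerversity.sumLE_oplus (h.assoc_left h')
    have hw' := GMPerversity.sumLE_oplus_assoc h h'
    rw [RingHom.id_apply, LinearMap.smul_apply,
      freeSMulAux_mk A K h e _ h' e' hw hw' rfl (by omega),
      freeSMulAux_mk A K h e _ h' e' hw hw' rfl (by omega), map_smul, LinearMap.smul_apply,
      map_smul, LinearMap.smul_apply]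

theorem freeSMul_mk {p q r p₁ q₁ w : GMPerversity n} (h : GMPerversity.SumLE p q r)
    {i j k i₁ j₁ l : ℤ} (e : i + j = k) (a : (A.X.obj p).X i)
    (h' : GMPerversity.SumLE p₁ q₁ q) (e' : i₁ + j₁ = j) (hw : GMPerversity.SumLE p p₁ w)
    (hw' : GMPerversity.SumLE w q₁ r) (el : i + i₁ = l) (el' : l + j₁ = k)
    (b : (A.X.obj p₁).X i₁) (x : (K.obj q₁).X j₁) :
    freeSMul A K h e a (PerverseComplex.boxMk A.X K h' e' b x) =
      PerverseComplex.boxMk A.X K hw' el' (A.mul hw el a b) x :=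
  freeSMulAux_mk A K h e a h' e' hw hw' el el' b x

theorem free_res_smul {p q r p' q' r' : GMPerversity n} (h : GMPerversity.SumLE p q r)
    (h' : GMPerversity.SumLE p' q' r') (hp : p ≤ p') (hq : q ≤ q') (hr : r ≤ r')
    {i j k : ℤ} (e : i + j = k) (a : (A.X.obj p).X i) :
    A.X.boxRes K hr k ∘ₗ freeSMul A K h e a =
      freeSMul A K h' e (A.X.res hp i a) ∘ₗ A.X.boxRes K hq j :=
  PerverseComplex.box_hom_ext fun p₁ q₁ i₁ j₁ h₁ e₁ b x => by
    have h₁' : GMPerversity.SumLE p₁ q₁ q' := h₁.mono le_rfl le_rfl hq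
    have hle : GMPerversity.oplus (h.assoc_left h₁) ≤ GMPerversity.oplus (h'.assoc_left h₁') :=
      GMPerversity.oplus_le _ ((GMPerversity.sumLE_oplus (h'.assoc_left h₁')).mono hp le_rfl le_rfl)
    rw [LinearMap.comp_apply, LinearMap.comp_apply, PerverseComplex.boxRes_mk,
      freeSMul_mk A K h e a h₁ e₁ (GMPerversity.sumLE_oplus (h.assoc_left h₁))
        (GMPerversity.sumLE_oplus_assoc h h₁) rfl (by omega),
      freeSMul_mk A K h' e _ h₁' e₁ (GMPerversity.sumLE_oplus (h'.assoc_left h₁'))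
        (GMPerversity.sumLE_oplus_assoc h' h₁') rfl (by omega),
      PerverseComplex.boxRes_mk,
      ← PerverseComplex.boxMk_res A.X K _ (GMPerversity.sumLE_oplus_assoc h' h₁') _ hle le_rfl,
      A.res_mul _ (GMPerversity.sumLE_oplus (h'.assoc_left h₁')) hp le_rfl,
      A.X.res_refl, K.res_refl]

theorem free_one_smul {q r : GMPerversity n} (h : q ≤ r) (j : ℤ) :
    freeSMul A K (GMPerversity.sumLE_zero_left h) (zero_add j) A.one = A.X.boxRes K h j :=
  PerverseComplex.box_hom_ext fun p₁ q₁ i₁ j₁ h₁ e₁ b x => by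
    rw [PerverseComplex.boxRes_mk,
      freeSMul_mk A K _ _ _ h₁ e₁ (GMPerversity.sumLE_zero_left (le_refl p₁))
        (h₁.mono le_rfl le_rfl h) (zero_add i₁) e₁, A.one_mul (le_refl p₁), A.X.res_refl]

theorem free_mul_smul {p q r u v s : GMPerversity n} (h₁ : GMPerversity.SumLE p q u)
    (h₂ : GMPerversity.SumLE u r s) (h₃ : GMPerversity.SumLE q r v) (h₄ : GMPerversity.SumLE p v s)
    {i j k l m t : ℤ} (e₁ : i + j = l) (e₂ : l + k = t) (e₃ : j + k = m) (e₄ : i + m = t)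
    (a : (A.X.obj p).X i) (b : (A.X.obj q).X j) :
    freeSMul A K h₂ e₂ (A.mul h₁ e₁ a b) = freeSMul A K h₄ e₄ a ∘ₗ freeSMul A K h₃ e₃ b :=
  PerverseComplex.box_hom_ext fun p₁ q₁ i₁ j₁ h' e' c x => by
    have hv := GMPerversity.sumLE_oplus (h₃.assoc_left h')
    have hv' := GMPerversity.sumLE_oplus_assoc h₃ h'
    have hu := GMPerversity.sumLE_oplus (h₂.assoc_left h')
    have hu' := GMPerversity.sumLE_oplus_assoc h₂ h'
    have hs : GMPerversity.SumLE p (GMPerversity.oplus (h₃.assoc_left h'))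
        (GMPerversity.oplus (h₂.assoc_left h')) := by
      refine (GMPerversity.sumLE_oplus_of _ fun i => ?_).symm
      have := hu i
      have := h₁ i
      omega
    rw [LinearMap.comp_apply, freeSMul_mk A K h₃ e₃ b h' e' hv hv' rfl (by omega),
      freeSMul_mk A K h₄ e₄ a hv' _ hs hu' (l := l + i₁) (by omega) (by omega),
      freeSMul_mk A K h₂ e₂ _ h' e' hu hu' rfl (by omega),
      A.mul_assoc h₁ hu hv hs e₁ rfl rfl (by omega)]

theorem free_leibniz {p q r : GMPerversity n} (h : GMPerversity.SumLE p q r) {i j k i' j' k' : ℤ}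
    (e : i + j = k) (e₁ : i' + j = k') (e₂ : i + j' = k') (hk : k' + 1 = k)
    (a : (A.X.obj p).X i) :
    A.X.boxDiff K r k k' ∘ₗ freeSMul A K h e a =
      freeSMul A K h e₁ (A.X.diff p i i' a) +
        i.negOnePow • (freeSMul A K h e₂ a ∘ₗ A.X.boxDiff K q j j') :=
  PerverseComplex.box_hom_ext fun p₁ q₁ i₁ j₁ h₁ e' b x => by
    have hw := GMPerversity.sumLE_oplus (h.assoc_left h₁)
    have hw' := GMPerversity.sumLE_oplus_assoc h h₁
    rw [LinearMap.add_apply, LinearMap.smul_apply, LinearMap.comp_apply, LinearMap.comp_apply,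
      freeSMul_mk A K h e a h₁ e' hw hw' (l := i + i₁) rfl (by omega),
      freeSMul_mk A K h e₁ _ h₁ e' hw hw' (l := i' + i₁) rfl (by omega),
      PerverseComplex.boxDiff_mk A.X K hw' _ (i' := i' + i₁) (j' := j₁ - 1) (by omega) (by omega),
      PerverseComplex.boxDiff_mk A.X K h₁ e' (i' := i₁ - 1) (j' := j₁ - 1) (by omega) (by omega),
      map_add, map_zsmul_unit,
      freeSMul_mk A K h e₂ a h₁ _ hw hw' (l := i' + i₁) (by omega) (by omega),
      freeSMul_mk A K h e₂ a h₁ _ hw hw' (l := i + i₁) (by omega) (by omega),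
      A.leibniz hw (i' := i') (j' := i₁ - 1) rfl rfl (by omega) (by omega)]
    simp only [map_add, map_zsmul_unit, LinearMap.add_apply, LinearMap.smul_apply, smul_add,
      smul_smul, Int.negOnePow_add]
    abel

/-- The pDG `A`-module `A ⊠ K`. -/
noncomputable def free : PDGModule A where
  X := A.X.box K
  smul h _ _ _ e := freeSMul A K h e
  res_smul h h' hp hq hr _ _ _ e a x := LinearMap.congr_fun (free_res_smul A K h h' hp hq hr e a) x
  one_smul h j x := LinearMap.congr_fun (free_one_smul A K h j) x
  mul_smul h₁ h₂ h₃ h₄ _ _ _ _ _ _ e₁ e₂ e₃ e₄ a b x :=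
    LinearMap.congr_fun (free_mul_smul A K h₁ h₂ h₃ h₄ e₁ e₂ e₃ e₄ a b) x
  leibniz h _ _ _ _ _ _ e e₁ e₂ hk a x :=
    LinearMap.congr_fun (free_leibniz A K h e e₁ e₂ hk a) x

end Free

/-! ### pDG submodules and quotients -/

/-- A pDG `A`-submodule of `M`. -/
structure Sub (M : PDGModule A) where
  carrier : ∀ (p : GMPerversity n) (i : ℤ), Submodule R ((M.X.obj p).X i)
  res_mem : ∀ {p q : GMPerversity n} (h : p ≤ q) {i : ℤ} {x : (M.X.obj p).X i},
    x ∈ carrier p i → M.X.res h i x ∈ carrier q i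
  diff_mem : ∀ {p : GMPerversity n} (i j : ℤ) {x : (M.X.obj p).X i},
    x ∈ carrier p i → M.X.diff p i j x ∈ carrier p j
  smul_mem : ∀ {p q r : GMPerversity n} (h : GMPerversity.SumLE p q r) {i j k : ℤ} (e : i + j = k)
    (a : (A.X.obj p).X i) {x : (M.X.obj q).X j},
    x ∈ carrier q j → M.smul h e a x ∈ carrier r k

namespace Sub

variable {M : PDGModule A} (N' N : Sub M)

/-- The component of `N' / N` (where `N ≤ N'`) in perversity `p` and degree `i`. -/
abbrev QuotObj (p : GMPerversity n) (i : ℤ) : Type u :=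
  N'.carrier p i ⧸ (N.carrier p i).submoduleOf (N'.carrier p i)

/-- A linear map preserving `N'` and `N` descends to `N' / N`. -/
def quotMap {p q : GMPerversity n} {i j : ℤ} (f : (M.X.obj p).X i →ₗ[R] (M.X.obj q).X j)
    (hf' : ∀ x ∈ N'.carrier p i, f x ∈ N'.carrier q j)
    (hf : ∀ x ∈ N.carrier p i, f x ∈ N.carrier q j) : QuotObj N' N p i →ₗ[R] QuotObj N' N q j :=
  Submodule.mapQ _ _ (f.restrict hf') fun x hx => hf x.1 hx

theorem quot_hom_ext {p : GMPerversity n} {i : ℤ} {P : Type*} [AddCommGroup P] [Module R P]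
    {f g : QuotObj N' N p i →ₗ[R] P}
    (h : ∀ x : N'.carrier p i, f (Submodule.Quotient.mk x) = g (Submodule.Quotient.mk x)) :
    f = g :=
  Submodule.linearMap_qext _ (LinearMap.ext h)

/-- The chain complex `(N' / N)_p`. -/
def quotComplex (p : GMPerversity n) : ChainComplex (ModuleCat.{u} R) ℤ where
  X i := ModuleCat.of R (QuotObj N' N p i)
  d i j := ModuleCat.ofHom (quotMap N' N (M.X.diff p i j) (fun _ => N'.diff_mem i j)
    (fun _ => N.diff_mem i j))
  shape i j h := ModuleCat.hom_ext <| quot_hom_ext N' N fun x =>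
    congrArg Submodule.Quotient.mk (Subtype.ext (M.X.diff_eq_zero p i j h x.1))
  d_comp_d' i j k _ _ := ModuleCat.hom_ext <| quot_hom_ext N' N fun x =>
    congrArg Submodule.Quotient.mk (Subtype.ext (M.X.diff_diff p i j k x.1))

/-- The structure morphisms of `N' / N`. -/
def quotRes {p q : GMPerversity n} (h : p ≤ q) : quotComplex N' N p ⟶ quotComplex N' N q where
  f i := ModuleCat.ofHom (quotMap N' N (M.X.res h i) (fun _ => N'.res_mem h)
    (fun _ => N.res_mem h))
  comm' i j _ := ModuleCat.hom_ext <| quot_hom_ext N' N fun x =>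
    congrArg Submodule.Quotient.mk (Subtype.ext (M.X.diff_res h i j x.1))

/-- The perverse chain complex `N' / N`. -/
def quotPerverse : PerverseComplex R n where
  obj := quotComplex N' N
  map f := quotRes N' N (leOfHom f)
  map_id p := HomologicalComplex.hom_ext _ _ fun i => ModuleCat.hom_ext <|
    quot_hom_ext N' N fun x =>
      congrArg Submodule.Quotient.mk (Subtype.ext (M.X.res_refl p i x.1))
  map_comp f g := HomologicalComplex.hom_ext _ _ fun i => ModuleCat.hom_ext <|
    quot_hom_ext N' N fun x => congrArg Submodule.Quotient.mk
      (Subtype.ext (M.X.res_res (leOfHom f) (leOfHom g) i x.1).symm)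

/-- The action of `A` on `N' / N`. -/
def quotSMul {p q r : GMPerversity n} (h : GMPerversity.SumLE p q r) {i j k : ℤ} (e : i + j = k) :
    (A.X.obj p).X i →ₗ[R] QuotObj N' N q j →ₗ[R] QuotObj N' N r k where
  toFun a := quotMap N' N (M.smul h e a) (fun _ => N'.smul_mem h e a)
    (fun _ => N.smul_mem h e a)
  map_add' a b := quot_hom_ext N' N fun x => congrArg Submodule.Quotient.mk
    (Subtype.ext (LinearMap.congr_fun (map_add (M.smul h e) a b) x.1))
  map_smul' c a := quot_hom_ext N' N fun x => congrArg Submodule.Quotient.mk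
    (Subtype.ext (LinearMap.congr_fun (map_smul (M.smul h e) c a) x.1))

theorem quot_res_smul {p q r p' q' r' : GMPerversity n} (h : GMPerversity.SumLE p q r)
    (h' : GMPerversity.SumLE p' q' r') (hp : p ≤ p') (hq : q ≤ q') (hr : r ≤ r')
    {i j k : ℤ} (e : i + j = k) (a : (A.X.obj p).X i) :
    quotMap N' N (M.X.res hr k) (fun _ => N'.res_mem hr) (fun _ => N.res_mem hr) ∘ₗ
        quotSMul N' N h e a =
      quotSMul N' N h' e (A.X.res hp i a) ∘ₗ
        quotMap N' N (M.X.res hq j) (fun _ => N'.res_mem hq) (fun _ => N.res_mem hq) :=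
  quot_hom_ext N' N fun x => congrArg Submodule.Quotient.mk
    (Subtype.ext (M.res_smul h h' hp hq hr e a x.1))

theorem quot_one_smul {q r : GMPerversity n} (h : q ≤ r) (j : ℤ) :
    quotSMul N' N (GMPerversity.sumLE_zero_left h) (zero_add j) A.one =
      quotMap N' N (M.X.res h j) (fun _ => N'.res_mem h) (fun _ => N.res_mem h) :=
  quot_hom_ext N' N fun x => congrArg Submodule.Quotient.mk (Subtype.ext (M.one_smul h x.1))

theorem quot_mul_smul {p q r u v s : GMPerversity n} (h₁ : GMPerversity.SumLE p q u)
    (h₂ : GMPerversity.SumLE u r s) (h₃ : GMPerversity.SumLE q r v) (h₄ : GMPerversity.SumLE p v s)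
    {i j k l m t : ℤ} (e₁ : i + j = l) (e₂ : l + k = t) (e₃ : j + k = m) (e₄ : i + m = t)
    (a : (A.X.obj p).X i) (b : (A.X.obj q).X j) :
    quotSMul N' N h₂ e₂ (A.mul h₁ e₁ a b) = quotSMul N' N h₄ e₄ a ∘ₗ quotSMul N' N h₃ e₃ b :=
  quot_hom_ext N' N fun x => congrArg Submodule.Quotient.mk
    (Subtype.ext (M.mul_smul h₁ h₂ h₃ h₄ e₁ e₂ e₃ e₄ a b x.1))

theorem quot_leibniz {p q r : GMPerversity n} (h : GMPerversity.SumLE p q r) {i j k i' j' k' : ℤ}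
    (e : i + j = k) (e₁ : i' + j = k') (e₂ : i + j' = k') (hk : k' + 1 = k)
    (a : (A.X.obj p).X i) :
    quotMap N' N (M.X.diff r k k') (fun _ => N'.diff_mem k k') (fun _ => N.diff_mem k k') ∘ₗ
        quotSMul N' N h e a =
      quotSMul N' N h e₁ (A.X.diff p i i' a) +
        i.negOnePow • (quotSMul N' N h e₂ a ∘ₗ
          quotMap N' N (M.X.diff q j j') (fun _ => N'.diff_mem j j') (fun _ => N.diff_mem j j')) :=
  quot_hom_ext N' N fun x => congrArg Submodule.Quotient.mk
    (Subtype.ext (M.leibniz h e e₁ e₂ hk a x.1))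

/-- The pDG `A`-module `N' / N`, for pDG submodules `N ≤ N'` of `M`. -/
def quotient : PDGModule A where
  X := quotPerverse N' N
  smul h _ _ _ e := quotSMul N' N h e
  res_smul h h' hp hq hr _ _ _ e a x :=
    LinearMap.congr_fun (quot_res_smul N' N h h' hp hq hr e a) x
  one_smul h j x := LinearMap.congr_fun (quot_one_smul N' N h j) x
  mul_smul h₁ h₂ h₃ h₄ _ _ _ _ _ _ e₁ e₂ e₃ e₄ a b x :=
    LinearMap.congr_fun (quot_mul_smul N' N h₁ h₂ h₃ h₄ e₁ e₂ e₃ e₄ a b) x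
  leibniz h _ _ _ _ _ _ e e₁ e₂ hk a x :=
    LinearMap.congr_fun (quot_leibniz N' N h e e₁ e₂ hk a) x

end Sub

/-! ### The perverse chain complex `Hom_A(M, Z)` -/

/-- Index set of the families of maps `(M_p)_i → (Z_q)_j`, `p + r ≤ q`, `j - i = k`. -/
structure HomIndex (r : GMPerversity n) (k : ℤ) where
  p : GMPerversity n
  q : GMPerversity n
  i : ℤ
  j : ℤ
  hpq : GMPerversity.SumLE p r q
  hij : i + k = j

section InternalHom

variable (M Z : PDGModule A)

/-- Families of `R`-linear maps `(M_p)_i → (Z_q)_j` for `p + r ≤ q` and `j - i = k`. -/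
abbrev HomFamily (r : GMPerversity n) (k : ℤ) : Type u :=
  ∀ t : HomIndex r k, (M.X.obj t.p).X t.i →ₗ[R] (Z.X.obj t.q).X t.j

/-- The component of `Hom_A(M, Z)` in perversity `r` and degree `k`: the families of maps in
`lim_{r ≤ q - p} ∏_{j - i = k} Hom_R((M_p)_i, (Z_q)_j)` such that
`f (a x) = (-1)^(k |a|) a (f x)`. -/
def homObj (r : GMPerversity n) (k : ℤ) : Submodule R (HomFamily M Z r k) where
  carrier := {f |
    (∀ (p q p' q' : GMPerversity n) (h : GMPerversity.SumLE p r q)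
      (h' : GMPerversity.SumLE p' r q') (hp : p' ≤ p) (hq : q ≤ q') (i j : ℤ) (e : i + k = j)
      (x : (M.X.obj p').X i),
      f ⟨p', q', i, j, h', e⟩ x = Z.X.res hq j (f ⟨p, q, i, j, h, e⟩ (M.X.res hp i x))) ∧
    (∀ (s p u v w : GMPerversity n) (h₁ : GMPerversity.SumLE s p u) (h₂ : GMPerversity.SumLE u r w)
      (h₃ : GMPerversity.SumLE p r v) (h₄ : GMPerversity.SumLE s v w) (l i m j t : ℤ)
      (e₁ : l + i = m) (e₂ : m + k = t) (e₃ : i + k = j) (e₄ : l + j = t)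
      (a : (A.X.obj s).X l) (x : (M.X.obj p).X i),
      f ⟨u, w, m, t, h₂, e₂⟩ (M.smul h₁ e₁ a x) =
        (k * l).negOnePow • Z.smul h₄ e₄ a (f ⟨p, v, i, j, h₃, e₃⟩ x))}
  zero_mem' := ⟨by intros; simp, by intros; simp⟩
  add_mem' := fun {f g} hf hg => ⟨by
      intro p q p' q' h h' hp hq i j e x
      simp only [Pi.add_apply, LinearMap.add_apply, map_add, hf.1 p q p' q' h h' hp hq i j e x,
        hg.1 p q p' q' h h' hp hq i j e x], by
      intro s p u v w h₁ h₂ h₃ h₄ l i m j t e₁ e₂ e₃ e₄ a x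
      simp only [Pi.add_apply, LinearMap.add_apply, map_add, smul_add,
        hf.2 s p u v w h₁ h₂ h₃ h₄ l i m j t e₁ e₂ e₃ e₄ a x,
        hg.2 s p u v w h₁ h₂ h₃ h₄ l i m j t e₁ e₂ e₃ e₄ a x]⟩
  smul_mem' := fun c f hf => ⟨by
      intro p q p' q' h h' hp hq i j e x
      simp only [Pi.smul_apply, LinearMap.smul_apply, map_smul, hf.1 p q p' q' h h' hp hq i j e x],
      by
      intro s p u v w h₁ h₂ h₃ h₄ l i m j t e₁ e₂ e₃ e₄ a x
      simp only [Pi.smul_apply, LinearMap.smul_apply, map_smul,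
        hf.2 s p u v w h₁ h₂ h₃ h₄ l i m j t e₁ e₂ e₃ e₄ a x]
      rw [smul_comm]⟩

/-- The differential `D f = d ∘ f - (-1)^k f ∘ d` on families, from degree `k` to degree `k'`
(it vanishes unless `k' + 1 = k`). -/
def homFamilyDiff (r : GMPerversity n) (k k' : ℤ) :
    HomFamily M Z r k →ₗ[R] HomFamily M Z r k' where
  toFun f := fun ⟨p, q, i, j, h, _⟩ =>
    Z.X.diff q (i + k) j ∘ₗ f ⟨p, q, i, i + k, h, rfl⟩ -
      k.negOnePow • (f ⟨p, q, j - k, j, h, sub_add_cancel j k⟩ ∘ₗ M.X.diff p i (j - k))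
  map_add' f g := by
    funext ⟨p, q, i, j, h, e⟩
    ext x
    simp only [Pi.add_apply, LinearMap.sub_apply, LinearMap.comp_apply, LinearMap.add_apply,
      LinearMap.smul_apply, map_add, smul_add]
    abel
  map_smul' c f := by
    funext ⟨p, q, i, j, h, e⟩
    ext x
    simp only [Pi.smul_apply, LinearMap.sub_apply, LinearMap.comp_apply, RingHom.id_apply,
      LinearMap.smul_apply, map_smul, smul_sub]
    rw [smul_comm]

theorem homFamilyDiff_apply {r : GMPerversity n} {k k' : ℤ} (f : HomFamily M Z r k)
    {p q : GMPerversity n} (h : GMPerversity.SumLE p r q) {i j i' j' : ℤ} (e : i + k' = j)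
    (e₁ : i + k = j') (e₂ : i' + k = j) (x : (M.X.obj p).X i) :
    homFamilyDiff M Z r k k' f ⟨p, q, i, j, h, e⟩ x =
      Z.X.diff q j' j (f ⟨p, q, i, j', h, e₁⟩ x) -
        k.negOnePow • f ⟨p, q, i', j, h, e₂⟩ (M.X.diff p i i' x) := by
  subst e₁
  obtain rfl : i' = j - k := by omega
  rfl

theorem homFamilyDiff_mem {r : GMPerversity n} {k k' : ℤ} (hk : k' + 1 = k)
    {f : HomFamily M Z r k} (hf : f ∈ homObj M Z r k) :
    homFamilyDiff M Z r k k' f ∈ homObj M Z r k' := by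
  refine ⟨?_, ?_⟩
  · intro p q p' q' h h' hp hq i j e x
    rw [homFamilyDiff_apply M Z f h' e (i' := i - 1) rfl (by omega),
      homFamilyDiff_apply M Z f h e (i' := i - 1) rfl (by omega),
      hf.1 p q p' q' h h' hp hq, hf.1 p q p' q' h h' hp hq, map_sub, map_zsmul_unit,
      M.X.diff_res, Z.X.diff_res]
  · intro s p u v w h₁ h₂ h₃ h₄ l i m j t e₁ e₂ e₃ e₄ a x
    rw [homFamilyDiff_apply M Z f h₂ e₂ (j' := t + 1) (i' := m - 1) (by omega) (by omega),
      homFamilyDiff_apply M Z f h₃ e₃ (j' := j + 1) (i' := i - 1) (by omega) (by omega),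
      hf.2 s p u v w h₁ h₂ h₃ h₄ l i m (j + 1) (t + 1) e₁ (by omega) (by omega) (by omega),
      M.leibniz h₁ (i' := l - 1) (j' := i - 1) e₁ (by omega) (by omega) (by omega),
      map_zsmul_unit, Z.leibniz h₄ (i' := l - 1) (j' := j) (k' := t) _ (by omega) e₄ rfl, map_add,
      map_zsmul_unit,
      hf.2 s p u v w h₁ h₂ h₃ h₄ (l - 1) i (m - 1) (j + 1) t (by omega) (by omega) (by omega)
        (by omega),
      hf.2 s p u v w h₁ h₂ h₃ h₄ l (i - 1) (m - 1) j t (by omega) (by omega) (by omega)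
        (by omega), map_sub, map_zsmul_unit]
    obtain rfl : k' = k - 1 := by omega
    have h1 : (k * (l - 1)).negOnePow = (k * l).negOnePow * k.negOnePow := by
      rw [mul_sub, mul_one, Int.negOnePow_sub]
    have h2 : ((k - 1) * l).negOnePow = (k * l).negOnePow * l.negOnePow := by
      rw [sub_mul, one_mul, Int.negOnePow_sub]
    have h3 : ∀ m : ℤ, m.negOnePow * m.negOnePow = 1 := fun m => by
      rw [← Int.negOnePow_add, Int.negOnePow_even _ ⟨m, rfl⟩]
    rw [h1, h2]
    simp only [smul_add, smul_sub, smul_smul]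
    have h4 : k.negOnePow * ((k * l).negOnePow * k.negOnePow) = (k * l).negOnePow := by
      rw [mul_comm, mul_assoc, h3, mul_one]
    have h5 : k.negOnePow * (l.negOnePow * (k * l).negOnePow) =
        (k * l).negOnePow * l.negOnePow * k.negOnePow := by
      rw [mul_comm, mul_comm l.negOnePow]
    rw [h4, h5]
    abel

theorem homFamilyDiff_eq_zero {r : GMPerversity n} {k k' : ℤ} (hk : k' + 1 ≠ k)
    (f : HomFamily M Z r k) : homFamilyDiff M Z r k k' f = 0 := by
  funext ⟨p, q, i, j, h, e⟩
  ext x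
  rw [homFamilyDiff_apply M Z f h e (j' := i + k) (i' := j - k) rfl (by omega),
    M.X.diff_eq_zero _ _ _ (by omega), Z.X.diff_eq_zero _ _ _ (by omega)]
  simp

theorem homFamilyDiff_diff {r : GMPerversity n} {k k' k'' : ℤ} (hk : k' + 1 = k)
    (hk' : k'' + 1 = k') (f : HomFamily M Z r k) :
    homFamilyDiff M Z r k' k'' (homFamilyDiff M Z r k k' f) = 0 := by
  funext ⟨p, q, i, j, h, e⟩
  ext x
  rw [homFamilyDiff_apply M Z _ h e (j' := j + 1) (i' := i - 1) (by omega) (by omega),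
    homFamilyDiff_apply M Z f h _ (j' := j + 2) (i' := i - 1) (by omega) (by omega),
    homFamilyDiff_apply M Z f h _ (j' := j + 1) (i' := i - 2) (by omega) (by omega),
    M.X.diff_diff, map_sub, Z.X.diff_diff, map_zsmul_unit]
  obtain rfl : k' = k - 1 := by omega
  simp [Int.negOnePow_sub]

/-- The differential of `Hom_A(M, Z)`. -/
def homDiff (r : GMPerversity n) (k k' : ℤ) : homObj M Z r k →ₗ[R] homObj M Z r k' :=
  (homFamilyDiff M Z r k k').restrict fun f hf => by
    by_cases hk : k' + 1 = k
    · exact homFamilyDiff_mem M Z hk hf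
    · rw [homFamilyDiff_eq_zero M Z hk]
      exact Submodule.zero_mem _

/-- The chain complex `Hom_A(M, Z)_r`. -/
def homComplex (r : GMPerversity n) : ChainComplex (ModuleCat.{u} R) ℤ where
  X k := ModuleCat.of R (homObj M Z r k)
  d k k' := ModuleCat.ofHom (homDiff M Z r k k')
  shape _ _ h := ModuleCat.hom_ext <| LinearMap.ext fun f =>
    Subtype.ext (homFamilyDiff_eq_zero M Z h f.1)
  d_comp_d' _ _ _ h h' := ModuleCat.hom_ext <| LinearMap.ext fun f =>
    Subtype.ext (homFamilyDiff_diff M Z h h' f.1)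

/-- The structure morphisms of `Hom_A(M, Z)`. -/
def homRes {r r' : GMPerversity n} (h : r ≤ r') : homComplex M Z r ⟶ homComplex M Z r' where
  f _ := ModuleCat.ofHom
    { toFun := fun f => ⟨fun t => f.1 ⟨t.p, t.q, t.i, t.j, t.hpq.mono le_rfl h le_rfl, t.hij⟩,
        fun p q p' q' h₁ h₂ => f.2.1 p q p' q' (h₁.mono le_rfl h le_rfl) (h₂.mono le_rfl h le_rfl),
        fun s p u v w h₁ h₂ h₃ h₄ => f.2.2 s p u v w h₁ (h₂.mono le_rfl h le_rfl)
          (h₃.mono le_rfl h le_rfl) h₄⟩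
      map_add' := fun _ _ => rfl
      map_smul' := fun _ _ => rfl }
  comm' _ _ _ := rfl

/-- The perverse chain complex `Hom_A(M, Z)`. -/
def internalHom : PerverseComplex R n where
  obj r := homComplex M Z r
  map f := homRes M Z (leOfHom f)
  map_id _ := rfl
  map_comp _ _ := rfl

end InternalHom

end PDGModule

/-! ### Acyclicity, semi-projective and semi-free modules -/

/-- A perverse chain complex is acyclic if it is so in each perversity. -/
def PerverseComplex.IsAcyclic (X : PerverseComplex R n) : Prop := ∀ p, (X.obj p).Acyclic

/-- A perverse chain complex is free if it is isomorphic to `⨁_p F_p(V_p)` for a family of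
degreewise free chain complexes `V_p`, where `F_p` is the left adjoint of the evaluation
at `p`. -/
def PerverseComplex.IsFree (K : PerverseComplex R n) : Prop :=
  ∃ V : GMPerversity n → ChainComplex (ModuleCat.{u} R) ℤ,
    (∀ p i, Module.Free R ((V p).X i)) ∧
      Nonempty (K ≅ ∐ fun p => (evaluationLeftAdjoint _ p).obj (V p))

namespace PDGModule

variable {A : PDGAlgebra.{u} R n}

/-- `M` is semi-projective: its underlying perverse graded `A`-module is projective and
`Hom_A(M, Z)` is acyclic for every acyclic `Z`. -/
def IsSemiProjective (M : PDGModule A) : Prop :=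
  Projective M.toGraded ∧ ∀ Z : PDGModule A, Z.X.IsAcyclic → (internalHom M Z).IsAcyclic

/-- `M` is semi-free: it is the union of an increasing sequence of pDG submodules
`0 = F 0 ≤ F 1 ≤ …` such that `F (k + 1) / F k ≅ A ⊠ K` where `K` is a free perverse chain complex
with zero differential. -/
def IsSemiFree (M : PDGModule A) : Prop :=
  ∃ F : ℕ → Sub M,
    (∀ p i, (F 0).carrier p i = ⊥) ∧
    (∀ k p i, (F k).carrier p i ≤ (F (k + 1)).carrier p i) ∧
    (∀ p i (x : (M.X.obj p).X i), ∃ k, x ∈ (F k).carrier p i) ∧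
    ∀ k, ∃ K : PerverseComplex R n, K.IsFree ∧ (∀ p i j, (K.obj p).d i j = 0) ∧
      Nonempty ((F (k + 1)).quotient (F k) ≅ free A K)

/-! ### The projective model structure -/

/-- Weak equivalences are the quasi-isomorphisms in each perversity. -/
instance : CategoryWithWeakEquivalences (PDGModule A) where
  weakEquivalences _ _ f := ∀ p, QuasiIso (f.hom.app p)

/-- Fibrations are the fibrations of chain complexes (degreewise surjections) in each
perversity. -/
instance : CategoryWithFibrations (PDGModule A) where
  fibrations _ _ f := ∀ p i, Function.Surjective ((f.hom.app p).f i).hom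

/-- Cofibrations are the maps with the left lifting property against all trivial fibrations. -/
instance : CategoryWithCofibrations (PDGModule A) where
  cofibrations := (trivialFibrations (PDGModule A)).llp

variable (A) in
/-- The zero pDG `A`-module. -/
def zeroModule : PDGModule A where
  X := (Functor.const _).obj
    { X := fun _ => ModuleCat.of R PUnit
      d := fun _ _ => 0 }
  smul _ _ _ _ _ := 0
  res_smul := by intros; exact Subsingleton.elim (α := PUnit) _ _
  one_smul := by intros; exact Subsingleton.elim (α := PUnit) _ _
  mul_smul := by intros; exact Subsingleton.elim (α := PUnit) _ _
  leibniz := by intros; exact Subsingleton.elim (α := PUnit) _ _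

variable (A) in
/-- The zero pDG `A`-module is initial. -/
def zeroModuleIsInitial : IsInitial (zeroModule A) :=
  IsInitial.ofUniqueHom
    (fun N =>
      { hom := { app := fun _ => { f := fun _ => 0 } }
        map_smul := fun h _ _ _ e a _ => (map_zero (N.smul h e a)).symm })
    (fun N g => PDGModule.Hom.ext <| NatTrans.ext <| funext fun p =>
      HomologicalComplex.hom_ext _ _ fun i => ModuleCat.hom_ext <| LinearMap.ext fun x => by
        have hx : x = 0 := Subsingleton.elim (α := PUnit) _ _
        rw [hx, map_zero, map_zero])

instance : HasInitial (PDGModule A) := (zeroModuleIsInitial A).hasInitial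

end PDGModule

end

/-! ### Perverse graded and differential graded modules in components; submodules, quotients, bases.
-/

section Basics

variable {R : Type u} [CommRing R] {n : ℕ}

/-! The main tool is that, for K free with zero differential, A ⊠ K has a homogeneous basis of
cycles (`exists_isBasis_free`): morphisms of perverse graded modules out of it correspond to
arbitrary values on the basis. This also produces elements of Hom_A(M, Z)_r of degree k, because a
graded morphism from M to the auxiliary module `twist Z r k`, with components lim_{p + r ≤ q}
(Z_q)_{i + k} and a sign in the action of A, defines such an element. The index set of that limit is
empty or has the least element p ⊕ r, so the limit is zero or the value at p ⊕ r. Hence a compatible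
family of cycles in an acyclic Z bounds a compatible family (`exists_twistObj_diff_eq`).

Semi-projective implies cofibrant (`IsSemiProjective.exists_lift`). Let f be a trivial fibration;
its kernel is acyclic. Graded projectivity lifts a morphism g : M → Y to a graded morphism φ,
perhaps not a chain map. The defect dφ - φd is a cycle of degree -1 in Hom_A(M, ker f), so it equals
Dγ for some γ of degree 0, and φ - γ is a lift of pDG modules.

Cofibrant implies retract of semi-free. Every M is the target of a trivial fibration from a
semi-free module. Starting from 0, for every cycle z of the present stage and every m in M whose
boundary is the image of z, attach a generator e with de = z and send it to m
(`nonempty_cellAttachment`). On the union of the stages the map to M is surjective with acyclic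
kernel. If M is cofibrant, its identity lifts, so M is a retract.

Retract of semi-free implies semi-projective. Both conditions pass to retracts. In a semi-free
filtration each step splits as graded modules, so a morphism on F_k extends to F_{k+1} with
arbitrary values on lifts e of the basis of the quotient (`IsShortExact.exists_extension`). For
projectivity, the values are preimages under the given epimorphism. For acyclicity of Hom_A(N, Z), a
primitive g of a cycle f has to satisfy d(g e) = f e ± g(de); since de lies in F_k, the right side
is already known. It is a cycle, so g e exists. -/

theorem GMPerversity.SumLE.le_left {p q r : GMPerversity n} (h : SumLE p q r) : p ≤ r :=
  fun i => (Nat.le_add_right _ _).trans (h i)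

theorem GMPerversity.SumLE.le_right {p q r : GMPerversity n} (h : SumLE p q r) : q ≤ r :=
  fun i => (Nat.le_add_left _ _).trans (h i)

namespace PerverseGraded

/-- A perverse graded module given by its components and its structure morphisms. -/
def ofRes (V : GMPerversity n → ℤ → ModuleCat.{u} R)
    (res : ∀ {p q : GMPerversity n}, p ≤ q → ∀ i, V p i →ₗ[R] V q i)
    (res_refl : ∀ p i x, res (le_refl p) i x = x)
    (res_res : ∀ {p q r : GMPerversity n} (h : p ≤ q) (h' : q ≤ r) i x,
      res h' i (res h i x) = res (h.trans h') i x) : PerverseGraded R n where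
  obj p := V p
  map f i := ModuleCat.ofHom (res (leOfHom f) i)
  map_id p := funext fun i => ModuleCat.hom_ext (LinearMap.ext (res_refl p i))
  map_comp f g := funext fun i => ModuleCat.hom_ext (LinearMap.ext fun x =>
    (res_res (leOfHom f) (leOfHom g) i x).symm)

variable (Y : PerverseGraded R n)

theorem res_refl (p : GMPerversity n) (i : ℤ) (x : Y.obj p i) : Y.res (le_refl p) i x = x := by
  have : Y.map (homOfLE (le_refl p)) = 𝟙 _ := Y.map_id p
  simp only [res, this]
  rfl

theorem res_res {p q r : GMPerversity n} (h : p ≤ q) (h' : q ≤ r) (i : ℤ) (x : Y.obj p i) :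
    Y.res h' i (Y.res h i x) = Y.res (h.trans h') i x := by
  have : Y.map (homOfLE (h.trans h')) = Y.map (homOfLE h) ≫ Y.map (homOfLE h') :=
    Y.map_comp (homOfLE h) (homOfLE h')
  simp only [res, this]
  rfl

end PerverseGraded

namespace PerverseComplex

/-- A perverse chain complex given by its components, structure morphisms and differentials. -/
def ofRes (V : GMPerversity n → ℤ → ModuleCat.{u} R)
    (res : ∀ {p q : GMPerversity n}, p ≤ q → ∀ i, V p i →ₗ[R] V q i)
    (diff : ∀ p i j, V p i →ₗ[R] V p j)
    (res_refl : ∀ p i x, res (le_refl p) i x = x)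
    (res_res : ∀ {p q r : GMPerversity n} (h : p ≤ q) (h' : q ≤ r) i x,
      res h' i (res h i x) = res (h.trans h') i x)
    (diff_res : ∀ {p q : GMPerversity n} (h : p ≤ q) i j x,
      diff q i j (res h i x) = res h j (diff p i j x))
    (diff_shape : ∀ p i j, j + 1 ≠ i → ∀ x, diff p i j x = 0)
    (diff_diff : ∀ p i j k, j + 1 = i → k + 1 = j → ∀ x, diff p j k (diff p i j x) = 0) :
    PerverseComplex R n where
  obj p :=
    { X := V p
      d := fun i j => ModuleCat.ofHom (diff p i j)
      shape := fun i j h => ModuleCat.hom_ext (LinearMap.ext (diff_shape p i j h))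
      d_comp_d' := fun i j k h h' =>
        ModuleCat.hom_ext (LinearMap.ext (diff_diff p i j k h h')) }
  map f :=
    { f := fun i => ModuleCat.ofHom (res (leOfHom f) i)
      comm' := fun i j _ => ModuleCat.hom_ext (LinearMap.ext (diff_res (leOfHom f) i j)) }
  map_id p := HomologicalComplex.hom_ext _ _ fun i =>
    ModuleCat.hom_ext (LinearMap.ext (res_refl p i))
  map_comp f g := HomologicalComplex.hom_ext _ _ fun i =>
    ModuleCat.hom_ext (LinearMap.ext fun x => (res_res (leOfHom f) (leOfHom g) i x).symm)

end PerverseComplex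

variable {A : PDGAlgebra.{u} R n}

namespace PGModule

/-- The component of a morphism of perverse graded modules. -/
def Hom.lin {X Y : PGModule A} (φ : X ⟶ Y) (p : GMPerversity n) (i : ℤ) :
    X.X.obj p i →ₗ[R] Y.X.obj p i :=
  (φ.hom.app p i).hom

variable {X Y W : PGModule A}

theorem Hom.lin_res (φ : X ⟶ Y) {p q : GMPerversity n} (h : p ≤ q) (i : ℤ) (x : X.X.obj p i) :
    Hom.lin φ q i (X.X.res h i x) = Y.X.res h i (Hom.lin φ p i x) :=
  congrArg (fun f => (f i).hom x) (φ.hom.naturality (homOfLE h))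

theorem Hom.lin_smul (φ : X ⟶ Y) {p q r : GMPerversity n} (h : GMPerversity.SumLE p q r)
    {i j k : ℤ} (e : i + j = k) (a : (A.X.obj p).X i) (x : X.X.obj q j) :
    Hom.lin φ r k (X.smul h e a x) = Y.smul h e a (Hom.lin φ q j x) :=
  φ.map_smul h e a x

theorem Hom.lin_ext {φ ψ : X ⟶ Y} (h : ∀ p i x, Hom.lin φ p i x = Hom.lin ψ p i x) : φ = ψ :=
  PGModule.Hom.ext <| NatTrans.ext <| funext fun p => funext fun i =>
    ModuleCat.hom_ext (LinearMap.ext (h p i))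

@[simp]
theorem Hom.lin_comp (φ : X ⟶ Y) (ψ : Y ⟶ W) (p : GMPerversity n) (i : ℤ) (x : X.X.obj p i) :
    Hom.lin (φ ≫ ψ) p i x = Hom.lin ψ p i (Hom.lin φ p i x) := rfl

@[simp]
theorem Hom.lin_id (p : GMPerversity n) (i : ℤ) (x : X.X.obj p i) :
    Hom.lin (𝟙 X) p i x = x := rfl

/-- A morphism of perverse graded modules given by its components. -/
def homOfLin (f : ∀ p i, X.X.obj p i →ₗ[R] Y.X.obj p i)
    (hres : ∀ {p q : GMPerversity n} (h : p ≤ q) i x,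
      f q i (X.X.res h i x) = Y.X.res h i (f p i x))
    (hsmul : ∀ {p q r : GMPerversity n} (h : GMPerversity.SumLE p q r) {i j k : ℤ}
      (e : i + j = k) (a : (A.X.obj p).X i) (x : X.X.obj q j),
      f r k (X.smul h e a x) = Y.smul h e a (f q j x)) : X ⟶ Y where
  hom :=
    { app := fun p i => ModuleCat.ofHom (f p i)
      naturality := fun _ _ g => funext fun i =>
        ModuleCat.hom_ext (LinearMap.ext (hres (leOfHom g) i)) }
  map_smul h _ _ _ e a x := hsmul h e a x

@[simp]
theorem lin_homOfLin (f : ∀ p i, X.X.obj p i →ₗ[R] Y.X.obj p i) (hres) (hsmul)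
    (p : GMPerversity n) (i : ℤ) : Hom.lin (homOfLin (X := X) (Y := Y) f hres hsmul) p i = f p i :=
  rfl

/-! ### Submodules and quotients of perverse graded modules -/

variable (Y) in
/-- A perverse graded `A`-submodule. -/
structure Sub where
  carrier : ∀ (p : GMPerversity n) (i : ℤ), Submodule R (Y.X.obj p i)
  res_mem : ∀ {p q : GMPerversity n} (h : p ≤ q) {i : ℤ} {x : Y.X.obj p i},
    x ∈ carrier p i → Y.X.res h i x ∈ carrier q i
  smul_mem : ∀ {p q r : GMPerversity n} (h : GMPerversity.SumLE p q r) {i j k : ℤ} (e : i + j = k)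
    (a : (A.X.obj p).X i) {x : Y.X.obj q j}, x ∈ carrier q j → Y.smul h e a x ∈ carrier r k

namespace Sub

variable (S : Sub Y)

/-- The quotient of a perverse graded module by a submodule. -/
def quotient : PGModule A where
  X := PerverseGraded.ofRes (fun p i => ModuleCat.of R (Y.X.obj p i ⧸ S.carrier p i))
    (fun h i => Submodule.mapQ _ _ (Y.X.res h i) fun _ hx => S.res_mem h hx)
    (by
      rintro p i ⟨x⟩
      exact congrArg (Submodule.Quotient.mk (p := S.carrier p i)) (Y.X.res_refl p i x))
    (by
      rintro p q r h h' i ⟨x⟩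
      exact congrArg (Submodule.Quotient.mk (p := S.carrier r i)) (Y.X.res_res h h' i x))
  smul {p q r} h {i j k} e :=
    { toFun := fun a => Submodule.mapQ _ _ (Y.smul h e a) fun _ hx => S.smul_mem h e a hx
      map_add' := fun a b => Submodule.linearMap_qext _ <| LinearMap.ext fun x =>
        congrArg (Submodule.Quotient.mk (p := S.carrier r k))
          (LinearMap.congr_fun (map_add (Y.smul h e) a b) x)
      map_smul' := fun c a => Submodule.linearMap_qext _ <| LinearMap.ext fun x =>
        congrArg (Submodule.Quotient.mk (p := S.carrier r k))
          (LinearMap.congr_fun (map_smul (Y.smul h e) c a) x) }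
  res_smul {p q r p' q' r'} h h' hp hq hr {i j k} e a := by
    rintro ⟨x⟩
    exact congrArg (Submodule.Quotient.mk (p := S.carrier r' k)) (Y.res_smul h h' hp hq hr e a x)
  one_smul {q r} h {j} := by
    rintro ⟨x⟩
    exact congrArg (Submodule.Quotient.mk (p := S.carrier r j)) (Y.one_smul h x)
  mul_smul {p q r u v s} h₁ h₂ h₃ h₄ {i j k l m t} e₁ e₂ e₃ e₄ a b := by
    rintro ⟨x⟩
    exact congrArg (Submodule.Quotient.mk (p := S.carrier s t))
      (Y.mul_smul h₁ h₂ h₃ h₄ e₁ e₂ e₃ e₄ a b x)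

/-- The projection onto the quotient. -/
def mkQ : Y ⟶ S.quotient :=
  homOfLin (fun p i => (S.carrier p i).mkQ) (fun _ _ _ => rfl) (fun _ _ _ _ _ _ _ => rfl)

/-- The zero morphism to the quotient. -/
def zeroQ : Y ⟶ S.quotient :=
  homOfLin (fun _ _ => 0) (fun _ _ _ => (map_zero _).symm) (fun _ _ _ _ _ _ _ => (map_zero _).symm)

/-- Membership becomes the equality of two parallel morphisms out of `Y`, so uniqueness of morphisms
can be used to prove that a submodule is everything. -/
theorem mem_iff (p : GMPerversity n) (i : ℤ) (x : Y.X.obj p i) :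
    x ∈ S.carrier p i ↔ Hom.lin S.mkQ p i x = Hom.lin S.zeroQ p i x :=
  (Submodule.Quotient.mk_eq_zero _).symm

end Sub

/-- The image of a morphism. -/
def range (φ : X ⟶ Y) : Sub Y where
  carrier p i := LinearMap.range (Hom.lin φ p i)
  res_mem := by
    rintro p q h i _ ⟨x, rfl⟩
    exact ⟨X.X.res h i x, Hom.lin_res φ h i x⟩
  smul_mem := by
    rintro p q r h i j k e a _ ⟨x, rfl⟩
    exact ⟨X.smul h e a x, Hom.lin_smul φ h e a x⟩

/-- The projection and the zero map to the quotient by the range agree after composition with `φ`,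
hence coincide. With the converse below, `Projective` means lifting against componentwise
surjections. -/
theorem surjective_of_epi (φ : X ⟶ Y) [Epi φ] (p : GMPerversity n) (i : ℤ) :
    Function.Surjective (Hom.lin φ p i) := by
  have h : (range φ).mkQ = (range φ).zeroQ := by
    rw [← cancel_epi φ]
    exact Hom.lin_ext fun p i x => ((range φ).mem_iff p i _).1 ⟨x, rfl⟩
  intro y
  exact ((range φ).mem_iff p i y).2 (by rw [h])

theorem epi_of_surjective (φ : X ⟶ Y) (h : ∀ p i, Function.Surjective (Hom.lin φ p i)) :
    Epi φ :=
  ⟨fun f g hfg => Hom.lin_ext fun p i y => by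
    obtain ⟨x, rfl⟩ := h p i y
    exact congrArg (fun f => Hom.lin f p i x) hfg⟩

/-! ### Bases -/

variable (Y) in
/-- A family of homogeneous elements is a basis if morphisms out of the module are determined by
arbitrary values on the family. -/
def IsBasis {Λ : Type u} (p : Λ → GMPerversity n) (i : Λ → ℤ) (b : ∀ l, Y.X.obj (p l) (i l)) :
    Prop :=
  ∀ (W : PGModule A) (w : ∀ l, W.X.obj (p l) (i l)),
    ∃! φ : Y ⟶ W, ∀ l, Hom.lin φ (p l) (i l) (b l) = w l

/-- The projection and the zero map to the quotient by `S` agree on the basis, hence everywhere. Any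
identity whose solutions form a submodule can therefore be checked on basis elements. -/
theorem IsBasis.mem_of_forall_mem {Λ : Type u} {p : Λ → GMPerversity n} {i : Λ → ℤ}
    {b : ∀ l, Y.X.obj (p l) (i l)} (hb : Y.IsBasis p i b) (S : Sub Y)
    (h : ∀ l, b l ∈ S.carrier (p l) (i l)) (q : GMPerversity n) (j : ℤ) (x : Y.X.obj q j) :
    x ∈ S.carrier q j := by
  have : S.mkQ = S.zeroQ :=
    (hb S.quotient fun l => Hom.lin S.zeroQ (p l) (i l) (b l)).unique
      (fun l => (S.mem_iff _ _ _).1 (h l)) (fun l => rfl)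
  exact (S.mem_iff q j x).2 (by rw [this])

theorem IsBasis.of_iso {Λ : Type u} {p : Λ → GMPerversity n} {i : Λ → ℤ}
    {b : ∀ l, X.X.obj (p l) (i l)} (hb : X.IsBasis p i b) (e : X ≅ Y) :
    Y.IsBasis p i fun l => Hom.lin e.hom (p l) (i l) (b l) := by
  intro W w
  obtain ⟨φ, hφ, hu⟩ := hb W w
  refine ⟨e.inv ≫ φ, fun l => ?_, fun ψ hψ => ?_⟩
  · rw [← Hom.lin_comp, e.hom_inv_id_assoc, hφ]
  · rw [Iso.eq_inv_comp]
    exact hu _ hψ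

end PGModule

namespace PDGModule

variable {M N Z : PDGModule A}

/-- The component of a morphism of pDG modules. -/
def Hom.lin (φ : M ⟶ N) (p : GMPerversity n) (i : ℤ) :
    (M.X.obj p).X i →ₗ[R] (N.X.obj p).X i :=
  ((φ.hom.app p).f i).hom

theorem Hom.lin_res (φ : M ⟶ N) {p q : GMPerversity n} (h : p ≤ q) (i : ℤ)
    (x : (M.X.obj p).X i) : Hom.lin φ q i (M.X.res h i x) = N.X.res h i (Hom.lin φ p i x) :=
  congrArg (fun f => (f.f i).hom x) (φ.hom.naturality (homOfLE h))

theorem Hom.lin_diff (φ : M ⟶ N) (p : GMPerversity n) (i j : ℤ) (x : (M.X.obj p).X i) :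
    Hom.lin φ p j (M.X.diff p i j x) = N.X.diff p i j (Hom.lin φ p i x) :=
  (congrArg (fun f => f.hom x) ((φ.hom.app p).comm i j)).symm

theorem Hom.lin_smul (φ : M ⟶ N) {p q r : GMPerversity n} (h : GMPerversity.SumLE p q r)
    {i j k : ℤ} (e : i + j = k) (a : (A.X.obj p).X i) (x : (M.X.obj q).X j) :
    Hom.lin φ r k (M.smul h e a x) = N.smul h e a (Hom.lin φ q j x) :=
  φ.map_smul h e a x

theorem Hom.lin_ext {φ ψ : M ⟶ N} (h : ∀ p i x, Hom.lin φ p i x = Hom.lin ψ p i x) : φ = ψ :=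
  PDGModule.Hom.ext <| NatTrans.ext <| funext fun p => HomologicalComplex.hom_ext _ _ fun i =>
    ModuleCat.hom_ext (LinearMap.ext (h p i))

@[simp]
theorem Hom.lin_comp (φ : M ⟶ N) (ψ : N ⟶ Z) (p : GMPerversity n) (i : ℤ)
    (x : (M.X.obj p).X i) : Hom.lin (φ ≫ ψ) p i x = Hom.lin ψ p i (Hom.lin φ p i x) := rfl

/-- A morphism of pDG modules given by its components. -/
def homOfLin (f : ∀ p i, (M.X.obj p).X i →ₗ[R] (N.X.obj p).X i)
    (hres : ∀ {p q : GMPerversity n} (h : p ≤ q) i x,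
      f q i (M.X.res h i x) = N.X.res h i (f p i x))
    (hdiff : ∀ p i j, j + 1 = i → ∀ x, f p j (M.X.diff p i j x) = N.X.diff p i j (f p i x))
    (hsmul : ∀ {p q r : GMPerversity n} (h : GMPerversity.SumLE p q r) {i j k : ℤ}
      (e : i + j = k) (a : (A.X.obj p).X i) (x : (M.X.obj q).X j),
      f r k (M.smul h e a x) = N.smul h e a (f q j x)) : M ⟶ N where
  hom :=
    { app := fun p =>
        { f := fun i => ModuleCat.ofHom (f p i)
          comm' := fun i j h => ModuleCat.hom_ext (LinearMap.ext fun x => (hdiff p i j h x).symm) }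
      naturality := fun _ _ g => HomologicalComplex.hom_ext _ _ fun i =>
        ModuleCat.hom_ext (LinearMap.ext (hres (leOfHom g) i)) }
  map_smul h _ _ _ e a x := hsmul h e a x

@[simp]
theorem lin_homOfLin (f : ∀ p i, (M.X.obj p).X i →ₗ[R] (N.X.obj p).X i) (hres) (hdiff) (hsmul)
    (p : GMPerversity n) (i : ℤ) :
    Hom.lin (homOfLin (M := M) (N := N) f hres hdiff hsmul) p i = f p i :=
  rfl

theorem Hom.lin_ofBijective_symm (φ : M ⟶ N) {p : GMPerversity n} {i : ℤ}
    (h : Function.Bijective (Hom.lin φ p i)) (y : (N.X.obj p).X i) :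
    Hom.lin φ p i ((LinearEquiv.ofBijective (Hom.lin φ p i) h).symm.toLinearMap y) = y :=
  (LinearEquiv.ofBijective _ h).apply_symm_apply y

/-- A morphism of pDG modules which is bijective in each component is an isomorphism. -/
noncomputable def isoOfBijective (φ : M ⟶ N)
    (h : ∀ p i, Function.Bijective (Hom.lin φ p i)) : M ≅ N where
  hom := φ
  inv := homOfLin (fun p i => (LinearEquiv.ofBijective _ (h p i)).symm.toLinearMap)
    (fun {p q} hpq i x => (h q i).1 <| by
      rw [Hom.lin_res, Hom.lin_ofBijective_symm, Hom.lin_ofBijective_symm])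
    (fun p i j _ x => (h p j).1 <| by
      rw [Hom.lin_diff, Hom.lin_ofBijective_symm, Hom.lin_ofBijective_symm])
    (fun {p q r} hpq {i j k} e a x => (h r k).1 <| by
      rw [Hom.lin_smul, Hom.lin_ofBijective_symm, Hom.lin_ofBijective_symm])
  hom_inv_id := Hom.lin_ext fun p i x =>
    (LinearEquiv.ofBijective _ (h p i)).symm_apply_apply x
  inv_hom_id := Hom.lin_ext fun p i x => Hom.lin_ofBijective_symm φ (h p i) x

/-- The morphism of perverse graded modules underlying a morphism of pDG modules. -/
def toGradedMap (φ : M ⟶ N) : M.toGraded ⟶ N.toGraded :=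
  PGModule.homOfLin (X := M.toGraded) (Y := N.toGraded) (Hom.lin φ)
    (fun h i x => Hom.lin_res φ h i x) (fun h _ _ _ e a x => Hom.lin_smul φ h e a x)

/-- The isomorphism of perverse graded modules underlying an isomorphism of pDG modules. -/
def toGradedIso (e : M ≅ N) : M.toGraded ≅ N.toGraded where
  hom := toGradedMap e.hom
  inv := toGradedMap e.inv
  hom_inv_id := PGModule.Hom.lin_ext fun p i x =>
    congrArg (fun f => Hom.lin f p i x) e.hom_inv_id
  inv_hom_id := PGModule.Hom.lin_ext fun p i x =>
    congrArg (fun f => Hom.lin f p i x) e.inv_hom_id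

end PDGModule

end Basics

/-! ### Acyclic complexes and short exact sequences -/

section Acyclic

variable {R : Type u} [CommRing R]

/-- The three degrees are tied by equations instead of being written `j + 1`, `j`, `j - 1`, so that
elements need not be transported between equal degrees. -/
theorem ChainComplex.acyclic_iff_forall_exists (C : ChainComplex (ModuleCat.{u} R) ℤ) :
    C.Acyclic ↔ ∀ (i j k : ℤ), j + 1 = i → k + 1 = j → ∀ x : C.X j, (C.d j k).hom x = 0 →
      ∃ y : C.X i, (C.d i j).hom y = x := by
  have key : ∀ i j k : ℤ, j + 1 = i → k + 1 = j → (C.ExactAt j ↔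
      ∀ x : C.X j, (C.d j k).hom x = 0 → ∃ y : C.X i, (C.d i j).hom y = x) := by
    intro i j k hi hk
    rw [C.exactAt_iff' i j k (by subst hi; simp) (by subst hk; simp),
      ShortComplex.moduleCat_exact_iff]
    rfl
  exact ⟨fun h i j k hi hk => (key i j k hi hk).1 (h j),
    fun h j => (key (j + 1) j (j - 1) rfl (by omega)).2 (h _ _ _ rfl (by omega))⟩

variable {C : Type*} [Category C] [Abelian C] {ι : Type*} {c : ComplexShape ι}

/-- In the long exact homology sequence the terms of `S.X₁` vanish. -/
theorem CategoryTheory.ShortComplex.ShortExact.quasiIso_g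
    {S : ShortComplex (HomologicalComplex C c)} (hS : S.ShortExact) (h : S.X₁.Acyclic) :
    _root_.QuasiIso S.g := by
  have h0 : ∀ i, IsZero (S.X₁.homology i) := fun i =>
    (HomologicalComplex.exactAt_iff_isZero_homology _ _).1 (h i)
  rw [_root_.quasiIso_iff]
  intro i
  rw [quasiIsoAt_iff_isIso_homologyMap]
  have h1 : Mono (HomologicalComplex.homologyMap S.g i) :=
    (hS.homology_exact₂ i).mono_g ((h0 i).eq_of_src _ _)
  have h2 : Epi (HomologicalComplex.homologyMap S.g i) := by
    by_cases hi : ∃ j, c.Rel i j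
    · obtain ⟨j, hij⟩ := hi
      exact (hS.homology_exact₃ i j hij).epi_f ((h0 j).eq_of_tgt _ _)
    -- Without a differential out of degree `i` there is no connecting map; there homology is the
    -- cokernel of the incoming differential, which preserves epimorphisms.
    · have := hS.epi_g
      exact HomologicalComplex.epi_homologyMap_of_epi_of_not_rel S.g i (by simpa using hi)
  exact isIso_of_mono_of_epi _

end Acyclic

/-! ### Elements of Hom_A(M, Z) from graded morphisms to a shifted module -/

section Twist

variable {R : Type u} [CommRing R] {n : ℕ} {A : PDGAlgebra.{u} R n}

namespace PDGModule

variable (M Z : PDGModule A) (r : GMPerversity n) (k : ℤ)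

/-- The module `lim_{p + r ≤ q} (Z_q)_{i + k}`. -/
def twistObj (p : GMPerversity n) (i : ℤ) :
    Submodule R (∀ q : {q // GMPerversity.SumLE p r q}, (Z.X.obj q.1).X (i + k)) where
  carrier := {z | ∀ (q q' : {q // GMPerversity.SumLE p r q}) (h : q.1 ≤ q'.1),
    Z.X.res h (i + k) (z q) = z q'}
  zero_mem' _ _ _ := map_zero _
  add_mem' ha hb q q' h := (map_add _ _ _).trans (congrArg₂ _ (ha q q' h) (hb q q' h))
  smul_mem' c _ ha q w h := (map_smul _ c _).trans (congrArg _ (ha q w h))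

/-- The structure morphisms of `twist`. -/
def twistRes {p p' : GMPerversity n} (h : p ≤ p') (i : ℤ) :
    twistObj Z r k p i →ₗ[R] twistObj Z r k p' i where
  toFun z := ⟨fun q => z.1 ⟨q.1, q.2.mono h le_rfl le_rfl⟩,
    fun q q' hq => z.2 ⟨q.1, q.2.mono h le_rfl le_rfl⟩ ⟨q'.1, q'.2.mono h le_rfl le_rfl⟩ hq⟩
  map_add' _ _ := rfl
  map_smul' _ _ := rfl

variable {r} in
-- The perversity `w` dominates `s + p + r`, hence also `s` plus the least perversity above `p + r`.
-- So the component at `w` of a product `a z`, with `a` in perversity `s`, can be computed from the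
-- component of `z` at `p ⊕ r`.
theorem sumLE_oplus_twist {s p u w : GMPerversity n} (h : GMPerversity.SumLE s p u)
    (hw : GMPerversity.SumLE u r w) :
    GMPerversity.SumLE p r w ∧
      ∀ h' : GMPerversity.SumLE p r w, GMPerversity.SumLE s (GMPerversity.oplus h') w := by
  refine ⟨hw.mono h.le_right le_rfl le_rfl, fun h' =>
    (GMPerversity.sumLE_oplus_of h' fun i => ?_).symm⟩
  have := h i
  have := hw i
  omega

variable {Z r k} in
-- Both components of `z` are restrictions of the one at `p ⊕ r`, the least index of the limit, so
-- both products equal the product formed there.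
theorem twist_smul_eq {s p w v v' : GMPerversity n} (hv : GMPerversity.SumLE p r v)
    (hv' : GMPerversity.SumLE p r v') (h : GMPerversity.SumLE s v w)
    (h' : GMPerversity.SumLE s v' w) {l i m : ℤ} (e : l + (i + k) = m) (a : (A.X.obj s).X l)
    (z : twistObj Z r k p i) :
    Z.smul h e a (z.1 ⟨v, hv⟩) = Z.smul h' e a (z.1 ⟨v', hv'⟩) := by
  have key : ∀ (x : GMPerversity n) (hx : GMPerversity.SumLE p r x)
      (hxw : GMPerversity.SumLE s x w) (h₀ : GMPerversity.SumLE s (GMPerversity.oplus hv) w),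
      Z.smul hxw e a (z.1 ⟨x, hx⟩) =
        Z.smul h₀ e a (z.1 ⟨GMPerversity.oplus hv, GMPerversity.sumLE_oplus hv⟩) := by
    intro x hx hxw h₀
    rw [← z.2 ⟨GMPerversity.oplus hv, GMPerversity.sumLE_oplus hv⟩ ⟨x, hx⟩
      (GMPerversity.oplus_le hv hx)]
    have := Z.res_smul h₀ hxw le_rfl (GMPerversity.oplus_le hv hx) le_rfl e a
      (z.1 ⟨GMPerversity.oplus hv, GMPerversity.sumLE_oplus hv⟩)
    rw [Z.X.res_refl, A.X.res_refl] at this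
    exact this.symm
  have h₀ : GMPerversity.SumLE s (GMPerversity.oplus hv) w :=
    h.mono le_rfl (GMPerversity.oplus_le hv hv) le_rfl
  exact (key v hv h h₀).trans (key v' hv' h' h₀).symm

/-- The components of the action of `A` on `twist`. -/
def twistSMulAt {s p u : GMPerversity n} (h : GMPerversity.SumLE s p u) {l i m : ℤ}
    (e : l + i = m) (w : {w // GMPerversity.SumLE u r w}) :
    (A.X.obj s).X l →ₗ[R] twistObj Z r k p i →ₗ[R] (Z.X.obj w.1).X (m + k) :=
  (k * l).negOnePow •
    (Z.smul ((sumLE_oplus_twist h w.2).2 (sumLE_oplus_twist h w.2).1)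
      (show l + (i + k) = m + k by omega)).compl₂
      (LinearMap.proj (R := R) (φ := fun q : {q // GMPerversity.SumLE p r q} =>
          (Z.X.obj q.1).X (i + k)) ⟨_, GMPerversity.sumLE_oplus (sumLE_oplus_twist h w.2).1⟩ ∘ₗ
        (twistObj Z r k p i).subtype)

/-- The action of `A` on `twist`. -/
def twistSMul {s p u : GMPerversity n} (h : GMPerversity.SumLE s p u) {l i m : ℤ}
    (e : l + i = m) :
    (A.X.obj s).X l →ₗ[R] twistObj Z r k p i →ₗ[R] twistObj Z r k u m :=
  LinearMap.mk₂ R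
    (fun a z => ⟨fun w => twistSMulAt Z r k h e w a z, by
      intro w w' hw
      simp only [twistSMulAt, LinearMap.smul_apply, LinearMap.compl₂_apply]
      rw [map_zsmul_unit]
      congr 1
      have hs := (sumLE_oplus_twist h w.2).2 (sumLE_oplus_twist h w.2).1
      rw [Z.res_smul hs (hs.mono le_rfl le_rfl hw) le_rfl le_rfl hw, A.X.res_refl, Z.X.res_refl]
      exact twist_smul_eq _ _ _ _ _ _ _⟩)
    (fun a b z => Subtype.ext <| funext fun w =>
      LinearMap.map_add₂ (twistSMulAt Z r k h e w) a b z)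
    (fun c a z => Subtype.ext <| funext fun w =>
      LinearMap.map_smul₂ (twistSMulAt Z r k h e w) c a z)
    (fun a z z' => Subtype.ext <| funext fun w => map_add (twistSMulAt Z r k h e w a) z z')
    (fun c a z => Subtype.ext <| funext fun w => map_smul (twistSMulAt Z r k h e w a) c z)

variable {Z r k} in
-- The action may be computed through any admissible `v`, not only through the `p ⊕ r` of its
-- definition; the module axioms are proved by choosing a `v` common to both sides.
theorem twistSMul_apply {s p u w v : GMPerversity n} (h : GMPerversity.SumLE s p u) {l i m : ℤ}
    (e : l + i = m) (e' : l + (i + k) = m + k) (a : (A.X.obj s).X l) (z : twistObj Z r k p i)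
    (hw : GMPerversity.SumLE u r w) (hv : GMPerversity.SumLE p r v)
    (hvw : GMPerversity.SumLE s v w) :
    (twistSMul Z r k h e a z).1 ⟨w, hw⟩ =
      (k * l).negOnePow • Z.smul hvw e' a (z.1 ⟨v, hv⟩) := by
  exact congrArg ((k * l).negOnePow • ·) (twist_smul_eq _ hv _ hvw e' a z)

variable {Z r k} in
theorem twistRes_twistSMul {p q r₁ p' q' r' : GMPerversity n} (h : GMPerversity.SumLE p q r₁)
    (h' : GMPerversity.SumLE p' q' r') (hp : p ≤ p') (hq : q ≤ q') (hr : r₁ ≤ r')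
    {i j m : ℤ} (e : i + j = m) (a : (A.X.obj p).X i) (x : twistObj Z r k q j) :
    twistRes Z r k hr m (twistSMul Z r k h e a x) =
      twistSMul Z r k h' e (A.X.res hp i a) (twistRes Z r k hq j x) := by
  refine Subtype.ext <| funext fun w => ?_
  have hw := (sumLE_oplus_twist h' w.2)
  have hv : GMPerversity.SumLE q r (GMPerversity.oplus hw.1) :=
    (GMPerversity.sumLE_oplus hw.1).mono hq le_rfl le_rfl
  have hs : GMPerversity.SumLE p (GMPerversity.oplus hw.1) w.1 :=
    (hw.2 hw.1).mono hp le_rfl le_rfl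
  refine (twistSMul_apply h e (by omega) a x (w.2.mono hr le_rfl le_rfl) hv hs).trans ?_
  refine Eq.trans ?_ (twistSMul_apply h' e (by omega) (A.X.res hp i a) _ w.2
    (GMPerversity.sumLE_oplus hw.1) (hw.2 hw.1)).symm
  have := Z.res_smul hs (hw.2 hw.1) hp le_rfl le_rfl (show i + (j + k) = m + k by omega) a
    (x.1 ⟨_, hv⟩)
  rw [Z.X.res_refl, Z.X.res_refl] at this
  exact congrArg _ this

variable {Z r k} in
theorem twist_one_smul {q r₁ : GMPerversity n} (h : q ≤ r₁) {j : ℤ} (x : twistObj Z r k q j) :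
    twistSMul Z r k (GMPerversity.sumLE_zero_left h) (zero_add j) A.one x =
      twistRes Z r k h j x := by
  refine Subtype.ext <| funext fun w => ?_
  have hv : GMPerversity.SumLE q r w.1 := w.2.mono h le_rfl le_rfl
  refine (twistSMul_apply _ _ (zero_add _) A.one x w.2 hv
    (GMPerversity.sumLE_zero_left le_rfl)).trans ?_
  rw [mul_zero, Int.negOnePow_zero]
  refine (_root_.one_smul _ _).trans ?_
  exact (Z.one_smul (le_refl w.1) (x.1 ⟨_, hv⟩)).trans (Z.X.res_refl _ _ _)

variable {Z r k} in
theorem twist_mul_smul {p q r₁ u v s : GMPerversity n} (h₁ : GMPerversity.SumLE p q u)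
    (h₂ : GMPerversity.SumLE u r₁ s) (h₃ : GMPerversity.SumLE q r₁ v)
    (h₄ : GMPerversity.SumLE p v s) {i j l' l m t : ℤ} (e₁ : i + j = l) (e₂ : l + l' = t)
    (e₃ : j + l' = m) (e₄ : i + m = t) (a : (A.X.obj p).X i) (b : (A.X.obj q).X j)
    (x : twistObj Z r k r₁ l') :
    twistSMul Z r k h₂ e₂ (A.mul h₁ e₁ a b) x =
      twistSMul Z r k h₄ e₄ a (twistSMul Z r k h₃ e₃ b x) := by
  refine Subtype.ext <| funext fun w => ?_
  -- Evaluate `x` at `r₁ ⊕ r`: then `b` moves it to `v ⊕ r` and `a` moves the result to `w`. The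
  -- product `a b` goes from `r₁ ⊕ r` to `w` directly, since `u + r₁ + r ≤ s + r ≤ w`.
  have hw := sumLE_oplus_twist h₄ w.2
  have hv := sumLE_oplus_twist h₃ (GMPerversity.sumLE_oplus hw.1)
  have hu : GMPerversity.SumLE u (GMPerversity.oplus hv.1) w.1 :=
    (GMPerversity.sumLE_oplus_of hv.1 fun i => by
      have := h₂ i
      have := w.2 i
      omega).symm
  refine (twistSMul_apply h₂ e₂ (by omega) _ x w.2 (GMPerversity.sumLE_oplus hv.1) hu).trans ?_
  refine Eq.trans ?_ (twistSMul_apply h₄ e₄ (by omega) a _ w.2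
    (GMPerversity.sumLE_oplus hw.1) (hw.2 hw.1)).symm
  rw [twistSMul_apply h₃ e₃ (by omega) b x (GMPerversity.sumLE_oplus hw.1)
    (GMPerversity.sumLE_oplus hv.1) (hv.2 hv.1), map_zsmul_unit, smul_smul,
    ← Int.negOnePow_add, ← mul_add, e₁,
    Z.mul_smul h₁ hu (hv.2 hv.1) (hw.2 hw.1) e₁ _ (m := m + k) (by omega) (by omega)]

/-- The perverse graded module with `Hom_A(M, Z)_r` in degree `k` as the module of morphisms
from `M` to it. -/
def twist : PGModule A where
  X := PerverseGraded.ofRes (fun p i => ModuleCat.of R (twistObj Z r k p i))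
    (fun h i => twistRes Z r k h i) (fun _ _ _ => rfl) (fun _ _ _ _ => rfl)
  smul h _ _ _ e := twistSMul Z r k h e
  res_smul h h' hp hq hr _ _ _ e a x := twistRes_twistSMul h h' hp hq hr e a x
  one_smul h _ x := twist_one_smul h x
  mul_smul h₁ h₂ h₃ h₄ _ _ _ _ _ _ e₁ e₂ e₃ e₄ a b x :=
    twist_mul_smul h₁ h₂ h₃ h₄ e₁ e₂ e₃ e₄ a b x

variable {M Z r k}

/-- The component of a morphism of perverse graded modules out of a pDG module. -/
def gradedLin {W : PGModule A} (φ : M.toGraded ⟶ W) (p : GMPerversity n) (i : ℤ) :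
    (M.X.obj p).X i →ₗ[R] W.X.obj p i :=
  PGModule.Hom.lin φ p i

theorem gradedLin_res {W : PGModule A} (φ : M.toGraded ⟶ W) {p q : GMPerversity n} (h : p ≤ q)
    (i : ℤ) (x : (M.X.obj p).X i) :
    gradedLin φ q i (M.X.res h i x) = W.X.res h i (gradedLin φ p i x) :=
  PGModule.Hom.lin_res φ h i x

theorem gradedLin_smul {W : PGModule A} (φ : M.toGraded ⟶ W) {p q r : GMPerversity n}
    (h : GMPerversity.SumLE p q r) {i j k : ℤ} (e : i + j = k) (a : (A.X.obj p).X i)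
    (x : (M.X.obj q).X j) :
    gradedLin φ r k (M.smul h e a x) = W.smul h e a (gradedLin φ q j x) :=
  PGModule.Hom.lin_smul φ h e a x

/-- The component of a morphism `M ⟶ twist Z r k`. -/
def twistLin (φ : M.toGraded ⟶ twist Z r k) (p : GMPerversity n) (i : ℤ) :
    (M.X.obj p).X i →ₗ[R] twistObj Z r k p i :=
  gradedLin φ p i

theorem twistLin_res (φ : M.toGraded ⟶ twist Z r k) {p q : GMPerversity n} (h : p ≤ q)
    (i : ℤ) (x : (M.X.obj p).X i) :
    twistLin φ q i (M.X.res h i x) = twistRes Z r k h i (twistLin φ p i x) :=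
  PGModule.Hom.lin_res φ h i x

theorem twistLin_smul (φ : M.toGraded ⟶ twist Z r k) {p q s : GMPerversity n}
    (h : GMPerversity.SumLE p q s) {i j m : ℤ} (e : i + j = m) (a : (A.X.obj p).X i)
    (x : (M.X.obj q).X j) :
    twistLin φ s m (M.smul h e a x) = twistSMul Z r k h e a (twistLin φ q j x) :=
  PGModule.Hom.lin_smul φ h e a x

/-- The projection `lim_{p + r ≤ q} (Z_q)_{i + k} → (Z_q)_j`, where `i + k = j`. -/
def twistEval {p q : GMPerversity n} (h : GMPerversity.SumLE p r q) {i j : ℤ} (e : i + k = j) :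
    twistObj Z r k p i →ₗ[R] (Z.X.obj q).X j where
  toFun z := e ▸ z.1 ⟨q, h⟩
  map_add' := by subst e; exact fun _ _ => rfl
  map_smul' := by subst e; exact fun _ _ => rfl

theorem res_twistEval {p q q' : GMPerversity n} (h : GMPerversity.SumLE p r q) (hq : q ≤ q')
    {i j : ℤ} (e : i + k = j) (z : twistObj Z r k p i) :
    Z.X.res hq j (twistEval h e z) = twistEval (h.mono le_rfl le_rfl hq) e z := by
  subst e
  exact z.2 ⟨q, h⟩ ⟨q', h.mono le_rfl le_rfl hq⟩ hq

theorem twistEval_res {p p' q : GMPerversity n} (hp : p ≤ p') (h : GMPerversity.SumLE p' r q)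
    {i j : ℤ} (e : i + k = j) (z : twistObj Z r k p i) :
    twistEval h e (twistRes Z r k hp i z) = twistEval (h.mono hp le_rfl le_rfl) e z := by
  subst e
  rfl

theorem twistEval_smul {s p u v w : GMPerversity n} (h₁ : GMPerversity.SumLE s p u)
    (h₂ : GMPerversity.SumLE u r w) (h₃ : GMPerversity.SumLE p r v)
    (h₄ : GMPerversity.SumLE s v w) {l i m j t : ℤ} (e₁ : l + i = m) (e₂ : m + k = t)
    (e₃ : i + k = j) (e₄ : l + j = t) (a : (A.X.obj s).X l) (z : twistObj Z r k p i) :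
    twistEval h₂ e₂ (twistSMul Z r k h₁ e₁ a z) =
      (k * l).negOnePow • Z.smul h₄ e₄ a (twistEval h₃ e₃ z) := by
  subst e₁ e₂ e₃
  exact twistSMul_apply h₁ rfl e₄ a _ h₂ h₃ h₄

/-- The family of maps underlying a morphism `M ⟶ twist Z r k`. -/
def twistFamily (φ : M.toGraded ⟶ twist Z r k) : HomFamily M Z r k := fun t =>
  twistEval t.hpq t.hij ∘ₗ twistLin φ t.p t.i

theorem twistFamily_apply (φ : M.toGraded ⟶ twist Z r k) {p q : GMPerversity n}
    (h : GMPerversity.SumLE p r q) {i j : ℤ} (e : i + k = j) (x : (M.X.obj p).X i) :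
    twistFamily φ ⟨p, q, i, j, h, e⟩ x = twistEval h e (twistLin φ p i x) := rfl

/-- Compatibility with restrictions comes from the limit, and the sign `(-1)^(k |a|)` was put into
the action on `twist` for the sake of the second condition. -/
theorem twistFamily_mem (φ : M.toGraded ⟶ twist Z r k) : twistFamily φ ∈ homObj M Z r k := by
  refine ⟨?_, ?_⟩
  · intro p q p' q' h h' hp hq i j e x
    rw [twistFamily_apply, twistFamily_apply, twistLin_res, twistEval_res, res_twistEval]
  · intro s p u v w h₁ h₂ h₃ h₄ l i m j t e₁ e₂ e₃ e₄ a x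
    rw [twistFamily_apply, twistFamily_apply, twistLin_smul, twistEval_smul h₁ h₂ h₃ h₄]

/-- The element of `lim_{p + r ≤ q} (Z_q)_{i + k}` given by a compatible family. -/
def twistMk {p : GMPerversity n} {i j : ℤ} (e : i + k = j)
    (c : ∀ q, GMPerversity.SumLE p r q → (Z.X.obj q).X j)
    (hc : ∀ q q' (h : GMPerversity.SumLE p r q) (h' : GMPerversity.SumLE p r q') (hq : q ≤ q'),
      Z.X.res hq j (c q h) = c q' h') : twistObj Z r k p i :=
  ⟨fun q => e ▸ c q.1 q.2, fun q q' hq => by subst e; exact hc q.1 q'.1 q.2 q'.2 hq⟩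

theorem twistEval_twistMk {p q : GMPerversity n} {i j : ℤ} (e : i + k = j)
    (c : ∀ q, GMPerversity.SumLE p r q → (Z.X.obj q).X j) (hc)
    (h : GMPerversity.SumLE p r q) : twistEval h e (twistMk e c hc) = c q h := by
  subst e
  rfl

/-- Compatible families of cycles in an acyclic module are boundaries of compatible families. -/
theorem exists_twistObj_diff_eq (hZ : Z.X.IsAcyclic) {p : GMPerversity n} {i j j' j'' : ℤ}
    (e : i + k = j') (hj : j + 1 = j') (hj' : j'' + 1 = j)
    (c : ∀ q, GMPerversity.SumLE p r q → (Z.X.obj q).X j)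
    (hc : ∀ q q' (h : GMPerversity.SumLE p r q) (h' : GMPerversity.SumLE p r q') (hq : q ≤ q'),
      Z.X.res hq j (c q h) = c q' h')
    (hd : ∀ q h, Z.X.diff q j j'' (c q h) = 0) :
    ∃ w : twistObj Z r k p i, ∀ q h, Z.X.diff q j' j (twistEval (q := q) h e w) = c q h := by
  by_cases hp : ∃ q, GMPerversity.SumLE p r q
  -- A primitive chosen at the least index `p ⊕ r` restricts to a compatible family of primitives at
  -- all `q`.
  · obtain ⟨q₀, h₀⟩ := hp
    obtain ⟨y, hy⟩ := (ChainComplex.acyclic_iff_forall_exists _).1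
      (hZ (GMPerversity.oplus h₀)) j' j j'' hj hj' _ (hd _ (GMPerversity.sumLE_oplus h₀))
    refine ⟨twistMk e (fun q h => Z.X.res (GMPerversity.oplus_le h₀ h) j' y)
      (fun q q' h h' hq => Z.X.res_res _ _ _ _), fun q h => ?_⟩
    rw [twistEval_twistMk, Z.X.diff_res]
    refine (congrArg _ hy).trans (hc _ _ _ _ _)
  -- No perversity dominates `p + r`: the limit is over the empty set and there is nothing to solve.
  · exact ⟨0, fun q h => (hp ⟨q, h⟩).elim⟩

theorem isAcyclic_internalHom (h : ∀ (r : GMPerversity n) (k k' k'' : ℤ), k + 1 = k' →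
    k'' + 1 = k → ∀ f ∈ homObj M Z r k, homFamilyDiff M Z r k k'' f = 0 →
      ∃ g ∈ homObj M Z r k', homFamilyDiff M Z r k' k g = f) : (internalHom M Z).IsAcyclic := by
  intro r
  refine (ChainComplex.acyclic_iff_forall_exists _).2 fun i j k hi hk f hf => ?_
  obtain ⟨g, hg, hgf⟩ := h r j i k hi hk f.1 f.2 (congrArg Subtype.val hf)
  exact ⟨⟨g, hg⟩, Subtype.ext hgf⟩

theorem exists_of_isAcyclic_internalHom (h : (internalHom M Z).IsAcyclic) (r : GMPerversity n)
    {k k' k'' : ℤ} (hk : k + 1 = k') (hk' : k'' + 1 = k) {f : HomFamily M Z r k}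
    (hf : f ∈ homObj M Z r k) (hd : homFamilyDiff M Z r k k'' f = 0) :
    ∃ g ∈ homObj M Z r k', homFamilyDiff M Z r k' k g = f := by
  obtain ⟨g, hg⟩ := (ChainComplex.acyclic_iff_forall_exists _).1 (h r) k' k k'' hk hk' ⟨f, hf⟩
    (Subtype.ext hd)
  exact ⟨g.1, g.2, congrArg Subtype.val hg⟩

section Precomp

variable {M' : PDGModule A}

/-- Precomposition of families of maps with a morphism of pDG modules. -/
def precomp (φ : M' ⟶ M) (f : HomFamily M Z r k) : HomFamily M' Z r k := fun t =>
  f t ∘ₗ Hom.lin φ t.p t.i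

theorem precomp_apply (φ : M' ⟶ M) (f : HomFamily M Z r k) {p q : GMPerversity n}
    (h : GMPerversity.SumLE p r q) {i j : ℤ} (e : i + k = j) (x : (M'.X.obj p).X i) :
    precomp φ f ⟨p, q, i, j, h, e⟩ x = f ⟨p, q, i, j, h, e⟩ (Hom.lin φ p i x) := rfl

theorem precomp_mem (φ : M' ⟶ M) {f : HomFamily M Z r k} (hf : f ∈ homObj M Z r k) :
    precomp φ f ∈ homObj M' Z r k := by
  refine ⟨?_, ?_⟩
  · intro p q p' q' h h' hp hq i j e x
    rw [precomp_apply, precomp_apply, Hom.lin_res, hf.1 p q p' q' h h' hp hq]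
  · intro s p u v w h₁ h₂ h₃ h₄ l i m j t e₁ e₂ e₃ e₄ a x
    rw [precomp_apply, precomp_apply, Hom.lin_smul,
      hf.2 s p u v w h₁ h₂ h₃ h₄ l i m j t e₁ e₂ e₃ e₄]

theorem homFamilyDiff_precomp (φ : M' ⟶ M) (f : HomFamily M Z r k) (k' : ℤ) :
    homFamilyDiff M' Z r k k' (precomp φ f) = precomp φ (homFamilyDiff M Z r k k' f) := by
  funext ⟨p, q, i, j, h, e⟩
  ext x
  rw [homFamilyDiff_apply M' Z _ h e (j' := i + k) (i' := j - k) rfl (by omega)]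
  refine Eq.trans ?_ (homFamilyDiff_apply M Z f h e (j' := i + k) (i' := j - k) rfl (by omega)
    (Hom.lin φ p i x)).symm
  rw [precomp_apply, precomp_apply, Hom.lin_diff]

theorem twistFamily_comp (φ : M' ⟶ M) (g : M.toGraded ⟶ twist Z r k) :
    twistFamily (toGradedMap φ ≫ g) = precomp φ (twistFamily g) := rfl

/-- The submodule on which an element of `Hom_A(M, Z)` vanishes. -/
def vanishing {f : HomFamily M Z r k} (hf : f ∈ homObj M Z r k) : PGModule.Sub M.toGraded where
  carrier p i :=
    { carrier := {x : (M.X.obj p).X i | ∀ q j h e, f ⟨p, q, i, j, h, e⟩ x = 0}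
      zero_mem' := fun q j h e => map_zero _
      add_mem' := fun hx hy q j h e =>
        (map_add (f ⟨p, q, i, j, h, e⟩) _ _).trans (by rw [hx, hy, add_zero])
      smul_mem' := fun c x hx q j h e =>
        (map_smul (f ⟨p, q, i, j, h, e⟩) c _).trans (by rw [hx, smul_zero]) }
  res_mem {p p'} hp {i} x hx q j h e := by
    have := hf.1 p' q p q h (h.mono hp le_rfl le_rfl) hp le_rfl i j e x
    rw [Z.X.res_refl] at this
    exact this.symm.trans (hx _ _ _ _)
  smul_mem {s p u} h₁ {l i m} e₁ a x hx w t h₂ e₂ := by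
    -- For every target `w`, the value on `a x` is up to sign `a` times the value on `x` at `p ⊕ r`.
    have hw := sumLE_oplus_twist h₁ h₂
    have := hf.2 s p u _ w h₁ h₂ (GMPerversity.sumLE_oplus hw.1) (hw.2 hw.1) l i m (i + k) t e₁ e₂
      rfl (by omega) a x
    refine this.trans ?_
    rw [hx, map_zero, smul_zero]

/-- Since the zero locus is a graded submodule, an element of Hom_A(M, Z) vanishes as soon as it
does on generators. This is how equations of the form `D g = f` are reduced to a basis. -/
theorem eq_zero_of_vanishing {f : HomFamily M Z r k} (hf : f ∈ homObj M Z r k)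
    (h : ∀ p i (x : (M.X.obj p).X i), x ∈ (vanishing hf).carrier p i) : f = 0 := by
  funext ⟨p, q, i, j, hpq, hij⟩
  ext x
  exact h p i x q j hpq hij

end Precomp

end PDGModule

end Twist

/-! ### Semi-projective modules are cofibrant -/

section Lifting

variable {R : Type u} [CommRing R] {n : ℕ} {A : PDGAlgebra.{u} R n}

namespace PDGModule

variable {M N X Y : PDGModule A}

/-- The component of a morphism between the perverse graded modules underlying pDG modules. -/
def gradedHomLin (φ : M.toGraded ⟶ N.toGraded) (p : GMPerversity n) (i : ℤ) :
    (M.X.obj p).X i →ₗ[R] (N.X.obj p).X i :=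
  gradedLin φ p i

theorem gradedHomLin_res (φ : M.toGraded ⟶ N.toGraded) {p q : GMPerversity n} (h : p ≤ q)
    (i : ℤ) (x : (M.X.obj p).X i) :
    gradedHomLin φ q i (M.X.res h i x) = N.X.res h i (gradedHomLin φ p i x) :=
  gradedLin_res φ h i x

theorem gradedHomLin_smul (φ : M.toGraded ⟶ N.toGraded) {p q r : GMPerversity n}
    (h : GMPerversity.SumLE p q r) {i j k : ℤ} (e : i + j = k) (a : (A.X.obj p).X i)
    (x : (M.X.obj q).X j) :
    gradedHomLin φ r k (M.smul h e a x) = N.smul h e a (gradedHomLin φ q j x) :=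
  gradedLin_smul φ h e a x

/-- A pDG submodule as a pDG module. -/
def Sub.toModule (S : Sub M) : PDGModule A where
  X := PerverseComplex.ofRes (fun p i => ModuleCat.of R (S.carrier p i))
    (fun h i => (M.X.res h i).restrict fun _ hx => S.res_mem h hx)
    (fun p i j => (M.X.diff p i j).restrict fun _ hx => S.diff_mem i j hx)
    (fun p i x => Subtype.ext (M.X.res_refl p i x.1))
    (fun h h' i x => Subtype.ext (M.X.res_res h h' i x.1))
    (fun h i j x => Subtype.ext (M.X.diff_res h i j x.1))
    (fun p i j h x => Subtype.ext (M.X.diff_eq_zero p i j h x.1))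
    (fun p i j k _ _ x => Subtype.ext (M.X.diff_diff p i j k x.1))
  smul h _ _ _ e :=
    { toFun := fun a => (M.smul h e a).restrict fun _ hx => S.smul_mem h e a hx
      map_add' := fun a b => LinearMap.ext fun x =>
        Subtype.ext (LinearMap.congr_fun (map_add (M.smul h e) a b) x.1)
      map_smul' := fun c a => LinearMap.ext fun x =>
        Subtype.ext (LinearMap.congr_fun (map_smul (M.smul h e) c a) x.1) }
  res_smul h h' hp hq hr _ _ _ e a x := Subtype.ext (M.res_smul h h' hp hq hr e a x.1)
  one_smul h _ x := Subtype.ext (M.one_smul h x.1)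
  mul_smul h₁ h₂ h₃ h₄ _ _ _ _ _ _ e₁ e₂ e₃ e₄ a b x :=
    Subtype.ext (M.mul_smul h₁ h₂ h₃ h₄ e₁ e₂ e₃ e₄ a b x.1)
  leibniz h _ _ _ _ _ _ e e₁ e₂ hk a x := Subtype.ext (M.leibniz h e e₁ e₂ hk a x.1)

/-- The kernel of a morphism of pDG modules. -/
def kerSub (f : M ⟶ N) : Sub M where
  carrier p i := LinearMap.ker (Hom.lin f p i)
  res_mem h _ x hx := by
    rw [LinearMap.mem_ker] at hx ⊢
    rw [Hom.lin_res, hx, map_zero]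
  diff_mem i j x hx := by
    rw [LinearMap.mem_ker] at hx ⊢
    rw [Hom.lin_diff, hx, map_zero]
  smul_mem h _ _ _ e a x hx := by
    rw [LinearMap.mem_ker] at hx ⊢
    rw [Hom.lin_smul, hx, map_zero]

/-- The inclusion of a pDG submodule. -/
def Sub.ι (S : Sub M) : S.toModule ⟶ M :=
  homOfLin (fun p i => (S.carrier p i).subtype) (fun _ _ _ => rfl) (fun _ _ _ _ _ => rfl)
    (fun _ _ _ _ _ _ _ => rfl)

theorem Sub.ι_injective (S : Sub M) (p : GMPerversity n) (i : ℤ) :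
    Function.Injective (Hom.lin S.ι p i) := Subtype.val_injective

/-- The sequence `0 → ker f → M → N → 0` in perversity `p`. -/
def kerSequence (f : M ⟶ N) (p : GMPerversity n) :
    ShortComplex (ChainComplex (ModuleCat.{u} R) ℤ) :=
  ShortComplex.mk ((kerSub f).ι.hom.app p) (f.hom.app p)
    (HomologicalComplex.hom_ext _ _ fun _ => ModuleCat.hom_ext (LinearMap.ext fun x => x.2))

theorem shortExact_kerSequence (f : M ⟶ N)
    (hf : ∀ p i, Function.Surjective (Hom.lin f p i)) (p : GMPerversity n) :
    (kerSequence f p).ShortExact := by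
  refine HomologicalComplex.shortExact_of_degreewise_shortExact _ fun i => ?_
  refine ShortComplex.ShortExact.mk' ?_ ?_ ?_
  · rw [ShortComplex.moduleCat_exact_iff]
    intro x hx
    exact ⟨⟨x, hx⟩, rfl⟩
  · exact (ModuleCat.mono_iff_injective _).2 Subtype.val_injective
  · exact (ModuleCat.epi_iff_surjective _).2 (hf p i)

/-- By the long exact homology sequence, trivial fibrations are exactly the componentwise
surjections with acyclic kernel; this is one half, the next lemma the other. -/
theorem isAcyclic_ker {f : M ⟶ N} (hf : trivialFibrations (PDGModule A) f) :
    (kerSub f).toModule.X.IsAcyclic := fun p =>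
  (shortExact_kerSequence f hf.1 p).acyclic_X₁ (hf.2 p)

theorem trivialFibrations_of_isAcyclic_ker {f : M ⟶ N}
    (hf : ∀ p i, Function.Surjective (Hom.lin f p i))
    (h : (kerSub f).toModule.X.IsAcyclic) : trivialFibrations (PDGModule A) f :=
  ⟨hf, fun p => (shortExact_kerSequence f hf p).quasiIso_g (h p)⟩

section

variable (f : X ⟶ Y) (g : M ⟶ Y) (h : ∀ p i, (M.X.obj p).X i →ₗ[R] (X.X.obj p).X i)
  (hfg : ∀ p i x, Hom.lin f p i (h p i x) = Hom.lin g p i x)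

/-- The defect `d h - h d` of a graded lift `h` of `g` along `f`, with values in the kernel
of `f`. -/
def liftDefect : HomFamily M (kerSub f).toModule 0 (-1) := fun t =>
  LinearMap.codRestrict ((kerSub f).carrier t.q t.j)
    (X.X.res t.hpq.le_left t.j ∘ₗ (X.X.diff t.p t.i t.j ∘ₗ h t.p t.i -
      h t.p t.j ∘ₗ M.X.diff t.p t.i t.j)) (fun x => by
      simp only [kerSub, LinearMap.mem_ker, LinearMap.comp_apply, LinearMap.sub_apply]
      rw [Hom.lin_res, map_sub, Hom.lin_diff, hfg, hfg, Hom.lin_diff, sub_self, map_zero])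

theorem liftDefect_apply {p q : GMPerversity n} {i j : ℤ} (e : GMPerversity.SumLE p 0 q)
    (e' : i + -1 = j) (x : (M.X.obj p).X i) :
    Hom.lin (kerSub f).ι q j (liftDefect f g h hfg ⟨p, q, i, j, e, e'⟩ x) =
      X.X.res e.le_left j (X.X.diff p i j (h p i x) - h p j (M.X.diff p i j x)) := rfl

/-- In the Leibniz rules for `d h` and `h d` the terms containing `d a` cancel. What remains carries
the sign `(-1)^|a|`, as an element of degree `-1` must. -/
theorem liftDefect_mem (hres : ∀ {p q : GMPerversity n} (e : p ≤ q) i x,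
      h q i (M.X.res e i x) = X.X.res e i (h p i x))
    (hsmul : ∀ {p q r : GMPerversity n} (e : GMPerversity.SumLE p q r) {i j k : ℤ}
      (e' : i + j = k) (a : (A.X.obj p).X i) (x : (M.X.obj q).X j),
      h r k (M.smul e e' a x) = X.smul e e' a (h q j x)) :
    liftDefect f g h hfg ∈ homObj M (kerSub f).toModule 0 (-1) := by
  refine ⟨?_, ?_⟩
  · intro p q p' q' e e' hp hq i j hij x
    refine (kerSub f).ι_injective q' j ?_
    rw [Hom.lin_res, liftDefect_apply, liftDefect_apply]
    rw [hres, M.X.diff_res, hres, X.X.diff_res, ← map_sub, X.X.res_res, X.X.res_res]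
  · intro s p u v w h₁ h₂ h₃ h₄ l i m j t e₁ e₂ e₃ e₄ a x
    refine (kerSub f).ι_injective w t ?_
    rw [map_zsmul_unit, Hom.lin_smul, liftDefect_apply, liftDefect_apply]
    rw [hsmul, X.leibniz h₁ (i' := l - 1) (j' := j) e₁ (by omega) (by omega) (by omega),
      M.leibniz h₁ (i' := l - 1) (j' := j) e₁ (by omega) (by omega) (by omega), map_add, hsmul,
      map_zsmul_unit, hsmul, add_sub_add_left_eq_sub, ← smul_sub, ← map_sub, map_zsmul_unit,
      X.res_smul h₁ h₄ le_rfl h₃.le_left h₂.le_left, A.X.res_refl, neg_one_mul, Int.negOnePow_neg]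

/-- Formally the defect is `D h`, so `D` kills it. It need not be a boundary in Hom_A(M, ker f),
because `h` does not take values in the kernel. -/
theorem homFamilyDiff_liftDefect :
    homFamilyDiff M (kerSub f).toModule 0 (-1) (-2) (liftDefect f g h hfg) = 0 := by
  funext ⟨p, q, i, j, e, e'⟩
  ext x
  obtain rfl : j = i - 1 - 1 := by omega
  rw [homFamilyDiff_apply M _ _ e e' (j' := i - 1) (i' := i - 1) (by omega) (by omega)]
  refine (kerSub f).ι_injective q _ ?_
  rw [map_sub, map_zsmul_unit, Hom.lin_diff, liftDefect_apply, liftDefect_apply]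
  rw [X.X.diff_res, map_sub, X.X.diff_diff, M.X.diff_diff, map_zero, ← map_zsmul_unit, ← map_sub]
  simp

end

/-- Projectivity gives a graded lift `φ`. Its defect is a cycle with values in the acyclic kernel of
`f`, so it equals `D γ` for some `γ` of degree 0. Subtracting `γ` removes the defect and leaves the
composite with `f` unchanged. -/
theorem IsSemiProjective.exists_lift (hM : M.IsSemiProjective) (f : X ⟶ Y)
    (hf : trivialFibrations (PDGModule A) f) (g : M ⟶ Y) : ∃ l : M ⟶ X, l ≫ f = g := by
  have : Projective M.toGraded := hM.1
  have : Epi (toGradedMap f) := PGModule.epi_of_surjective _ hf.1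
  obtain ⟨φ, hφ⟩ := Projective.factors (toGradedMap g) (toGradedMap f)
  have hfg : ∀ p i x, Hom.lin f p i (gradedHomLin φ p i x) = Hom.lin g p i x := fun p i x =>
    congrArg (fun ψ => PGModule.Hom.lin ψ p i x) hφ
  obtain ⟨γ, hγ, hd⟩ := exists_of_isAcyclic_internalHom (hM.2 _ (isAcyclic_ker hf)) 0
    (k := -1) (k' := 0) (k'' := -2) rfl rfl
    (liftDefect_mem f g _ hfg (gradedHomLin_res φ) (gradedHomLin_smul φ))
    (homFamilyDiff_liftDefect f g _ hfg)
  have hp : ∀ p : GMPerversity n, GMPerversity.SumLE p 0 p := fun p =>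
    GMPerversity.sumLE_zero_right le_rfl
  -- An element of Hom_A(M, ker f)_0 has components from perversity `p` to every `q ≥ p`; the
  -- correction uses the diagonal ones.
  let c : ∀ p i, (M.X.obj p).X i →ₗ[R] (X.X.obj p).X i := fun p i =>
    Hom.lin (kerSub f).ι p i ∘ₗ γ ⟨p, p, i, i, hp p, add_zero i⟩
  have hcres : ∀ {p q : GMPerversity n} (h : p ≤ q) i x,
      c q i (M.X.res h i x) = X.X.res h i (c p i x) := by
    intro p q h i x
    -- Restricting before or after a diagonal component gives the component of `γ` from `p` to `q`
    -- in both cases.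
    have h1 := hγ.1 q q p q (hp q) (GMPerversity.sumLE_zero_right h) h le_rfl i i (add_zero i) x
    have h2 := hγ.1 p p p q (hp p) (GMPerversity.sumLE_zero_right h) le_rfl h i i (add_zero i) x
    rw [PerverseComplex.res_refl] at h1 h2
    exact congrArg Subtype.val (h1.symm.trans h2)
  have hcsmul : ∀ {p q r : GMPerversity n} (e : GMPerversity.SumLE p q r) {i j k : ℤ}
      (e' : i + j = k) (a : (A.X.obj p).X i) (x : (M.X.obj q).X j),
      c r k (M.smul e e' a x) = X.smul e e' a (c q j x) := by
    intro p q r e i j k e' a x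
    have h1 := hγ.2 p q r q r e (hp r) (hp q) e i j k j k e' (add_zero k) (add_zero j) e' a x
    rw [zero_mul, Int.negOnePow_zero] at h1
    exact congrArg Subtype.val (h1.trans (_root_.one_smul _ _))
  have hcd : ∀ p i j, j + 1 = i → ∀ x, X.X.diff p i j (c p i x) - c p j (M.X.diff p i j x) =
      X.X.diff p i j (gradedHomLin φ p i x) - gradedHomLin φ p j (M.X.diff p i j x) := by
    intro p i j hij x
    have h1 := homFamilyDiff_apply M _ γ (hp p) (k' := -1) (i := i) (j := j) (i' := j) (j' := i)
      (by omega) (add_zero i) (add_zero j) x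
    rw [hd] at h1
    have h2 := congrArg (Hom.lin (kerSub f).ι p j) h1
    rw [liftDefect_apply, X.X.res_refl, map_sub (Hom.lin (kerSub f).ι p j), map_zsmul_unit,
      Hom.lin_diff, Int.negOnePow_zero] at h2
    exact (h2.trans (congrArg _ (_root_.one_smul ℤˣ _))).symm
  refine ⟨homOfLin (fun p i => gradedHomLin φ p i - c p i) ?_ ?_ ?_, ?_⟩
  · intro p q h i x
    rw [LinearMap.sub_apply, LinearMap.sub_apply, gradedHomLin_res, hcres, map_sub]
  · intro p i j hij x
    have := hcd p i j hij x
    rw [LinearMap.sub_apply, LinearMap.sub_apply, map_sub, sub_eq_sub_iff_sub_eq_sub,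
      ← neg_sub, ← this, neg_sub]
  · intro p q r e i j k e' a x
    rw [LinearMap.sub_apply, LinearMap.sub_apply, gradedHomLin_smul, hcsmul, map_sub]
  · refine Hom.lin_ext fun p i x => ?_
    rw [Hom.lin_comp, lin_homOfLin, LinearMap.sub_apply, map_sub, hfg]
    exact sub_eq_self.2 (γ ⟨p, p, i, i, hp p, add_zero i⟩ x).2

/-- The map to be tested starts at an initial object, so the upper triangle of a lifting square
commutes automatically. -/
theorem isCofibrant_of_exists_lift
    (h : ∀ {X Y : PDGModule A} (f : X ⟶ Y), trivialFibrations (PDGModule A) f → ∀ g : M ⟶ Y,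
      ∃ l : M ⟶ X, l ≫ f = g) : IsCofibrant M := by
  refine (isCofibrant_iff M).2 ⟨fun X Y f hf => ⟨fun {u v} sq => ?_⟩⟩
  obtain ⟨l, hl⟩ := h f hf v
  exact ⟨⟨{ l := l, fac_left := initial.hom_ext _ _, fac_right := hl }⟩⟩

theorem exists_lift_of_isCofibrant (hM : IsCofibrant M) (f : X ⟶ Y)
    (hf : trivialFibrations (PDGModule A) f) (g : M ⟶ Y) : ∃ l : M ⟶ X, l ≫ f = g := by
  have h : HasLiftingProperty (initial.to M) f := ((isCofibrant_iff M).1 hM).mem f hf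
  have sq : CommSq (initial.to X) (initial.to M) f g := ⟨initial.hom_ext _ _⟩
  exact ⟨sq.lift, sq.fac_right⟩

theorem IsSemiProjective.isCofibrant (hM : M.IsSemiProjective) : IsCofibrant M :=
  isCofibrant_of_exists_lift fun f hf g => hM.exists_lift f hf g

end PDGModule

end Lifting

/-! ### Homogeneous bases of free perverse complexes and of A ⊠ K -/

section FreeBasis

variable {R : Type u} [CommRing R] {n : ℕ}

/-- A perverse graded module as a perverse chain complex with zero differential. -/
def PerverseGraded.toComplex (Y : PerverseGraded R n) : PerverseComplex R n :=
  PerverseComplex.ofRes (fun p i => Y.obj p i) (fun h i => Y.res h i) (fun _ _ _ => 0)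
    Y.res_refl Y.res_res (fun _ _ _ _ => (map_zero _).symm) (fun _ _ _ _ _ => rfl)
    (fun _ _ _ _ _ _ _ => rfl)

namespace PerverseComplex

/-- The component of a morphism to a perverse graded module. -/
def linOfHom {K : PerverseComplex R n} {Y : PerverseGraded R n} (τ : K ⟶ Y.toComplex)
    (p : GMPerversity n) (i : ℤ) : (K.obj p).X i →ₗ[R] Y.obj p i :=
  ((τ.app p).f i).hom

theorem linOfHom_res {K : PerverseComplex R n} {Y : PerverseGraded R n} (τ : K ⟶ Y.toComplex)
    {p q : GMPerversity n} (h : p ≤ q) (i : ℤ) (x : (K.obj p).X i) :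
    linOfHom τ q i (K.res h i x) = Y.res h i (linOfHom τ p i x) :=
  congrArg (fun f => (f.f i).hom x) (τ.naturality (homOfLE h))

/-- A chain map from a complex with zero differential to a perverse graded module, given by its
components. -/
def homToGraded {V : ChainComplex (ModuleCat.{u} R) ℤ} (hV : ∀ i j, V.d i j = 0)
    {Y : PerverseGraded R n} {p : GMPerversity n} (f : ∀ i, V.X i →ₗ[R] Y.obj p i) :
    V ⟶ Y.toComplex.obj p where
  f i := ModuleCat.ofHom (f i)
  comm' i j _ := ModuleCat.hom_ext <| LinearMap.ext fun x => by
    have h : (V.d i j).hom x = 0 := congrArg (fun g => g.hom x) (hV i j)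
    exact ((congrArg (f j) h).trans (map_zero _)).symm

/-- A family of homogeneous elements is a graded basis if morphisms to perverse graded modules
are determined by arbitrary values on the family. -/
def IsGradedBasis (K : PerverseComplex R n) {Λ : Type u} (p : Λ → GMPerversity n) (i : Λ → ℤ)
    (b : ∀ l, (K.obj (p l)).X (i l)) : Prop :=
  ∀ (Y : PerverseGraded R n) (y : ∀ l, Y.obj (p l) (i l)),
    ∃! τ : K ⟶ Y.toComplex, ∀ l, linOfHom τ (p l) (i l) (b l) = y l

section Incl

variable {K : PerverseComplex R n} {V : GMPerversity n → ChainComplex (ModuleCat.{u} R) ℤ}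
  (e : K ≅ ∐ fun p => (evaluationLeftAdjoint _ p).obj (V p))

/-- The inclusion `V_p ⟶ (⨁_p F_p(V_p))_p`. -/
noncomputable def freeIncl (p : GMPerversity n) : V p ⟶ K.obj p :=
  (evaluationAdjunctionRight _ p).homEquiv (V p) K
    (Sigma.ι (fun p => (evaluationLeftAdjoint _ p).obj (V p)) p ≫ e.inv)

theorem freeIncl_comp_app {T : PerverseComplex R n} (τ : K ⟶ T) (p : GMPerversity n) :
    freeIncl e p ≫ τ.app p = (evaluationAdjunctionRight _ p).homEquiv (V p) T
      (Sigma.ι (fun p => (evaluationLeftAdjoint _ p).obj (V p)) p ≫ e.inv ≫ τ) := by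
  rw [← Category.assoc, Adjunction.homEquiv_naturality_right]
  rfl

/-- The universal property of the coproduct combined with the adjunction between `F_p` and
evaluation at `p`: a morphism out of `⨁ F_p(V_p)` is a family of chain maps on the `V p`. -/
theorem existsUnique_freeIncl {T : PerverseComplex R n} (t : ∀ p, V p ⟶ T.obj p) :
    ∃! τ : K ⟶ T, ∀ p, freeIncl e p ≫ τ.app p = t p := by
  refine ⟨e.hom ≫ Sigma.desc fun p => ((evaluationAdjunctionRight _ p).homEquiv (V p) T).symm (t p),
    fun p => ?_, fun τ hτ => ?_⟩
  · rw [freeIncl_comp_app]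
    simp
  · rw [← Iso.inv_comp_eq]
    refine Sigma.hom_ext _ _ fun p => ?_
    rw [Sigma.ι_desc, Equiv.eq_symm_apply, ← freeIncl_comp_app, hτ]

/-- `V p` is a retract of `K.obj p`, so it inherits the vanishing of the differential. -/
theorem d_eq_zero_of_iso (e : K ≅ ∐ fun p => (evaluationLeftAdjoint _ p).obj (V p))
    (hd : ∀ p i j, (K.obj p).d i j = 0) (p : GMPerversity n) (i j : ℤ) :
    (V p).d i j = 0 := by
  classical
  -- The retraction comes from the morphism to the constant diagram `V p` which is the identity on
  -- the summand `p` and zero on the others.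
  obtain ⟨τ, hτ, -⟩ := existsUnique_freeIncl e
    (T := (Functor.const (GMPerversity n)).obj (V p))
    (Function.update (β := fun q => V q ⟶ V p) (fun _ => 0) p (𝟙 (V p)))
  have h := hτ p
  rw [Function.update_self] at h
  have h' : (freeIncl e p).f j ≫ (τ.app p).f j = 𝟙 _ := congrArg (fun f => f.f j) h
  calc (V p).d i j = (V p).d i j ≫ (freeIncl e p).f j ≫ (τ.app p).f j := by
        rw [h', Category.comp_id]
    _ = 0 := by
      rw [← Category.assoc, ← (freeIncl e p).comm, hd, comp_zero, zero_comp]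

end Incl

/-- All differentials vanish, so a chain map on `V p` is just a family of linear maps, determined by
arbitrary values on the bases `β`. The `ULift`s only keep the index type in the universe of `R`. -/
theorem isGradedBasis_freeIncl {K : PerverseComplex R n}
    {V : GMPerversity n → ChainComplex (ModuleCat.{u} R) ℤ}
    (e : K ≅ ∐ fun p => (evaluationLeftAdjoint _ p).obj (V p)) (hV : ∀ p i j, (V p).d i j = 0)
    {Λ : GMPerversity n → ℤ → Type u} (β : ∀ p i, Module.Basis (Λ p i) R ((V p).X i)) :
    K.IsGradedBasis (Λ := Σ (p : ULift.{u} (GMPerversity n)) (i : ULift.{u} ℤ), Λ p.down i.down)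
      (fun l => l.1.down) (fun l => l.2.1.down)
      fun l => ((freeIncl e l.1.down).f l.2.1.down).hom (β _ _ l.2.2) := by
  intro Y y
  let t : ∀ p, V p ⟶ Y.toComplex.obj p := fun p => homToGraded (hV p)
    fun i => (β p i).constr R fun l => y ⟨⟨p⟩, ⟨i⟩, l⟩
  have key : ∀ τ : K ⟶ Y.toComplex, (∀ l : Σ (p : ULift.{u} (GMPerversity n)) (i : ULift.{u} ℤ),
      Λ p.down i.down, linOfHom τ l.1.down l.2.1.down
          (((freeIncl e l.1.down).f l.2.1.down).hom (β _ _ l.2.2)) = y l) ↔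
      ∀ p, freeIncl e p ≫ τ.app p = t p := by
    intro τ
    constructor
    · intro h p
      refine HomologicalComplex.hom_ext _ _ fun i => ModuleCat.hom_ext ((β p i).ext fun l => ?_)
      exact (h ⟨⟨p⟩, ⟨i⟩, l⟩).trans ((β p i).constr_basis R (M' := Y.obj p i)
          (fun l => y ⟨⟨p⟩, ⟨i⟩, l⟩) l).symm
    · rintro h ⟨⟨p⟩, ⟨i⟩, l⟩
      exact (congrArg (fun f => (f.f i).hom (β p i l)) (h p)).trans
        ((β p i).constr_basis R (M' := Y.obj p i)
          (fun l => y ⟨⟨p⟩, ⟨i⟩, l⟩) l)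
  obtain ⟨τ, hτ, hu⟩ := existsUnique_freeIncl e (T := Y.toComplex) t
  exact ⟨τ, (key τ).2 hτ, fun σ hσ => hu σ ((key σ).1 hσ)⟩

theorem IsFree.exists_isGradedBasis {K : PerverseComplex R n} (hK : K.IsFree)
    (hd : ∀ p i j, (K.obj p).d i j = 0) :
    ∃ (Λ : Type u) (p : Λ → GMPerversity n) (i : Λ → ℤ) (b : ∀ l, (K.obj (p l)).X (i l)),
      K.IsGradedBasis p i b := by
  obtain ⟨V, hV, ⟨e⟩⟩ := hK
  exact ⟨_, _, _, _, isGradedBasis_freeIncl e (d_eq_zero_of_iso e hd)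
    fun p i => Module.Free.chooseBasis R ((V p).X i)⟩

/-- The differential of `K`, as a morphism to a perverse graded module. -/
def diffHom (K : PerverseComplex R n) :
    K ⟶ (PerverseGraded.ofRes (fun p i => (K.obj p).X (i - 1)) (fun h i => K.res h (i - 1))
      (fun p i x => K.res_refl p (i - 1) x)
      (fun h h' i x => K.res_res h h' (i - 1) x)).toComplex where
  app p :=
    { f := fun i => (K.obj p).d i (i - 1)
      comm' := fun i j _ => (comp_zero (f := (K.obj p).d i (i - 1))).trans
        ((K.obj p).d_comp_d i j (j - 1)).symm }
  naturality _ _ f := HomologicalComplex.hom_ext _ _ fun i =>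
    (K.map f).comm i (i - 1)

/-- The differential of `K` is itself a morphism, `diffHom`, to a shifted graded module. It vanishes
on every `V p`, so uniqueness makes it zero. -/
theorem d_eq_zero_of_freeIncl {K : PerverseComplex R n}
    {V : GMPerversity n → ChainComplex (ModuleCat.{u} R) ℤ}
    (e : K ≅ ∐ fun p => (evaluationLeftAdjoint _ p).obj (V p)) (hV : ∀ p i j, (V p).d i j = 0)
    (p : GMPerversity n) (i j : ℤ) : (K.obj p).d i j = 0 := by
  by_cases h : j + 1 = i
  · obtain rfl : j = i - 1 := by omega
    have h0 : K.diffHom = 0 := (existsUnique_freeIncl e fun _ => 0).unique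
      (fun p => HomologicalComplex.hom_ext _ _ fun i => by
        refine ((freeIncl e p).comm i (i - 1)).trans ?_
        rw [hV, zero_comp]
        rfl)
      (fun p => comp_zero)
    exact congrArg (fun f => (f.app p).f i) h0
  · exact (K.obj p).shape i j h

/-- Free perverse chain complexes with zero differential on a given family of generators. -/
theorem exists_isFree (Λ : GMPerversity n → ℤ → Type u) :
    ∃ K : PerverseComplex R n, K.IsFree ∧ (∀ p i j, (K.obj p).d i j = 0) ∧
      ∃ b, K.IsGradedBasis
        (Λ := Σ (p : ULift.{u} (GMPerversity n)) (i : ULift.{u} ℤ), Λ p.down i.down)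
        (fun l => l.1.down) (fun l => l.2.1.down) b := by
  let V : GMPerversity n → ChainComplex (ModuleCat.{u} R) ℤ := fun p =>
    { X := fun i => ModuleCat.of R (Λ p i →₀ R)
      d := fun _ _ => 0 }
  let e := Iso.refl (∐ fun p => (evaluationLeftAdjoint _ p).obj (V p))
  exact ⟨_, ⟨V, fun p i => inferInstanceAs (Module.Free R (Λ p i →₀ R)), ⟨e⟩⟩,
    d_eq_zero_of_freeIncl e fun _ _ _ => rfl, _,
    isGradedBasis_freeIncl e (fun _ _ _ => rfl) fun _ _ => Finsupp.basisSingleOne⟩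

end PerverseComplex

variable {A : PDGAlgebra.{u} R n}

/-- The Leibniz rule for `1 * 1` reads `d 1 = d 1 + d 1`. -/
theorem PDGAlgebra.diff_one (A : PDGAlgebra.{u} R n) : A.X.diff 0 0 (-1) A.one = 0 := by
  have h := A.leibniz (GMPerversity.sumLE_zero_left (le_refl 0)) (zero_add 0)
    (i' := -1) (j' := -1) (k' := -1) rfl rfl rfl A.one A.one
  have h1 := A.mul_one (le_refl 0) (A.X.diff 0 0 (-1) A.one)
  have h2 := A.one_mul (le_refl 0) (A.X.diff 0 0 (-1) A.one)
  have h3 := A.one_mul (le_refl 0) A.one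
  rw [A.X.res_refl] at h1 h2 h3
  rw [h3, Int.negOnePow_zero] at h
  have h4 := h.trans (congrArg₂ (· + ·) h1 ((_root_.one_smul ℤˣ _).trans h2))
  exact left_eq_add.1 h4

namespace PDGModule

variable (A) (K : PerverseComplex R n)

/-- The element `1 ⊗ x` of `A ⊠ K`. -/
noncomputable def freeUnit (p : GMPerversity n) (i : ℤ) :
    (K.obj p).X i →ₗ[R] ((free A K).X.obj p).X i :=
  PerverseComplex.boxMk A.X K (GMPerversity.sumLE_zero_left le_rfl) (zero_add i) A.one

theorem freeUnit_res {p q : GMPerversity n} (h : p ≤ q) (i : ℤ) (x : (K.obj p).X i) :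
    freeUnit A K q i (K.res h i x) = (free A K).X.res h i (freeUnit A K p i x) := by
  refine Eq.trans ?_ (PerverseComplex.boxRes_mk A.X K h _ _ _ _).symm
  have := PerverseComplex.boxMk_res A.X K (GMPerversity.sumLE_zero_left h)
    (GMPerversity.sumLE_zero_left le_rfl) (zero_add i) le_rfl h A.one x
  rw [A.X.res_refl] at this
  exact this

/-- Thus the elements `1 ⊗ x` generate `A ⊠ K`. -/
theorem smul_freeUnit {p q r : GMPerversity n} (h : GMPerversity.SumLE p q r) {i j k : ℤ}
    (e : i + j = k) (a : (A.X.obj p).X i) (x : (K.obj q).X j) :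
    (free A K).smul h e a (freeUnit A K q j x) = PerverseComplex.boxMk A.X K h e a x := by
  refine (freeSMul_mk A K h e a _ _ (GMPerversity.sumLE_zero_right le_rfl) h (add_zero i) e
    A.one x).trans ?_
  rw [A.mul_one (le_refl p), A.X.res_refl]

variable {K}

theorem free_hom_ext {W : PGModule A} {φ ψ : (free A K).toGraded ⟶ W}
    (h : ∀ p i x, gradedLin φ p i (freeUnit A K p i x) = gradedLin ψ p i (freeUnit A K p i x)) :
    φ = ψ := by
  refine PGModule.Hom.lin_ext fun p i x => ?_
  refine LinearMap.congr_fun (PerverseComplex.box_hom_ext (X := A.X) (Y := K)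
    (f := gradedLin φ p i) (g := gradedLin ψ p i) fun p q i j hpq hij a x => ?_) x
  rw [← smul_freeUnit]
  refine (gradedLin_smul φ hpq hij a _).trans (Eq.trans ?_ (gradedLin_smul ψ hpq hij a _).symm)
  rw [h]

/-- The components of `freeDesc`. -/
noncomputable def freeDescLin {W : PGModule A} (τ : K ⟶ W.X.toComplex) (r : GMPerversity n)
    (k : ℤ) : A.X.BoxObj K r k →ₗ[R] W.X.obj r k :=
  PerverseComplex.boxDesc (X := A.X) (Y := K)
    (fun _ q _ j hpq hij => (W.smul hpq hij).compl₂ (PerverseComplex.linOfHom τ q j))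
    (fun p q p' q' i j hpq hpq' hij hp hq a x => by
      rw [LinearMap.compl₂_apply, LinearMap.compl₂_apply, PerverseComplex.linOfHom_res,
        ← W.res_smul hpq hpq' hp hq le_rfl, W.X.res_refl])

theorem freeDescLin_mk {W : PGModule A} (τ : K ⟶ W.X.toComplex) {p q r : GMPerversity n}
    {i j k : ℤ} (h : GMPerversity.SumLE p q r) (e : i + j = k) (a : (A.X.obj p).X i)
    (x : (K.obj q).X j) : freeDescLin A τ r k (PerverseComplex.boxMk A.X K h e a x) =
      W.smul h e a (PerverseComplex.linOfHom τ q j x) :=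
  PerverseComplex.boxDesc_mk _ _ _ _ _ _

/-- The morphism `A ⊠ K ⟶ W` induced by a morphism `K ⟶ W`. -/
noncomputable def freeDesc {W : PGModule A} (τ : K ⟶ W.X.toComplex) :
    (free A K).toGraded ⟶ W :=
  PGModule.homOfLin (X := (free A K).toGraded) (freeDescLin A τ)
    (fun {p q} h i x => by
      refine LinearMap.congr_fun (PerverseComplex.box_hom_ext (X := A.X) (Y := K)
        (f := freeDescLin A τ q i ∘ₗ A.X.boxRes K h i)
        (g := W.X.res h i ∘ₗ freeDescLin A τ p i) fun p₁ q₁ i j hpq hij a x => ?_) x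
      rw [LinearMap.comp_apply, LinearMap.comp_apply, PerverseComplex.boxRes_mk,
        freeDescLin_mk, freeDescLin_mk,
        W.res_smul hpq (hpq.mono le_rfl le_rfl h) le_rfl le_rfl h,
        A.X.res_refl, W.X.res_refl])
    (fun {p q r} h {i j k} e a x => by
      refine LinearMap.congr_fun (PerverseComplex.box_hom_ext (X := A.X) (Y := K)
        (f := freeDescLin A τ r k ∘ₗ freeSMul A K h e a)
        (g := W.smul h e a ∘ₗ freeDescLin A τ q j) fun p₁ q₁ i₁ j₁ h₁ e₁ b x => ?_) x
      have hw := GMPerversity.sumLE_oplus (h.assoc_left h₁)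
      have hw' := GMPerversity.sumLE_oplus_assoc h h₁
      rw [LinearMap.comp_apply, LinearMap.comp_apply,
        freeSMul_mk A K h e a h₁ e₁ hw hw' rfl (by omega), freeDescLin_mk, freeDescLin_mk,
        W.mul_smul hw hw' h₁ h rfl _ e₁ e])

theorem freeDesc_freeUnit {W : PGModule A} (τ : K ⟶ W.X.toComplex) (p : GMPerversity n) (i : ℤ)
    (x : (K.obj p).X i) :
    gradedLin (freeDesc A τ) p i (freeUnit A K p i x) = PerverseComplex.linOfHom τ p i x := by
  refine (freeDescLin_mk A τ _ _ _ _).trans ?_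
  rw [W.one_smul (le_refl p), W.X.res_refl]

/-- Restriction to `1 ⊗ K`, with inverse `freeDesc`, identifies graded morphisms out of `A ⊠ K` with
morphisms out of `K`, and these are arbitrary on a graded basis. -/
theorem isBasis_free {Λ : Type u} {p : Λ → GMPerversity n} {i : Λ → ℤ}
    {b : ∀ l, (K.obj (p l)).X (i l)} (hd : ∀ p i j, (K.obj p).d i j = 0)
    (hb : K.IsGradedBasis p i b) :
    (free A K).toGraded.IsBasis p i fun l => freeUnit A K (p l) (i l) (b l) := by
  intro W w
  obtain ⟨τ, hτ, hu⟩ := hb W.X w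
  refine ⟨freeDesc A τ, fun l => (freeDesc_freeUnit A τ _ _ _).trans (hτ l), fun ψ hψ => ?_⟩
  -- The restriction of `ψ` to `1 ⊗ K`; it is a chain map to a complex with zero differential
  -- because `K` has zero differential.
  let σ : K ⟶ W.X.toComplex :=
    { app := fun p =>
        PerverseComplex.homToGraded (hd p) fun i => gradedLin ψ p i ∘ₗ freeUnit A K p i
      naturality := fun p q f => HomologicalComplex.hom_ext _ _ fun i =>
        ModuleCat.hom_ext <| LinearMap.ext fun x =>
          (congrArg (gradedLin ψ q i) (freeUnit_res A K (leOfHom f) i x)).trans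
            (gradedLin_res ψ (leOfHom f) i _) }
  have hσ : σ = τ := hu σ hψ
  refine free_hom_ext A fun p i x => ?_
  rw [freeDesc_freeUnit, ← hσ]
  rfl

theorem diff_freeUnit (hd : ∀ p i j, (K.obj p).d i j = 0) (p : GMPerversity n) (i j : ℤ)
    (x : (K.obj p).X i) : (free A K).X.diff p i j (freeUnit A K p i x) = 0 := by
  by_cases h : j + 1 = i
  · refine (PerverseComplex.boxDiff_mk A.X K _ _ (i' := -1) (j' := j) (by omega) (by omega)
      A.one x).trans ?_
    have h1 : K.diff p i j x = 0 := congrArg (fun f => f.hom x) (hd p i j)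
    rw [A.diff_one, h1, map_zero, map_zero, smul_zero, LinearMap.zero_apply, add_zero]
    rfl
  · exact (free A K).X.diff_eq_zero p i j h _

/-- `A ⊠ K` has a basis of cycles if `K` is free with zero differential. -/
theorem exists_isBasis_free (hK : K.IsFree) (hd : ∀ p i j, (K.obj p).d i j = 0) :
    ∃ (Λ : Type u) (p : Λ → GMPerversity n) (i : Λ → ℤ)
      (b : ∀ l, ((free A K).X.obj (p l)).X (i l)),
      (free A K).toGraded.IsBasis p i b ∧ ∀ l j, (free A K).X.diff (p l) (i l) j (b l) = 0 := by
  obtain ⟨Λ, p, i, b, hb⟩ := hK.exists_isGradedBasis hd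
  exact ⟨Λ, p, i, _, isBasis_free A hd hb, fun l j => diff_freeUnit A hd _ _ _ _⟩

end PDGModule

end FreeBasis

/-! ### Semi-free modules and their retracts are semi-projective -/

section Extension

variable {R : Type u} [CommRing R] {n : ℕ} {A : PDGAlgebra.{u} R n}

namespace PGModule

variable {S T Q W : PGModule A}

/-- A short exact sequence of perverse graded modules. -/
structure IsShortExact (ι : S ⟶ T) (π : T ⟶ Q) : Prop where
  injective : ∀ p i, Function.Injective (Hom.lin ι p i)
  surjective : ∀ p i, Function.Surjective (Hom.lin π p i)
  exact : ∀ p i y, Hom.lin π p i y = 0 ↔ ∃ x, Hom.lin ι p i x = y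

namespace IsShortExact

variable {ι : S ⟶ T} {π : T ⟶ Q}

theorem exists_section {Λ : Type u} {p : Λ → GMPerversity n} {i : Λ → ℤ}
    {b : ∀ l, Q.X.obj (p l) (i l)}
    (hb : Q.IsBasis p i b) {e : ∀ l, T.X.obj (p l) (i l)}
    (he : ∀ l, Hom.lin π (p l) (i l) (e l) = b l) :
    ∃ s : Q ⟶ T, s ≫ π = 𝟙 Q ∧ ∀ l, Hom.lin s (p l) (i l) (b l) = e l := by
  obtain ⟨s, hs, -⟩ := hb T e
  refine ⟨s, (hb Q b).unique (fun l => ?_) (fun l => rfl), hs⟩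
  rw [Hom.lin_comp, hs, he]

theorem exists_sub_eq (H : IsShortExact ι π) {s : Q ⟶ T} (hs : s ≫ π = 𝟙 Q)
    (q : GMPerversity n) (j : ℤ)
    (x : T.X.obj q j) : ∃ y, Hom.lin ι q j y = x - Hom.lin s q j (Hom.lin π q j x) := by
  rw [← H.exact, map_sub, ← Hom.lin_comp, hs, Hom.lin_id, sub_self]

/-- Splitting the sequence by `s`, which maps the basis to the `e l`, writes every `x` as `ι y + s
(π x)`. So `T` is generated by the image of `ι` and the `e l`. -/
theorem hom_ext (H : IsShortExact ι π) {Λ : Type u} {p : Λ → GMPerversity n} {i : Λ → ℤ}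
    {b : ∀ l, Q.X.obj (p l) (i l)}
    (hb : Q.IsBasis p i b) {e : ∀ l, T.X.obj (p l) (i l)}
    (he : ∀ l, Hom.lin π (p l) (i l) (e l) = b l)
    {φ ψ : T ⟶ W} (hι : ι ≫ φ = ι ≫ ψ)
    (hφψ : ∀ l, Hom.lin φ (p l) (i l) (e l) = Hom.lin ψ (p l) (i l) (e l)) : φ = ψ := by
  obtain ⟨s, hs, hse⟩ := exists_section hb he
  have h : s ≫ φ = s ≫ ψ := by
    refine (hb W fun l => Hom.lin φ (p l) (i l) (e l)).unique (fun l => ?_) (fun l => ?_)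
    · rw [Hom.lin_comp, hse]
    · rw [Hom.lin_comp, hse, hφψ]
  refine Hom.lin_ext fun q j x => ?_
  obtain ⟨y, hy⟩ := H.exists_sub_eq hs q j x
  have hx : x = Hom.lin ι q j y + Hom.lin s q j (Hom.lin π q j x) := by
    rw [hy, sub_add_cancel]
  have h1 := congrArg (fun f => Hom.lin f q j y) hι
  have h2 := congrArg (fun f => Hom.lin f q j (Hom.lin π q j x)) h
  rw [hx, map_add, map_add]
  exact congrArg₂ _ h1 h2

theorem mem_of_forall_mem (H : IsShortExact ι π) {Λ : Type u} {p : Λ → GMPerversity n} {i : Λ → ℤ}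
    {b : ∀ l, Q.X.obj (p l) (i l)}
    (hb : Q.IsBasis p i b) {e : ∀ l, T.X.obj (p l) (i l)}
    (he : ∀ l, Hom.lin π (p l) (i l) (e l) = b l)
    (U : Sub T) (hι : ∀ q j x, Hom.lin ι q j x ∈ U.carrier q j)
    (hU : ∀ l, e l ∈ U.carrier (p l) (i l)) (q : GMPerversity n) (j : ℤ) (x : T.X.obj q j) :
    x ∈ U.carrier q j := by
  have : U.mkQ = U.zeroQ := H.hom_ext hb he
    (Hom.lin_ext fun q j x => (U.mem_iff _ _ _).1 (hι q j x)) fun l => (U.mem_iff _ _ _).1 (hU l)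
  exact (U.mem_iff q j x).2 (by rw [this])

/-- The elements `x - s (π x)` lie in the image of `ι`. Since `ι` is injective, their preimages
depend on `x` linearly and compatibly with all structure. -/
theorem exists_retraction (H : IsShortExact ι π) {s : Q ⟶ T} (hs : s ≫ π = 𝟙 Q) :
    ∃ ρ : T ⟶ S, ∀ q j x,
      Hom.lin ι q j (Hom.lin ρ q j x) = x - Hom.lin s q j (Hom.lin π q j x) := by
  choose r hr using H.exists_sub_eq hs
  refine ⟨homOfLin
    (fun q j =>
      { toFun := r q j
        map_add' := fun x y => H.injective q j <| by
          rw [map_add, hr, hr, hr, map_add, map_add, add_sub_add_comm]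
        map_smul' := fun c x => H.injective q j <| by
          rw [map_smul, hr, hr, map_smul, map_smul, RingHom.id_apply, smul_sub] })
    (fun {q q'} h j x => H.injective q' j ?_) (fun {q q' q''} h {j j' j''} e a x =>
      H.injective q'' j'' ?_), hr⟩
  · refine (hr _ _ _).trans ?_
    rw [Hom.lin_res, Hom.lin_res, Hom.lin_res, ← map_sub]
    exact congrArg _ (hr _ _ _).symm
  · refine (hr _ _ _).trans ?_
    rw [Hom.lin_smul, Hom.lin_smul, Hom.lin_smul, ← map_sub]
    exact congrArg _ (hr _ _ _).symm

/-- As a graded module `T` is `S` plus a free module on the `e l`, so both parts of a morphism can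
be prescribed independently: `g` after the retraction plus `φ` after `π`. This is the inductive step
along a semi-free filtration. -/
theorem exists_extension (H : IsShortExact ι π) {Λ : Type u} {p : Λ → GMPerversity n} {i : Λ → ℤ}
    {b : ∀ l, Q.X.obj (p l) (i l)}
    (hb : Q.IsBasis p i b) {e : ∀ l, T.X.obj (p l) (i l)}
    (he : ∀ l, Hom.lin π (p l) (i l) (e l) = b l)
    (g : S ⟶ W) (w : ∀ l, W.X.obj (p l) (i l)) :
    ∃ g' : T ⟶ W, ι ≫ g' = g ∧ ∀ l, Hom.lin g' (p l) (i l) (e l) = w l := by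
  obtain ⟨s, hs, hse⟩ := exists_section hb he
  obtain ⟨ρ, hρ⟩ := H.exists_retraction hs
  obtain ⟨φ, hφ, -⟩ := hb W w
  refine ⟨homOfLin (fun q j => Hom.lin g q j ∘ₗ Hom.lin ρ q j + Hom.lin φ q j ∘ₗ Hom.lin π q j)
    (fun h j x => ?_) (fun h _ _ _ e a x => ?_), Hom.lin_ext fun q j x => ?_, fun l => ?_⟩
  · simp only [LinearMap.add_apply, LinearMap.comp_apply, Hom.lin_res, map_add]
  · simp only [LinearMap.add_apply, LinearMap.comp_apply, Hom.lin_smul, map_add]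
  · have h1 : Hom.lin π q j (Hom.lin ι q j x) = 0 := (H.exact q j _).2 ⟨x, rfl⟩
    have h2 : Hom.lin ρ q j (Hom.lin ι q j x) = x := H.injective q j <| by
      rw [hρ, h1, map_zero, sub_zero]
    rw [Hom.lin_comp, lin_homOfLin, LinearMap.add_apply, LinearMap.comp_apply,
      LinearMap.comp_apply, h1, h2, map_zero, add_zero]
  · have h2 : Hom.lin ρ (p l) (i l) (e l) = 0 := H.injective _ _ <| by
      rw [hρ, he, hse, sub_self, map_zero]
    rw [lin_homOfLin, LinearMap.add_apply, LinearMap.comp_apply,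
      LinearMap.comp_apply, h2, map_zero, zero_add, he, hφ]

end IsShortExact

end PGModule

namespace PDGModule

namespace Sub

variable {M : PDGModule A}

/-- The inclusion of pDG submodules. -/
def incl {S T : Sub M} (h : ∀ p i, S.carrier p i ≤ T.carrier p i) : S.toModule ⟶ T.toModule :=
  homOfLin (fun p i => Submodule.inclusion (h p i)) (fun _ _ _ => rfl) (fun _ _ _ _ _ => rfl)
    (fun _ _ _ _ _ _ _ => rfl)

theorem incl_injective {S T : Sub M} (h : ∀ p i, S.carrier p i ≤ T.carrier p i)
    (p : GMPerversity n) (i : ℤ) : Function.Injective (Hom.lin (incl h) p i) :=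
  Submodule.inclusion_injective (h p i)

/-- The projection onto the quotient of pDG submodules. -/
def proj (T S : Sub M) : T.toModule ⟶ T.quotient S :=
  homOfLin (fun p i => ((S.carrier p i).submoduleOf (T.carrier p i)).mkQ) (fun _ _ _ => rfl)
    (fun _ _ _ _ _ => rfl) (fun _ _ _ _ _ _ _ => rfl)

theorem isShortExact_incl_proj {S T : Sub M} (h : ∀ p i, S.carrier p i ≤ T.carrier p i) :
    PGModule.IsShortExact (toGradedMap (incl h)) (toGradedMap (proj T S)) where
  injective p i := incl_injective h p i
  surjective p i := Submodule.mkQ_surjective _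
  exact p i y := by
    refine (Submodule.Quotient.mk_eq_zero _).trans ?_
    constructor
    · intro hy
      exact ⟨⟨y.1, hy⟩, rfl⟩
    · rintro ⟨x, rfl⟩
      exact x.2

variable {F : ℕ → Sub M} {W : PGModule A}

/-- Compatible morphisms on the terms of an exhaustive filtration glue. -/
theorem exists_glue (hmono : ∀ k p i, (F k).carrier p i ≤ (F (k + 1)).carrier p i)
    (hF : ∀ p i (x : (M.X.obj p).X i), ∃ k, x ∈ (F k).carrier p i)
    (γ : ∀ k, (F k).toModule.toGraded ⟶ W)
    (hγ : ∀ k, toGradedMap (incl (hmono k)) ≫ γ (k + 1) = γ k) :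
    ∃ g : M.toGraded ⟶ W, ∀ k, toGradedMap (F k).ι ≫ g = γ k := by
  have hle : ∀ {k l : ℕ} (_ : k ≤ l) p i, (F k).carrier p i ≤ (F l).carrier p i :=
    fun {k l} h p i => monotone_nat_of_le_succ (f := fun k => (F k).carrier p i)
      (fun k => hmono k p i) h
  let Γ : ∀ k p i, (F k).carrier p i →ₗ[R] W.X.obj p i := fun k p i => gradedLin (γ k) p i
  have hΓ : ∀ {k l : ℕ} (_ : k ≤ l) p i x (hk : x ∈ (F k).carrier p i)
      (hl : x ∈ (F l).carrier p i), Γ l p i ⟨x, hl⟩ = Γ k p i ⟨x, hk⟩ := by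
    intro k l h
    induction l, h using Nat.le_induction with
    | base => exact fun _ _ _ _ _ => rfl
    | succ l h ih =>
      intro p i x hk hl
      rw [← ih p i x hk (hle h p i hk)]
      exact congrArg (fun f => gradedLin f p i (⟨x, hle h p i hk⟩ : (F l).carrier p i)) (hγ l)
  -- Each `x` is evaluated at a chosen stage `K p i x`. By `hΓ'` every stage containing `x` gives
  -- the same value, so sums can be compared at a common stage.
  choose K hK using hF
  have hΓ' : ∀ k p i x (hk : x ∈ (F k).carrier p i), Γ (K p i x) p i ⟨x, hK p i x⟩ =
      Γ k p i ⟨x, hk⟩ := by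
    intro k p i x hk
    rcases le_total (K p i x) k with h | h
    · exact (hΓ h p i x _ _).symm
    · exact hΓ h p i x _ _
  refine ⟨PGModule.homOfLin (X := M.toGraded)
    (fun p i =>
      { toFun := fun x => Γ (K p i x) p i ⟨x, hK p i x⟩
        map_add' := fun x y => ?_
        map_smul' := fun c x => ?_ }) (fun {p q} h i x => ?_) (fun {p q r} h {i j k} e a x => ?_),
    fun k => PGModule.Hom.lin_ext fun p i x => hΓ' k p i x.1 x.2⟩
  · have hx := hle (le_max_left (K p i x) (K p i y)) p i (hK p i x)
    have hy := hle (le_max_right (K p i x) (K p i y)) p i (hK p i y)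
    refine (hΓ' _ p i _ (add_mem hx hy)).trans ?_
    rw [hΓ' _ p i x hx, hΓ' _ p i y hy, ← map_add]
    rfl
  · refine (hΓ' _ p i _ (Submodule.smul_mem _ c (hK p i x))).trans ?_
    rw [RingHom.id_apply, ← map_smul]
    rfl
  · refine (hΓ' _ q i _ ((F (K p i x)).res_mem h (hK p i x))).trans ?_
    exact gradedLin_res (γ (K p i x)) h i ⟨x, hK p i x⟩
  · refine (hΓ' _ r k _ ((F (K q j x)).smul_mem h e a (hK q j x))).trans ?_
    exact gradedLin_smul (γ (K q j x)) h e a ⟨x, hK q j x⟩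

/-- Properties of morphisms on the terms of a filtration which can be extended step by step hold
for some morphism on the union. -/
theorem exists_of_forall_extend (hmono : ∀ k p i, (F k).carrier p i ≤ (F (k + 1)).carrier p i)
    (hF : ∀ p i (x : (M.X.obj p).X i), ∃ k, x ∈ (F k).carrier p i)
    (P : ∀ k, ((F k).toModule.toGraded ⟶ W) → Prop) (h0 : ∃ g, P 0 g)
    (hs : ∀ k g, P k g → ∃ g', toGradedMap (incl (hmono k)) ≫ g' = g ∧ P (k + 1) g') :
    ∃ g : M.toGraded ⟶ W, ∀ k, P k (toGradedMap (F k).ι ≫ g) := by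
  choose E hE hE' using hs
  obtain ⟨g₀, h₀⟩ := h0
  let γ : ∀ k, {g // P k g} := fun k => Nat.rec ⟨g₀, h₀⟩ (fun k g => ⟨E k g.1 g.2, hE' k g.1 g.2⟩) k
  obtain ⟨g, hg⟩ := exists_glue hmono hF (fun k => (γ k).1) (fun k => hE k (γ k).1 (γ k).2)
  exact ⟨g, fun k => by rw [hg]; exact (γ k).2⟩

end Sub

variable {N : PDGModule A}

/-- The zero morphism out of a trivial pDG module. -/
def zeroHom {S : PDGModule A} (W : PGModule A) : S.toGraded ⟶ W :=
  PGModule.homOfLin (X := S.toGraded) (fun _ _ => 0) (fun _ _ _ => (map_zero _).symm)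
    (fun _ _ _ _ _ _ _ => (map_zero _).symm)

/-- A basis of cycles of the quotient is lifted to `F (k + 1)`. The lifts need not be cycles, but
their boundaries die in the quotient, hence lie in `F k`. -/
theorem IsSemiFree.exists_cells (F : ℕ → Sub N)
    (hQ : ∀ k, ∃ K : PerverseComplex R n, K.IsFree ∧ (∀ p i j, (K.obj p).d i j = 0) ∧
      Nonempty ((F (k + 1)).quotient (F k) ≅ free A K)) (k : ℕ) :
    ∃ (Λ : Type u) (p : Λ → GMPerversity n) (i : Λ → ℤ)
      (e : ∀ l, ((F (k + 1)).toModule.X.obj (p l)).X (i l)),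
      ((F (k + 1)).quotient (F k)).toGraded.IsBasis p i
        (fun l => Hom.lin ((F (k + 1)).proj (F k)) _ _ (e l)) ∧
        ∀ l j, Hom.lin ((F (k + 1)).proj (F k)) _ _
          ((F (k + 1)).toModule.X.diff (p l) (i l) j (e l)) = 0 := by
  obtain ⟨K, hK, hd, ⟨φ⟩⟩ := hQ k
  obtain ⟨Λ, p, i, b, hb, hbd⟩ := exists_isBasis_free A hK hd
  have hsurj : ∀ p i, Function.Surjective (Hom.lin ((F (k + 1)).proj (F k)) p i) :=
    fun _ _ => Submodule.mkQ_surjective _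
  choose e he using fun l => hsurj (p l) (i l) (Hom.lin φ.inv _ _ (b l))
  refine ⟨Λ, p, i, e, ?_, fun l j => ?_⟩
  · rw [funext he]
    exact hb.of_iso (toGradedIso φ.symm)
  · rw [Hom.lin_diff, he, ← Hom.lin_diff, hbd, map_zero]

/-- A lift through `π` extends from `F k` to `F (k + 1)` by choosing preimages of the values of `f`
on the new cells. -/
theorem IsSemiFree.projective (hN : N.IsSemiFree) : Projective N.toGraded := by
  obtain ⟨F, hF0, hmono, hF, hQ⟩ := hN
  refine ⟨fun {E X} f π _ => ?_⟩
  obtain ⟨g, hg⟩ : ∃ g : N.toGraded ⟶ E,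
      ∀ k, (toGradedMap (F k).ι ≫ g) ≫ π = toGradedMap (F k).ι ≫ f := by
    refine Sub.exists_of_forall_extend (W := E) hmono hF
      (fun k g => g ≫ π = toGradedMap (F k).ι ≫ f) ⟨zeroHom E, ?_⟩ ?_
    · refine PGModule.Hom.lin_ext fun p i x => ?_
      have hx : x = 0 := Subtype.ext ((Submodule.mem_bot R).1 ((hF0 p i).le x.2))
      rw [hx, map_zero, map_zero]
    · intro k g hg
      obtain ⟨Λ, p, i, e, hb, -⟩ := IsSemiFree.exists_cells F hQ k
      choose w hw using fun l => PGModule.surjective_of_epi π (p l) (i l)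
        (PGModule.Hom.lin (toGradedMap (F (k + 1)).ι ≫ f) _ _ (e l))
      have H := Sub.isShortExact_incl_proj (hmono k)
      obtain ⟨g', hg', hw'⟩ := H.exists_extension (e := e) hb (fun _ => rfl) g w
      refine ⟨g', hg', H.hom_ext (e := e) hb (fun _ => rfl) ?_ fun l => ?_⟩
      · rw [← Category.assoc, hg', hg]
        rfl
      · exact (congrArg (PGModule.Hom.lin π (p l) (i l)) (hw' l)).trans (hw l)
  refine ⟨g, PGModule.Hom.lin_ext fun p i x => ?_⟩
  obtain ⟨k, hk⟩ := hF p i x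
  exact congrArg (fun f => gradedLin f p i (⟨x, hk⟩ : (F k).carrier p i)) (hg k)

/-- A primitive `g` of the cycle `f` is built along the filtration. On a new cell `e` its value must
satisfy `d (g e) = f e + (-1)^k' g (d e)`. Here `d e` lies in the previous stage, so this is an
equation in the acyclic `Z` with known right side. -/
theorem IsSemiFree.isAcyclic_internalHom (hN : N.IsSemiFree) (Z : PDGModule A)
    (hZ : Z.X.IsAcyclic) : (internalHom N Z).IsAcyclic := by
  obtain ⟨F, hF0, hmono, hF, hQ⟩ := hN
  refine PDGModule.isAcyclic_internalHom fun r k k' k'' hk hk' f hf hfd => ?_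
  obtain ⟨g, hg⟩ : ∃ g : N.toGraded ⟶ twist Z r k', ∀ m,
      homFamilyDiff _ Z r k' k (twistFamily (toGradedMap (F m).ι ≫ g)) = precomp (F m).ι f := by
    refine Sub.exists_of_forall_extend (W := twist Z r k') hmono hF
      (fun m g => homFamilyDiff _ Z r k' k (twistFamily g) = precomp (F m).ι f) ⟨zeroHom _, ?_⟩ ?_
    · funext ⟨p, q, i, j, h, e⟩
      ext x
      have hx : x = 0 := Subtype.ext ((Submodule.mem_bot R).1 ((hF0 p i).le x.2))
      rw [hx, map_zero, map_zero]
    · intro m g hg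
      obtain ⟨Λ, p, i, e, hb, hd⟩ := IsSemiFree.exists_cells F hQ m
      have H := Sub.isShortExact_incl_proj (hmono m)
      -- The boundary of a cell, viewed in the previous stage.
      have hy : ∀ l j, ∃ y : ((F m).toModule.X.obj (p l)).X j,
          Hom.lin (Sub.incl (hmono m)) (p l) j y =
            (F (m + 1)).toModule.X.diff (p l) (i l) j (e l) := fun l j =>
        (H.exact (p l) j _).1 (hd l j)
      choose y hy' using hy
      have hincl : ∀ {p q i j} (h : GMPerversity.SumLE p r q) (e : i + k = j)
          (x : ((F m).toModule.X.obj p).X i), precomp (F m).ι f ⟨p, q, i, j, h, e⟩ x =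
          precomp (F (m + 1)).ι f ⟨p, q, i, j, h, e⟩ (Hom.lin (Sub.incl (hmono m)) p i x) :=
        fun _ _ _ => rfl
      -- The admissible values of `g` on the new cells, as elements of the limit over target
      -- perversities.
      have hw : ∀ l, ∃ w : twistObj Z r k' (p l) (i l), ∀ q h,
          Z.X.diff q (i l + k') (i l + k) (twistEval (q := q) h rfl w) =
            precomp (F (m + 1)).ι f ⟨p l, q, i l, i l + k, h, rfl⟩ (e l) +
              k'.negOnePow • twistFamily g ⟨p l, q, i l - 1, i l + k, h, by omega⟩
                (y l (i l - 1)) := by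
        intro l
        refine exists_twistObj_diff_eq hZ rfl (j'' := i l + k'') (by omega) (by omega) _ ?_ ?_
        · intro q q' h h' hq
          have h1 := (precomp_mem (F (m + 1)).ι hf).1 (p l) q (p l) q' h h' le_rfl hq (i l) _
            rfl (e l)
          have h2 := (twistFamily_mem g).1 (p l) q (p l) q' h h' le_rfl hq (i l - 1) (i l + k)
            (by omega) (y l (i l - 1))
          rw [PerverseComplex.res_refl] at h1 h2
          rw [map_add, map_zsmul_unit, h1, h2]
        · intro q h
          -- The right side is a cycle: `D f = 0` turns `d (f e)` into `(-1)^k f (d e)`, and `D g =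
          -- f` on the cycle `y` turns `d (g y)` into `f y`. Since `k' = k + 1`, the two terms
          -- cancel.
          have hfd' : homFamilyDiff _ Z r k k'' (precomp (F (m + 1)).ι f) = 0 := by
            rw [homFamilyDiff_precomp, hfd]; rfl
          have h1 := homFamilyDiff_apply _ Z (precomp (F (m + 1)).ι f) h (i := i l) (j := i l + k'')
            (j' := i l + k) (i' := i l - 1) rfl rfl (by omega) (e l)
          have h2 := homFamilyDiff_apply _ Z (twistFamily g) h (i := i l - 1) (j := i l + k'')
            (j' := i l + k) (i' := i l - 2) (k' := k) (by omega) (by omega) (by omega)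
            (y l (i l - 1))
          rw [hfd'] at h1
          have h3 : (F m).toModule.X.diff (p l) (i l - 1) (i l - 2) (y l (i l - 1)) = 0 := by
            refine Sub.incl_injective (hmono m) (p l) (i l - 2) ?_
            rw [Hom.lin_diff, hy', PerverseComplex.diff_diff, map_zero]
          rw [hg, h3, map_zero, smul_zero, sub_zero, hincl] at h2
          have hs : k'.negOnePow = -k.negOnePow := by rw [← hk, Int.negOnePow_succ]
          rw [map_add, map_zsmul_unit, ← h2, hy', sub_eq_zero.1 h1.symm, hs, Units.neg_smul,
            add_neg_cancel]
      choose w hw using hw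
      obtain ⟨g', hg', hw'⟩ := H.exists_extension (e := e) hb (fun _ => rfl) g w
      refine ⟨g', hg', ?_⟩
      have hg'' : precomp (Sub.incl (hmono m)) (twistFamily g') = twistFamily g := by
        rw [← twistFamily_comp, hg']
      -- The difference `D g' - f` vanishes on `F m` by the induction hypothesis and on the new
      -- cells by the choice of `w`, hence on `F (m + 1)`.
      have hδ := sub_mem (homFamilyDiff_mem _ Z (by omega) (twistFamily_mem g'))
        (precomp_mem (F (m + 1)).ι hf)
      refine sub_eq_zero.1 (eq_zero_of_vanishing hδ
        (H.mem_of_forall_mem (e := e) hb (fun _ => rfl) _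
        ?_ ?_))
      · intro p i x q j h e
        have h1 := hg
        rw [← hg'', homFamilyDiff_precomp] at h1
        exact sub_eq_zero.2 (LinearMap.congr_fun (congrFun h1 ⟨p, q, i, j, h, e⟩) x)
      · rintro l q _ h rfl
        refine sub_eq_zero.2 ?_
        rw [homFamilyDiff_apply _ Z _ h rfl (j' := i l + k') (i' := i l - 1) rfl (by omega)]
        have h1 : twistEval h rfl (twistLin g' (p l) (i l) (e l)) = twistEval h rfl (w l) :=
          congrArg _ (hw' l)
        rw [twistFamily_apply, h1, hw, ← hy', ← hg'']
        exact add_sub_cancel_right _ _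
  refine ⟨twistFamily g, twistFamily_mem g, ?_⟩
  funext ⟨p, q, i, j, h, e⟩
  ext x
  obtain ⟨m, hm⟩ := hF p i x
  have := hg m
  rw [twistFamily_comp, homFamilyDiff_precomp] at this
  exact LinearMap.congr_fun (congrFun this ⟨p, q, i, j, h, e⟩) ⟨x, hm⟩

theorem IsSemiFree.isSemiProjective (hN : N.IsSemiFree) : N.IsSemiProjective :=
  ⟨hN.projective, hN.isAcyclic_internalHom⟩

/-- The retract of perverse graded modules underlying a retract of pDG modules. -/
def toGradedRetract {M : PDGModule A} (r : Retract M N) : Retract M.toGraded N.toGraded where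
  i := toGradedMap r.i
  r := toGradedMap r.r
  retract := PGModule.Hom.lin_ext fun p i x => congrArg (fun f => Hom.lin f p i x) r.retract

/-- A cycle `f` on `M` becomes a cycle `f ∘ r` on `N`. A primitive of it, precomposed with `i`, is a
primitive of `f ∘ r ∘ i = f`. Projectivity passes to the retract in the usual way. -/
theorem IsSemiProjective.of_retract {M : PDGModule A} (r : Retract M N)
    (hN : N.IsSemiProjective) : M.IsSemiProjective := by
  have hP : Projective N.toGraded := hN.1
  refine ⟨⟨fun f e _ => ?_⟩, fun Z hZ => ?_⟩
  · refine ⟨(toGradedRetract r).i ≫ Projective.factorThru ((toGradedRetract r).r ≫ f) e, ?_⟩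
    rw [Category.assoc, Projective.factorThru_comp, (toGradedRetract r).retract_assoc]
  · refine PDGModule.isAcyclic_internalHom fun s k k' k'' hk hk' f hf hd => ?_
    obtain ⟨g, hg, hgf⟩ := exists_of_isAcyclic_internalHom (hN.2 Z hZ) s hk hk'
      (precomp_mem r.r hf) (by rw [homFamilyDiff_precomp, hd]; rfl)
    refine ⟨precomp r.i g, precomp_mem r.i hg, ?_⟩
    rw [homFamilyDiff_precomp, hgf]
    funext t
    ext x
    exact congrArg (f t) (congrArg (fun f => Hom.lin f t.p t.i x) r.retract)

end PDGModule

end Extension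

/-! ### Extensions with twisted differential and the attachment of cells -/

section TwistedSum

variable {R : Type u} [CommRing R] {n : ℕ} {A : PDGAlgebra.{u} R n}

namespace PDGModule

variable (F Q : PDGModule A)

/-- A chain map of degree `-1` from `Q` to `F`, compatible with the action of `A`. -/
structure ConnectingMap where
  lin : ∀ (p : GMPerversity n) (i j : ℤ), (Q.X.obj p).X i →ₗ[R] (F.X.obj p).X j
  lin_res : ∀ {p q : GMPerversity n} (h : p ≤ q) (i j : ℤ) (y : (Q.X.obj p).X i),
    lin q i j (Q.X.res h i y) = F.X.res h j (lin p i j y)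
  lin_eq_zero : ∀ (p : GMPerversity n) (i j : ℤ), j + 1 ≠ i → ∀ y, lin p i j y = 0
  diff_lin : ∀ (p : GMPerversity n) (i j k : ℤ), j + 1 = i → k + 1 = j → ∀ y,
    F.X.diff p j k (lin p i j y) + lin p j k (Q.X.diff p i j y) = 0
  lin_smul : ∀ {p q r : GMPerversity n} (h : GMPerversity.SumLE p q r) {i j k j' k' : ℤ}
    (e : i + j = k) (e' : i + j' = k') (_ : k' + 1 = k) (a : (A.X.obj p).X i)
    (y : (Q.X.obj q).X j),
    lin r k k' (Q.smul h e a y) = i.negOnePow • F.smul h e' a (lin q j j' y)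

variable {F Q}

/-- Basis elements which are cycles may be sent to arbitrary cycles by a connecting map. -/
theorem exists_connectingMap {Λ : Type u} {p : Λ → GMPerversity n} {i : Λ → ℤ}
    {b : ∀ l, (Q.X.obj (p l)).X (i l)} (hb : Q.toGraded.IsBasis p i b)
    (hd : ∀ l j, Q.X.diff (p l) (i l) j (b l) = 0) (z : ∀ l, (F.X.obj (p l)).X (i l - 1))
    (hz : ∀ l j, F.X.diff (p l) (i l - 1) j (z l) = 0) :
    ∃ θ : ConnectingMap F Q, ∀ l, θ.lin (p l) (i l) (i l - 1) (b l) = z l := by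
  have hp : ∀ p : GMPerversity n, GMPerversity.SumLE p 0 p := fun p =>
    GMPerversity.sumLE_zero_right le_rfl
  -- A connecting map is the diagonal part of a cycle of degree `-1` in Hom_A(Q, F)_0. The element
  -- with the prescribed values comes from the basis property applied to the corresponding `twist`.
  obtain ⟨g, hg, -⟩ := hb (twist F 0 (-1)) fun l =>
    twistMk (Z := F) (r := 0) (k := -1) (i := i l) (j := i l - 1) rfl
      (fun q h => F.X.res h.le_left _ (z l)) (fun _ _ _ _ _ => F.X.res_res _ _ _ _)
  have hg' : ∀ l q h, twistFamily g ⟨p l, q, i l, i l - 1, h, rfl⟩ (b l) =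
      F.X.res h.le_left _ (z l) := by
    intro l q h
    rw [twistFamily_apply]
    exact (congrArg (twistEval (Z := F) (k := -1) h (show i l + -1 = i l - 1 from rfl))
      (hg l)).trans
      (twistEval_twistMk _ _ _ _)
  have hmem := twistFamily_mem g
  -- On a basis element both terms of `D` vanish, since `b l` and `z l` are cycles.
  have hD : homFamilyDiff Q F 0 (-1) (-2) (twistFamily g) = 0 := by
    refine eq_zero_of_vanishing (homFamilyDiff_mem _ _ rfl hmem) (hb.mem_of_forall_mem _ ?_)
    intro l q j h e
    rw [homFamilyDiff_apply Q F _ h e (j' := i l - 1) (i' := i l - 1) rfl (by omega), hg', hd,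
      F.X.diff_res, hz, map_zero, map_zero, smul_zero, sub_zero]
  generalize twistFamily g = Θ at hg' hmem hD
  -- A connecting map has a component for every pair of degrees; those with `j ≠ i - 1` are set to
  -- zero.
  let θ : ∀ p i j, (Q.X.obj p).X i →ₗ[R] (F.X.obj p).X j := fun p i j =>
    if h : i + -1 = j then Θ ⟨p, p, i, j, hp p, h⟩ else 0
  have hθ : ∀ p i j (h : i + -1 = j), θ p i j = Θ ⟨p, p, i, j, hp p, h⟩ := fun p i j h =>
    dif_pos h
  have hθ0 : ∀ p i j, j + 1 ≠ i → θ p i j = 0 := fun p i j h => dif_neg (by omega)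
  refine ⟨⟨θ, ?_, fun p i j h y => ?_, ?_, ?_⟩, fun l => ?_⟩
  · intro p q h i j y
    by_cases e : i + -1 = j
    · have h1 := hmem.1 q q p q (hp q) (GMPerversity.sumLE_zero_right h) h le_rfl i j e y
      have h2 := hmem.1 p p p q (hp p) (GMPerversity.sumLE_zero_right h) le_rfl h i j e y
      rw [PerverseComplex.res_refl] at h1 h2
      rw [hθ _ _ _ e, hθ _ _ _ e]
      exact h1.symm.trans h2
    · rw [hθ0 _ _ _ (by omega), hθ0 _ _ _ (by omega), LinearMap.zero_apply, LinearMap.zero_apply,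
        map_zero]
  · rw [hθ0 p i j h, LinearMap.zero_apply]
  · intro p i j k hj hk y
    have h1 := homFamilyDiff_apply Q F Θ (hp p) (k' := -2) (i := i) (j := k) (i' := j) (j' := j)
      (by omega) (by omega) (by omega) y
    rw [hD] at h1
    rw [hθ _ _ _ (by omega), hθ _ _ _ (by omega)]
    simpa using h1.symm
  · intro p q r h i j k j' k' e e' hk a y
    rw [hθ _ _ _ (by omega), hθ _ _ _ (by omega)]
    have h1 := hmem.2 p q r q r h (hp r) (hp q) h i j k j' k' e (by omega) (by omega) e' a y
    rwa [neg_one_mul, Int.negOnePow_neg] at h1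
  · refine (LinearMap.congr_fun (hθ (p l) (i l) (i l - 1) rfl) (b l)).trans ?_
    rw [hg', F.X.res_refl]

namespace ConnectingMap

variable (θ : ConnectingMap F Q)

/-- The differential `(x, y) ↦ (d x + θ y, d y)`. -/
def sumDiff (p : GMPerversity n) (i j : ℤ) :
    (F.X.obj p).X i × (Q.X.obj p).X i →ₗ[R] (F.X.obj p).X j × (Q.X.obj p).X j :=
  ((F.X.diff p i j).coprod (θ.lin p i j)).prod (Q.X.diff p i j ∘ₗ LinearMap.snd _ _ _)

theorem sumDiff_apply (p : GMPerversity n) (i j : ℤ)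
    (x : (F.X.obj p).X i × (Q.X.obj p).X i) :
    θ.sumDiff p i j x = (F.X.diff p i j x.1 + θ.lin p i j x.2, Q.X.diff p i j x.2) := rfl

/-- The pDG module `F ⊕ Q` with the differential twisted by a connecting map. -/
def twistedSum : PDGModule A where
  X := PerverseComplex.ofRes
    (fun p i => ModuleCat.of R ((F.X.obj p).X i × (Q.X.obj p).X i))
    (fun h i => (F.X.res h i).prodMap (Q.X.res h i)) θ.sumDiff
    (fun p i x => Prod.ext (F.X.res_refl p i x.1) (Q.X.res_refl p i x.2))
    (fun h h' i x => Prod.ext (F.X.res_res h h' i x.1) (Q.X.res_res h h' i x.2))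
    (fun {p q} h i j x => Prod.ext
      ((congrArg₂ (· + ·) (F.X.diff_res h i j x.1) (θ.lin_res h i j x.2)).trans
        (map_add (F.X.res h j) _ _).symm)
      (Q.X.diff_res h i j x.2))
    (fun p i j h x => Prod.ext
      ((congrArg₂ (· + ·) (F.X.diff_eq_zero p i j h x.1) (θ.lin_eq_zero p i j h x.2)).trans
        (add_zero _))
      (Q.X.diff_eq_zero p i j h x.2))
    (fun p i j k hj hk x => by
      rw [sumDiff_apply, sumDiff_apply, map_add, F.X.diff_diff, zero_add,
        θ.diff_lin p i j k hj hk, Q.X.diff_diff]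
      rfl)
  smul h _ _ _ e :=
    { toFun := fun a => (F.smul h e a).prodMap (Q.smul h e a)
      map_add' := fun a b => LinearMap.ext fun x => Prod.ext
        (LinearMap.map_add₂ (F.smul h e) a b x.1) (LinearMap.map_add₂ (Q.smul h e) a b x.2)
      map_smul' := fun c a => LinearMap.ext fun x => Prod.ext
        (LinearMap.map_smul₂ (F.smul h e) c a x.1) (LinearMap.map_smul₂ (Q.smul h e) c a x.2) }
  res_smul h h' hp hq hr _ _ _ e a x :=
    Prod.ext (F.res_smul h h' hp hq hr e a x.1) (Q.res_smul h h' hp hq hr e a x.2)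
  one_smul h _ x := Prod.ext (F.one_smul h x.1) (Q.one_smul h x.2)
  mul_smul h₁ h₂ h₃ h₄ _ _ _ _ _ _ e₁ e₂ e₃ e₄ a b x :=
    Prod.ext (F.mul_smul h₁ h₂ h₃ h₄ e₁ e₂ e₃ e₄ a b x.1)
      (Q.mul_smul h₁ h₂ h₃ h₄ e₁ e₂ e₃ e₄ a b x.2)
  leibniz {p q r} h {i j k i' j' k'} e e₁ e₂ hk a x := by
    refine Prod.ext ?_ (Q.leibniz h e e₁ e₂ hk a x.2)
    change F.X.diff r k k' (F.smul h e a x.1) + θ.lin r k k' (Q.smul h e a x.2) =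
      F.smul h e₁ (A.X.diff p i i' a) x.1 +
        i.negOnePow • F.smul h e₂ a (F.X.diff q j j' x.1 + θ.lin q j j' x.2)
    rw [F.leibniz h e e₁ e₂ hk, θ.lin_smul h e e₂ hk, map_add, smul_add, add_assoc]

/-- The inclusion of the submodule `F`. -/
def inl : F ⟶ θ.twistedSum :=
  homOfLin (N := θ.twistedSum) (fun p i => LinearMap.inl R ((F.X.obj p).X i) ((Q.X.obj p).X i))
    (fun h i _ => Prod.ext rfl (map_zero (Q.X.res h i)).symm)
    (fun p i j _ x => Prod.ext
      ((add_zero (F.X.diff p i j x)).symm.trans (congrArg _ (map_zero (θ.lin p i j)).symm))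
      (map_zero (Q.X.diff p i j)).symm)
    (fun h _ _ _ e a _ => Prod.ext rfl (map_zero (Q.smul h e a)).symm)

/-- The projection onto the quotient `Q`. -/
def snd : θ.twistedSum ⟶ Q :=
  homOfLin (M := θ.twistedSum) (fun p i => LinearMap.snd R ((F.X.obj p).X i) ((Q.X.obj p).X i))
    (fun _ _ _ => rfl) (fun _ _ _ _ _ => rfl) (fun _ _ _ _ _ _ _ => rfl)

variable {M : PDGModule A}

/-- The morphism out of the twisted sum given by `φ` on `F` and `ψ` on `Q`. -/
def desc (φ : F ⟶ M) (ψ : Q.toGraded ⟶ M.toGraded)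
    (h : ∀ p i j, j + 1 = i → ∀ y, M.X.diff p i j (gradedHomLin ψ p i y) =
      Hom.lin φ p j (θ.lin p i j y) + gradedHomLin ψ p j (Q.X.diff p i j y)) :
    θ.twistedSum ⟶ M :=
  homOfLin (M := θ.twistedSum) (fun p i => (Hom.lin φ p i).coprod (gradedHomLin ψ p i))
    (fun h i x => (congrArg₂ (· + ·) (Hom.lin_res φ h i x.1) (gradedHomLin_res ψ h i x.2)).trans
      (map_add _ _ _).symm)
    (fun p i j hj x => by
      change Hom.lin φ p j (F.X.diff p i j x.1 + θ.lin p i j x.2) +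
        gradedHomLin ψ p j (Q.X.diff p i j x.2) =
        M.X.diff p i j (Hom.lin φ p i x.1 + gradedHomLin ψ p i x.2)
      rw [map_add, map_add, h p i j hj, Hom.lin_diff, add_assoc])
    (fun h _ _ _ e a x =>
      (congrArg₂ (· + ·) (Hom.lin_smul φ h e a x.1) (gradedHomLin_smul ψ h e a x.2)).trans
        (map_add _ _ _).symm)

section Defect

variable (φ : F ⟶ M) (ψ : Q.toGraded ⟶ M.toGraded)

/-- The map `d ψ - φ θ - ψ d`. -/
def defect (p : GMPerversity n) (i j : ℤ) : (Q.X.obj p).X i →ₗ[R] (M.X.obj p).X j :=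
  M.X.diff p i j ∘ₗ gradedHomLin ψ p i -
    (Hom.lin φ p j ∘ₗ θ.lin p i j + gradedHomLin ψ p j ∘ₗ Q.X.diff p i j)

theorem defect_apply (p : GMPerversity n) (i j : ℤ) (y : (Q.X.obj p).X i) :
    θ.defect φ ψ p i j y = M.X.diff p i j (gradedHomLin ψ p i y) -
      (Hom.lin φ p j (θ.lin p i j y) + gradedHomLin ψ p j (Q.X.diff p i j y)) := rfl

theorem defect_res {p q : GMPerversity n} (h : p ≤ q) (i j : ℤ) (y : (Q.X.obj p).X i) :
    θ.defect φ ψ q i j (Q.X.res h i y) = M.X.res h j (θ.defect φ ψ p i j y) := by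
  rw [defect_apply, defect_apply, gradedHomLin_res, M.X.diff_res, θ.lin_res, Hom.lin_res,
    Q.X.diff_res, gradedHomLin_res, map_sub, map_add]

/-- The terms with `d a` cancel between `d ψ` and `ψ d`, so the defect is `A`-linear up to sign and
its kernel is a submodule. It thus suffices to check on a basis that `φ` and `ψ` define a chain map.
-/
theorem defect_smul {p q r : GMPerversity n} (h : GMPerversity.SumLE p q r) {i j k j' k' : ℤ}
    (e : i + j = k) (e' : i + j' = k') (hk : k' + 1 = k) (a : (A.X.obj p).X i)
    (y : (Q.X.obj q).X j) : θ.defect φ ψ r k k' (Q.smul h e a y) =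
      i.negOnePow • M.smul h e' a (θ.defect φ ψ q j j' y) := by
  rw [defect_apply, defect_apply, gradedHomLin_smul,
    M.leibniz h (i' := i - 1) e (by omega) e' hk, θ.lin_smul h e e' hk,
    Q.leibniz h (i' := i - 1) e (by omega) e' hk, map_add, map_zsmul_unit, map_zsmul_unit,
    Hom.lin_smul, gradedHomLin_smul, gradedHomLin_smul, map_sub, map_add, smul_sub, smul_add]
  abel

/-- The submodule of `Q` on which `φ` and `ψ` are compatible with the differentials. -/
def defectKer : PGModule.Sub Q.toGraded where
  carrier p i := LinearMap.ker (θ.defect φ ψ p i (i - 1))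
  res_mem h i x hx := (θ.defect_res φ ψ h i (i - 1) x).trans
    ((congrArg _ (LinearMap.mem_ker.1 hx)).trans (map_zero _))
  smul_mem {p q r} h {i j k} e a x hx := by
    refine (θ.defect_smul φ ψ h (j' := j - 1) e (by omega) (by omega) a x).trans ?_
    exact (congrArg (fun v => i.negOnePow • M.smul h (show i + (j - 1) = k - 1 by omega) a v)
      (LinearMap.mem_ker.1 hx)).trans (by rw [map_zero, smul_zero])

end Defect

end ConnectingMap

variable {M : PDGModule A}

/-- The cells to be attached to `F`: a cycle of `F` and an element of `M` whose boundary is the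
image of the cycle. -/
def Cell (φ : F ⟶ M) (p : GMPerversity n) (i : ℤ) : Type u :=
  {c : (F.X.obj p).X (i - 1) × (M.X.obj p).X i //
    (∀ k, F.X.diff p (i - 1) k c.1 = 0) ∧ M.X.diff p i (i - 1) c.2 = Hom.lin φ p (i - 1) c.1}

/-- An extension of `φ : F ⟶ M` by a free module, in which the cycles of `F` whose images are
boundaries become boundaries. -/
structure CellAttachment (φ : F ⟶ M) where
  K : PerverseComplex R n
  obj : PDGModule A
  incl : F ⟶ obj
  proj : obj ⟶ free A K
  desc : obj ⟶ M
  isFree : K.IsFree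
  d_eq_zero : ∀ p i j, (K.obj p).d i j = 0
  incl_injective : ∀ p i, Function.Injective (Hom.lin incl p i)
  proj_surjective : ∀ p i, Function.Surjective (Hom.lin proj p i)
  exact : ∀ p i x, Hom.lin proj p i x = 0 ↔ ∃ y, Hom.lin incl p i y = x
  incl_desc : incl ≫ desc = φ
  exists_diff_eq : ∀ (p : GMPerversity n) (i j : ℤ), j + 1 = i → ∀ z : (F.X.obj p).X j,
    (∀ k, F.X.diff p j k z = 0) → ∀ m : (M.X.obj p).X i, M.X.diff p i j m = Hom.lin φ p j z →
      ∃ e, obj.X.diff p i j e = Hom.lin incl p j z ∧ Hom.lin desc p i e = m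

/-- Let `K` be free on the cells, with zero differential, and twist the differential of `F ⊕ (A ⊠
K)` by the connecting map which sends the generator of the cell `(z, m)` to `z`. Sending this
generator to `m` extends `φ` to a chain map because `d m = φ z`. -/
theorem nonempty_cellAttachment (φ : F ⟶ M) : Nonempty (CellAttachment φ) := by
  obtain ⟨K, hK, hd, b, hb⟩ := PerverseComplex.exists_isFree (R := R) (Cell φ)
  have hB := isBasis_free A hd hb
  obtain ⟨θ, hθ⟩ := exists_connectingMap (F := F) hB (fun l j => diff_freeUnit A hd _ _ j _)
    (fun l => l.2.2.1.1) (fun l => l.2.2.2.1)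
  obtain ⟨ψ, hψ, -⟩ := hB M.toGraded fun l => l.2.2.1.2
  have hψ' : ∀ l, gradedHomLin ψ _ _ (freeUnit A K _ _ (b l)) = l.2.2.1.2 := hψ
  have hc : ∀ p i j, j + 1 = i → ∀ y, M.X.diff p i j (gradedHomLin ψ p i y) =
      Hom.lin φ p j (θ.lin p i j y) +
        gradedHomLin ψ p j ((free A K).X.diff p i j y) := by
    rintro p i j hj y
    obtain rfl : j = i - 1 := by omega
    -- On the generator of a cell the identity is the equation `d m = φ z` in the definition of a
    -- cell.
    refine sub_eq_zero.1 (hB.mem_of_forall_mem (θ.defectKer φ ψ) (fun l => ?_) p i y)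
    refine sub_eq_zero.2 ?_
    refine (congrArg _ (hψ' l)).trans ?_
    refine (l.2.2.2.2).trans ?_
    refine Eq.trans ?_ (congrArg₂ (fun u v => Hom.lin φ _ _ u + gradedHomLin ψ _ _ v)
      (hθ l).symm (diff_freeUnit A hd _ _ _ (b l)).symm)
    rw [map_zero, add_zero]
  refine ⟨{
    K := K
    obj := θ.twistedSum
    incl := θ.inl
    proj := θ.snd
    desc := θ.desc φ ψ hc
    isFree := hK
    d_eq_zero := hd
    incl_injective := fun p i => LinearMap.inl_injective
    proj_surjective := fun p i => LinearMap.snd_surjective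
    exact := fun p i x => ⟨fun h => ⟨x.1, Prod.ext rfl h.symm⟩, ?_⟩
    incl_desc := Hom.lin_ext fun p i x => ?_
    exists_diff_eq := fun p i j hj z hz m hm => ?_ }⟩
  · rintro ⟨y, rfl⟩
    rfl
  · exact (congrArg (Hom.lin φ p i x + ·) (map_zero (gradedHomLin ψ p i))).trans (add_zero _)
  · obtain rfl : j = i - 1 := by omega
    -- The pair `(z, m)` is itself a cell; its generator is the required element.
    let l : Σ (p : ULift.{u} (GMPerversity n)) (i : ULift.{u} ℤ), Cell φ p.down i.down :=
      ⟨⟨p⟩, ⟨i⟩, ⟨(z, m), hz, hm⟩⟩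
    refine ⟨((0, freeUnit A K p i (b l)) : (F.X.obj p).X i × ((free A K).X.obj p).X i), ?_, ?_⟩
    · refine Prod.ext ?_ (diff_freeUnit A hd _ _ _ _)
      exact (congrArg₂ (· + ·) (map_zero (F.X.diff p i (i - 1))) (hθ l)).trans (zero_add z)
    · exact (congrArg₂ (· + ·) (map_zero (Hom.lin φ p i)) (hψ' l)).trans (zero_add m)

end PDGModule

end TwistedSum

/-! ### Sequential colimits of pDG modules -/

section SequentialColimit

variable {R : Type u} [CommRing R] {n : ℕ} {A : PDGAlgebra.{u} R n}

namespace PDGModule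

variable (D : ℕ ⥤ PDGModule A)

/-- The transition maps of a sequence of pDG modules. -/
def transition (p : GMPerversity n) (i : ℤ) (k l : ℕ) (h : k ≤ l) :
    ((D.obj k).X.obj p).X i →ₗ[R] ((D.obj l).X.obj p).X i :=
  Hom.lin (D.map (homOfLE h)) p i

instance (p : GMPerversity n) (i : ℤ) :
    DirectedSystem (fun k => ((D.obj k).X.obj p).X i) (transition D p i · · ·) where
  map_self k x := congrArg (fun f => Hom.lin f p i x) (D.map_id k)
  map_map _ _ _ h h₂ x :=
    congrArg (fun f => Hom.lin f p i x) (D.map_comp (homOfLE h) (homOfLE h₂)).symm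

/-- The components of the colimit of a sequence of pDG modules. -/
abbrev ColimObj (p : GMPerversity n) (i : ℤ) : Type u :=
  Module.DirectLimit (fun k => ((D.obj k).X.obj p).X i) (transition D p i)

/-- The canonical maps to the colimit. -/
noncomputable abbrev colimOf (p : GMPerversity n) (i : ℤ) (k : ℕ) :
    ((D.obj k).X.obj p).X i →ₗ[R] ColimObj D p i :=
  Module.DirectLimit.of R ℕ (fun k => ((D.obj k).X.obj p).X i) (transition D p i) k

/-- The structure morphisms of the colimit. -/
noncomputable def colimRes {p q : GMPerversity n} (h : p ≤ q) (i : ℤ) :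
    ColimObj D p i →ₗ[R] ColimObj D q i :=
  Module.DirectLimit.map (fun k => (D.obj k).X.res h i)
    fun _ _ _ => LinearMap.ext fun x => (Hom.lin_res _ h i x).symm

theorem colimRes_of {p q : GMPerversity n} (h : p ≤ q) (i : ℤ) (k : ℕ)
    (x : ((D.obj k).X.obj p).X i) :
    colimRes D h i (colimOf D p i k x) = colimOf D q i k ((D.obj k).X.res h i x) :=
  Module.DirectLimit.map_apply_of _ _ _

/-- The differentials of the colimit. -/
noncomputable def colimDiff (p : GMPerversity n) (i j : ℤ) : ColimObj D p i →ₗ[R] ColimObj D p j :=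
  Module.DirectLimit.map (fun k => (D.obj k).X.diff p i j)
    fun _ _ _ => LinearMap.ext fun x => (Hom.lin_diff _ p i j x).symm

theorem colimDiff_of (p : GMPerversity n) (i j : ℤ) (k : ℕ) (x : ((D.obj k).X.obj p).X i) :
    colimDiff D p i j (colimOf D p i k x) = colimOf D p j k ((D.obj k).X.diff p i j x) :=
  Module.DirectLimit.map_apply_of _ _ _

/-- The action of an element of `A` on the colimit. -/
noncomputable def colimSMulAux {p q r : GMPerversity n} (h : GMPerversity.SumLE p q r) {i j k : ℤ}
    (e : i + j = k) (a : (A.X.obj p).X i) : ColimObj D q j →ₗ[R] ColimObj D r k :=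
  Module.DirectLimit.map (fun l => (D.obj l).smul h e a)
    fun _ _ _ => LinearMap.ext fun x => (Hom.lin_smul _ h e a x).symm

theorem colimSMulAux_of {p q r : GMPerversity n} (h : GMPerversity.SumLE p q r) {i j k : ℤ}
    (e : i + j = k) (a : (A.X.obj p).X i) (l : ℕ) (x : ((D.obj l).X.obj q).X j) :
    colimSMulAux D h e a (colimOf D q j l x) = colimOf D r k l ((D.obj l).smul h e a x) :=
  Module.DirectLimit.map_apply_of _ _ _

/-- The action of `A` on the colimit. -/
noncomputable def colimSMul {p q r : GMPerversity n} (h : GMPerversity.SumLE p q r) {i j k : ℤ}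
    (e : i + j = k) : (A.X.obj p).X i →ₗ[R] ColimObj D q j →ₗ[R] ColimObj D r k where
  toFun := colimSMulAux D h e
  map_add' a b := LinearMap.ext fun x => by
    induction x using Module.DirectLimit.induction_on with
    | ih l x =>
      rw [LinearMap.add_apply, colimSMulAux_of, colimSMulAux_of, colimSMulAux_of, map_add,
        LinearMap.add_apply, map_add]
  map_smul' c a := LinearMap.ext fun x => by
    induction x using Module.DirectLimit.induction_on with
    | ih l x =>
      rw [RingHom.id_apply, LinearMap.smul_apply, colimSMulAux_of, colimSMulAux_of, map_smul,
        LinearMap.smul_apply, map_smul]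

theorem colimSMul_of {p q r : GMPerversity n} (h : GMPerversity.SumLE p q r) {i j k : ℤ}
    (e : i + j = k) (a : (A.X.obj p).X i) (l : ℕ) (x : ((D.obj l).X.obj q).X j) :
    colimSMul D h e a (colimOf D q j l x) = colimOf D r k l ((D.obj l).smul h e a x) :=
  colimSMulAux_of D h e a l x

/-- The perverse chain complex underlying the colimit. -/
noncomputable def colimPerverse : PerverseComplex R n :=
  PerverseComplex.ofRes (fun p i => ModuleCat.of R (ColimObj D p i)) (colimRes D) (colimDiff D)
    (fun p i x => by
      induction x using Module.DirectLimit.induction_on with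
      | ih l x => rw [colimRes_of, PerverseComplex.res_refl])
    (fun h h' i x => by
      induction x using Module.DirectLimit.induction_on with
      | ih l x => rw [colimRes_of, colimRes_of, colimRes_of, PerverseComplex.res_res])
    (fun h i j x => by
      induction x using Module.DirectLimit.induction_on with
      | ih l x => rw [colimRes_of, colimDiff_of, colimDiff_of, colimRes_of,
          PerverseComplex.diff_res])
    (fun p i j h x => by
      induction x using Module.DirectLimit.induction_on with
      | ih l x => rw [colimDiff_of, PerverseComplex.diff_eq_zero _ _ _ _ h, map_zero])
    (fun p i j k _ _ x => by
      induction x using Module.DirectLimit.induction_on with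
      | ih l x => rw [colimDiff_of, colimDiff_of, PerverseComplex.diff_diff, map_zero])

theorem colim_res_smul {p q r p' q' r' : GMPerversity n} (h : GMPerversity.SumLE p q r)
    (h' : GMPerversity.SumLE p' q' r') (hp : p ≤ p') (hq : q ≤ q') (hr : r ≤ r')
    {i j k : ℤ} (e : i + j = k) (a : (A.X.obj p).X i) (x : ColimObj D q j) :
    colimRes D hr k (colimSMul D h e a x) =
      colimSMul D h' e (A.X.res hp i a) (colimRes D hq j x) := by
  induction x using Module.DirectLimit.induction_on with
  | ih l x => rw [colimSMul_of, colimRes_of, colimRes_of, colimSMul_of,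
      (D.obj l).res_smul h h' hp hq hr]

theorem colim_one_smul {q r : GMPerversity n} (h : q ≤ r) {j : ℤ} (x : ColimObj D q j) :
    colimSMul D (GMPerversity.sumLE_zero_left h) (zero_add j) A.one x = colimRes D h j x := by
  induction x using Module.DirectLimit.induction_on with
  | ih l x => rw [colimSMul_of, colimRes_of, (D.obj l).one_smul]

theorem colim_mul_smul {p q r u v s : GMPerversity n} (h₁ : GMPerversity.SumLE p q u)
    (h₂ : GMPerversity.SumLE u r s) (h₃ : GMPerversity.SumLE q r v) (h₄ : GMPerversity.SumLE p v s)
    {i j k l m t : ℤ} (e₁ : i + j = l) (e₂ : l + k = t) (e₃ : j + k = m) (e₄ : i + m = t)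
    (a : (A.X.obj p).X i) (b : (A.X.obj q).X j) (x : ColimObj D r k) :
    colimSMul D h₂ e₂ (A.mul h₁ e₁ a b) x = colimSMul D h₄ e₄ a (colimSMul D h₃ e₃ b x) := by
  induction x using Module.DirectLimit.induction_on with
  | ih l x => rw [colimSMul_of, colimSMul_of, colimSMul_of,
      (D.obj l).mul_smul h₁ h₂ h₃ h₄ e₁ e₂ e₃ e₄]

theorem colim_leibniz {p q r : GMPerversity n} (h : GMPerversity.SumLE p q r)
    {i j k i' j' k' : ℤ} (e : i + j = k) (e₁ : i' + j = k') (e₂ : i + j' = k') (hk : k' + 1 = k)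
    (a : (A.X.obj p).X i) (x : ColimObj D q j) :
    colimDiff D r k k' (colimSMul D h e a x) =
      colimSMul D h e₁ (A.X.diff p i i' a) x +
        i.negOnePow • colimSMul D h e₂ a (colimDiff D q j j' x) := by
  induction x using Module.DirectLimit.induction_on with
  | ih l x => rw [colimSMul_of, colimDiff_of, colimSMul_of, colimDiff_of, colimSMul_of,
      (D.obj l).leibniz h e e₁ e₂ hk, map_add, map_zsmul_unit]

/-- The colimit of a sequence of pDG modules. -/
noncomputable def seqColim : PDGModule A where
  X := colimPerverse D
  smul h _ _ _ e := colimSMul D h e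
  res_smul h h' hp hq hr _ _ _ e a x := colim_res_smul D h h' hp hq hr e a x
  one_smul h _ x := colim_one_smul D h x
  mul_smul h₁ h₂ h₃ h₄ _ _ _ _ _ _ e₁ e₂ e₃ e₄ a b x :=
    colim_mul_smul D h₁ h₂ h₃ h₄ e₁ e₂ e₃ e₄ a b x
  leibniz h _ _ _ _ _ _ e e₁ e₂ hk a x := colim_leibniz D h e e₁ e₂ hk a x

/-- The canonical morphisms to the colimit. -/
noncomputable def toColim (k : ℕ) : D.obj k ⟶ seqColim D :=
  homOfLin (N := seqColim D) (fun p i => colimOf D p i k)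
    (fun h i x => (colimRes_of D h i k x).symm)
    (fun p i j _ x => (colimDiff_of D p i j k x).symm)
    (fun h _ _ _ e a x => (colimSMul_of D h e a k x).symm)

theorem exists_toColim {p : GMPerversity n} {i : ℤ} (x : ((seqColim D).X.obj p).X i) :
    ∃ k y, Hom.lin (toColim D k) p i y = x :=
  Module.DirectLimit.exists_of (R := R) (f := transition D p i) x

theorem map_toColim {k l : ℕ} (h : k ≤ l) : D.map (homOfLE h) ≫ toColim D l = toColim D k :=
  Hom.lin_ext fun p i x =>
    Module.DirectLimit.of_f (R := R) (f := transition D p i) (hij := h) (x := x)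

variable {D}

/-- Elements which agree in the colimit already agree at some finite stage, and the transition maps
to that stage are injective. -/
theorem toColim_injective
    (hD : ∀ k p i, Function.Injective (Hom.lin (D.map (homOfLE (Nat.le_succ k))) p i)) (k : ℕ)
    (p : GMPerversity n) (i : ℤ) : Function.Injective (Hom.lin (toColim D k) p i) := by
  have h : ∀ l (h : k ≤ l), Function.Injective (transition D p i k l h) := by
    intro l h
    induction l, h using Nat.le_induction with
    | base =>
      intro x y hxy
      rwa [DirectedSystem.map_self (f := (transition D p i · · ·)),
        DirectedSystem.map_self (f := (transition D p i · · ·))] at hxy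
    | succ l h ih =>
      intro x y hxy
      rw [← DirectedSystem.map_map (f := (transition D p i · · ·)) h l.le_succ,
        ← DirectedSystem.map_map (f := (transition D p i · · ·)) h l.le_succ] at hxy
      exact ih (hD l p i hxy)
  intro x y hxy
  obtain ⟨l, hl, hl'⟩ := Module.DirectLimit.exists_eq_of_of_eq (R := R) (f := transition D p i) hxy
  exact h l hl hl'

variable {M : PDGModule A}

section Desc

variable (c : ∀ k, D.obj k ⟶ M) (hc : ∀ k l (h : k ≤ l), D.map (homOfLE h) ≫ c l = c k)

/-- The components of `colimDesc`. -/
noncomputable def colimDescLin (hc : ∀ k l (h : k ≤ l), D.map (homOfLE h) ≫ c l = c k)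
    (p : GMPerversity n) (i : ℤ) : ((seqColim D).X.obj p).X i →ₗ[R] (M.X.obj p).X i :=
  Module.DirectLimit.lift R ℕ _ (transition D p i) (fun k => Hom.lin (c k) p i)
    fun k l h x => congrArg (fun f => Hom.lin f p i x) (hc k l h)

theorem colimDescLin_toColim (p : GMPerversity n) (i : ℤ) (k : ℕ) (x : ((D.obj k).X.obj p).X i) :
    colimDescLin c hc p i (Hom.lin (toColim D k) p i x) = Hom.lin (c k) p i x :=
  Module.DirectLimit.lift_of (f := transition D p i) (fun k => Hom.lin (c k) p i) _ x

/-- The morphism out of the colimit induced by a compatible family of morphisms. -/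
noncomputable def colimDesc : seqColim D ⟶ M :=
  homOfLin (colimDescLin c hc)
    (fun {p q} h i x => by
      obtain ⟨k, y, rfl⟩ := exists_toColim D x
      rw [← Hom.lin_res, colimDescLin_toColim, colimDescLin_toColim, Hom.lin_res])
    (fun p i j _ x => by
      obtain ⟨k, y, rfl⟩ := exists_toColim D x
      rw [← Hom.lin_diff, colimDescLin_toColim, colimDescLin_toColim, Hom.lin_diff])
    (fun {p q r} h {i j k} e a x => by
      obtain ⟨l, y, rfl⟩ := exists_toColim D x
      rw [← Hom.lin_smul, colimDescLin_toColim, colimDescLin_toColim, Hom.lin_smul])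

theorem lin_colimDesc (p : GMPerversity n) (i : ℤ) (k : ℕ) (x : ((D.obj k).X.obj p).X i) :
    Hom.lin (colimDesc c hc) p i (Hom.lin (toColim D k) p i x) = Hom.lin (c k) p i x :=
  colimDescLin_toColim c hc p i k x

end Desc

end PDGModule

end SequentialColimit

/-! ### Semi-free resolutions; cofibrant modules as retracts -/

section SemiFreeResolution

variable {R : Type u} [CommRing R] {n : ℕ} {A : PDGAlgebra.{u} R n}

namespace PDGModule

section Quotient

variable {N P X Y : PDGModule A}

/-- Two quotients of a pDG module with the same kernel are isomorphic. -/
theorem nonempty_iso_of_surjective (f : P ⟶ X) (g : P ⟶ Y)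
    (hf : ∀ p i, Function.Surjective (Hom.lin f p i))
    (hg : ∀ p i, Function.Surjective (Hom.lin g p i))
    (h : ∀ p i x, Hom.lin f p i x = 0 ↔ Hom.lin g p i x = 0) : Nonempty (X ≅ Y) := by
  have key : ∀ p i, ∃ l : (X.X.obj p).X i →ₗ[R] (Y.X.obj p).X i,
      ∀ x, l (Hom.lin f p i x) = Hom.lin g p i x := fun p i =>
    ⟨(LinearMap.ker (Hom.lin f p i)).liftQ (Hom.lin g p i) (fun x hx => (h p i x).1 hx) ∘ₗ
      ((Hom.lin f p i).quotKerEquivOfSurjective (hf p i)).symm.toLinearMap, fun x => by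
        have : ((Hom.lin f p i).quotKerEquivOfSurjective (hf p i)).symm (Hom.lin f p i x) =
            Submodule.Quotient.mk x := by
          rw [LinearEquiv.symm_apply_eq]
          rfl
        rw [LinearMap.comp_apply, LinearEquiv.coe_coe, this]
        rfl⟩
  choose l hl using key
  let φ : X ⟶ Y := homOfLin l
    (fun {p q} hpq i x => by
      obtain ⟨x, rfl⟩ := hf p i x
      rw [← Hom.lin_res, hl, hl, Hom.lin_res])
    (fun p i j _ x => by
      obtain ⟨x, rfl⟩ := hf p i x
      rw [← Hom.lin_diff, hl, hl, Hom.lin_diff])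
    (fun {p q r} hpq {i j k} e a x => by
      obtain ⟨x, rfl⟩ := hf q j x
      rw [← Hom.lin_smul, hl, hl, Hom.lin_smul])
  have hφ : ∀ p i x, Hom.lin φ p i (Hom.lin f p i x) = Hom.lin g p i x := hl
  refine ⟨isoOfBijective φ fun p i => ⟨?_, fun y => ?_⟩⟩
  · refine (injective_iff_map_eq_zero _).2 fun x hx => ?_
    obtain ⟨x, rfl⟩ := hf p i x
    rw [hφ] at hx
    exact (h p i x).2 hx
  · obtain ⟨x, rfl⟩ := hg p i y
    exact ⟨_, hφ p i x⟩

/-- The image of a morphism of pDG modules. -/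
def rangeSub (f : P ⟶ N) : Sub N where
  carrier p i := LinearMap.range (Hom.lin f p i)
  res_mem := by
    rintro p q h i _ ⟨x, rfl⟩
    exact ⟨P.X.res h i x, Hom.lin_res f h i x⟩
  diff_mem := by
    rintro p i j _ ⟨x, rfl⟩
    exact ⟨P.X.diff p i j x, Hom.lin_diff f p i j x⟩
  smul_mem := by
    rintro p q r h i j k e a _ ⟨x, rfl⟩
    exact ⟨P.smul h e a x, Hom.lin_smul f h e a x⟩

/-- The morphism from `P` to a quotient of its image. -/
def toQuotient (f : P ⟶ N) (S : Sub N) : P ⟶ (rangeSub f).quotient S :=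
  homOfLin (N := (rangeSub f).quotient S)
    (fun p i => (Submodule.submoduleOf (S.carrier p i) ((rangeSub f).carrier p i)).mkQ ∘ₗ
      (Hom.lin f p i).rangeRestrict)
    (fun h i x => congrArg Submodule.Quotient.mk (Subtype.ext (Hom.lin_res f h i x)))
    (fun p i j _ x => congrArg Submodule.Quotient.mk (Subtype.ext (Hom.lin_diff f p i j x)))
    (fun h _ _ _ e a x =>
      congrArg Submodule.Quotient.mk (Subtype.ext (Hom.lin_smul f h e a x)))

theorem toQuotient_surjective (f : P ⟶ N) (S : Sub N) (p : GMPerversity n) (i : ℤ) :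
    Function.Surjective (Hom.lin (toQuotient f S) p i) :=
  (Submodule.mkQ_surjective _).comp (LinearMap.surjective_rangeRestrict _)

theorem toQuotient_eq_zero (f : P ⟶ N) (S : Sub N) (p : GMPerversity n) (i : ℤ)
    (x : (P.X.obj p).X i) :
    Hom.lin (toQuotient f S) p i x = 0 ↔ Hom.lin f p i x ∈ S.carrier p i :=
  Submodule.Quotient.mk_eq_zero _

end Quotient

variable (M : PDGModule A)

/-- A chosen cell attachment. -/
noncomputable def attach {F : PDGModule A} {M : PDGModule A} (φ : F ⟶ M) : CellAttachment φ :=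
  (nonempty_cellAttachment φ).some

/-- The stages of the semi-free resolution of `M`, obtained from `0` by attaching cells. -/
noncomputable def stage : ℕ → Σ F : PDGModule A, F ⟶ M
  | 0 => ⟨zeroModule A, (zeroModuleIsInitial A).to M⟩
  | k + 1 => ⟨(attach (stage k).2).obj, (attach (stage k).2).desc⟩

/-- The cell attachment leading to the next stage. -/
noncomputable def stageAttachment (k : ℕ) : CellAttachment (stage M k).2 := attach (stage M k).2

/-- The inclusion of a stage into the next one. -/
noncomputable def stageIncl (k : ℕ) : (stage M k).1 ⟶ (stage M (k + 1)).1 :=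
  (stageAttachment M k).incl

/-- The sequence of stages. -/
noncomputable def stages : ℕ ⥤ PDGModule A :=
  Functor.ofSequence (stageIncl M)

theorem stages_map_succ (k : ℕ) : (stages M).map (homOfLE k.le_succ) = stageIncl M k :=
  Functor.ofSequence_map_homOfLE_succ _ k

theorem stageIncl_comp (k : ℕ) : stageIncl M k ≫ (stage M (k + 1)).2 = (stage M k).2 :=
  (stageAttachment M k).incl_desc

theorem stages_map_comp (k l : ℕ) (h : k ≤ l) :
    (stages M).map (homOfLE h) ≫ (stage M l).2 = (stage M k).2 := by
  induction l, h using Nat.le_induction with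
  | base => exact (congrArg (· ≫ (stage M k).2) ((stages M).map_id k)).trans (Category.id_comp _)
  | succ l h ih =>
    have h₁ := (stages M).map_comp (homOfLE h) (homOfLE l.le_succ)
    rw [stages_map_succ] at h₁
    exact (congrArg (· ≫ (stage M (l + 1)).2) h₁).trans ((Category.assoc _ _ _).trans
      ((congrArg ((stages M).map (homOfLE h) ≫ ·) (stageIncl_comp M l)).trans ih))

/-- The semi-free resolution of `M`. -/
noncomputable def resolution : PDGModule A := seqColim (stages M)

/-- The inclusion of a stage into the resolution. -/
noncomputable def stageι (k : ℕ) : (stage M k).1 ⟶ resolution M := toColim (stages M) k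

/-- The augmentation of the semi-free resolution. -/
noncomputable def augmentation : resolution M ⟶ M :=
  colimDesc (D := stages M) (fun k => (stage M k).2) (stages_map_comp M)

variable {M}

theorem augmentation_stageι {p : GMPerversity n} {i : ℤ} (k : ℕ)
    (x : ((stage M k).1.X.obj p).X i) :
    Hom.lin (augmentation M) p i (Hom.lin (stageι M k) p i x) = Hom.lin (stage M k).2 p i x :=
  lin_colimDesc (D := stages M) _ _ p i k x

theorem stageι_stageIncl {p : GMPerversity n} {i : ℤ} (k : ℕ)
    (x : ((stage M k).1.X.obj p).X i) :
    Hom.lin (stageι M (k + 1)) p i (Hom.lin (stageIncl M k) p i x) =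
      Hom.lin (stageι M k) p i x := by
  have h := map_toColim (stages M) k.le_succ
  rw [stages_map_succ] at h
  exact congrArg (fun f => Hom.lin f p i x) h

theorem stageι_injective (k : ℕ) (p : GMPerversity n) (i : ℤ) :
    Function.Injective (Hom.lin (stageι M k) p i) :=
  toColim_injective (fun k p i => by
    rw [stages_map_succ]
    exact (stageAttachment M k).incl_injective p i) k p i

theorem exists_stageι {p : GMPerversity n} {i : ℤ} (x : ((resolution M).X.obj p).X i) :
    ∃ k y, Hom.lin (stageι M k) p i y = x :=
  exists_toColim (stages M) x

theorem stage_exists_diff_eq (k : ℕ) {p : GMPerversity n} {i j : ℤ} (h : j + 1 = i)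
    (z : ((stage M k).1.X.obj p).X j) (hz : ∀ l, (stage M k).1.X.diff p j l z = 0)
    (m : (M.X.obj p).X i) (hm : M.X.diff p i j m = Hom.lin (stage M k).2 p j z) :
    ∃ e : ((stage M (k + 1)).1.X.obj p).X i,
      (stage M (k + 1)).1.X.diff p i j e = Hom.lin (stageIncl M k) p j z ∧
        Hom.lin (stage M (k + 1)).2 p i e = m :=
  (stageAttachment M k).exists_diff_eq p i j h z hz m hm

/-- The filtration consists of the images of the stages, the first of which is the zero module. -/
theorem isSemiFree_resolution (M : PDGModule A) : (resolution M).IsSemiFree := by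
  refine ⟨fun k => rangeSub (stageι M k), fun p i => ?_, fun k p i => ?_, fun p i x => ?_,
    fun k => ⟨(stageAttachment M k).K, (stageAttachment M k).isFree,
      (stageAttachment M k).d_eq_zero, ?_⟩⟩
  · refine (Submodule.eq_bot_iff _).2 ?_
    rintro _ ⟨x, rfl⟩
    have hx : x = 0 := Subsingleton.elim (α := PUnit) _ _
    rw [hx, map_zero]
  · rintro _ ⟨x, rfl⟩
    exact ⟨_, stageι_stageIncl k x⟩
  · exact exists_stageι x
  -- The filtration quotient and `A ⊠ K` are both quotients of stage `k + 1`; as the stages embed in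
  -- the colimit, both kernels are the image of stage `k`.
  · refine nonempty_iso_of_surjective (toQuotient (stageι M (k + 1)) (rangeSub (stageι M k)))
      (stageAttachment M k).proj (toQuotient_surjective _ _)
      (stageAttachment M k).proj_surjective fun p i x => ?_
    refine (toQuotient_eq_zero _ _ p i x).trans
      (Iff.trans ?_ ((stageAttachment M k).exact p i x).symm)
    constructor
    · rintro ⟨y, hy⟩
      exact ⟨y, stageι_injective (k + 1) p i ((stageι_stageIncl k y).trans hy)⟩
    · rintro ⟨y, rfl⟩
      exact ⟨y, (stageι_stageIncl k y).symm⟩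

/-- Two attachments reach any `m`. The cell `(0, d m)` at stage 0 yields a cycle `e` of stage 1
lying over `d m`; then the cell `(e, m)` yields an element of stage 2 lying over `m`. -/
theorem augmentation_surjective (p : GMPerversity n) (i : ℤ) :
    Function.Surjective (Hom.lin (augmentation M) p i) := by
  intro m
  obtain ⟨e, he, hem⟩ := stage_exists_diff_eq 0 (p := p) (i := i - 1) (j := i - 1 - 1) (by omega) 0
    (fun _ => map_zero _) (M.X.diff p i (i - 1) m) (by rw [M.X.diff_diff, map_zero])
  rw [map_zero] at he
  obtain ⟨e', -, he'⟩ := stage_exists_diff_eq 1 (p := p) (i := i) (j := i - 1) (by omega) e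
    (fun l => by
      by_cases hl : l = i - 1 - 1
      · subst hl
        exact he
      · exact PerverseComplex.diff_eq_zero _ _ _ _ (by omega) _) m hem.symm
  exact ⟨Hom.lin (stageι M 2) p i e', (augmentation_stageι 2 e').trans he'⟩

/-- A cycle of the kernel comes from an element `z` of some stage, which is a cycle there because
the stage embeds in the colimit. The cell `(z, 0)` makes it the boundary, at the next stage, of an
element that maps to zero in `M`. -/
theorem isAcyclic_ker_augmentation : (kerSub (augmentation M)).toModule.X.IsAcyclic := by
  refine fun p => (ChainComplex.acyclic_iff_forall_exists _).2 fun i j k hi hk x hx => ?_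
  obtain ⟨l, z, hz⟩ := exists_stageι x.1
  have hzd : ∀ t, (stage M l).1.X.diff p j t z = 0 := by
    intro t
    by_cases ht : t = k
    · subst ht
      refine stageι_injective l p t ?_
      rw [Hom.lin_diff, hz, map_zero]
      exact congrArg Subtype.val hx
    · exact PerverseComplex.diff_eq_zero _ _ _ _ (by omega) _
  have hz0 : Hom.lin (stage M l).2 p j z = 0 := by
    rw [← augmentation_stageι, hz]
    exact x.2
  obtain ⟨e, he, he0⟩ := stage_exists_diff_eq l hi z hzd 0 (by rw [map_zero, hz0])
  refine ⟨⟨Hom.lin (stageι M (l + 1)) p i e, (augmentation_stageι _ e).trans he0⟩,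
    Subtype.ext ?_⟩
  refine (Hom.lin_diff (stageι M (l + 1)) p i j e).symm.trans ?_
  rw [he, stageι_stageIncl, hz]

/-- The augmentation is a trivial fibration, so the identity of `M` lifts through it; the lift is a
section. -/
theorem exists_retract_of_isCofibrant (hM : IsCofibrant M) :
    ∃ N : PDGModule A, N.IsSemiFree ∧ Nonempty (Retract M N) := by
  obtain ⟨s, hs⟩ := exists_lift_of_isCofibrant hM (augmentation M)
    (trivialFibrations_of_isAcyclic_ker augmentation_surjective isAcyclic_ker_augmentation) (𝟙 M)
  exact ⟨resolution M, isSemiFree_resolution M, ⟨⟨s, augmentation M, hs⟩⟩⟩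

end PDGModule

end SemiFreeResolution

theorem theoremB {R : Type u} [CommRing R] {n : ℕ} (A : PDGAlgebra.{u} R n) (M : PDGModule A) :
    [M.IsSemiProjective,
      IsCofibrant M,
      ∃ N : PDGModule A, N.IsSemiFree ∧ Nonempty (Retract M N)].TFAE := by
  tfae_have 1 → 2 := fun h => h.isCofibrant
  tfae_have 2 → 3 := PDGModule.exists_retract_of_isCofibrant
  tfae_have 3 → 1 := fun ⟨_, hN, ⟨r⟩⟩ => hN.isSemiProjective.of_retract r
  tfae_finish
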